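/- **Setting.** Let $d\ge 1$, $K\ge 2$, $\mathcal X=[0,1]^d$, and let $B(x,r)$ be the closed $\ell_\infty$-ball. A problem instance consists of two probability measures $Q_X,P_X$ on $\mathcal X$ (target and source covariate laws), for each arm $k\in[K]$ a conditional law on $[0,1]$ of the reward of arm $k$ given the covariate $x$, common to target and source, with mean $f_k(x)$, and a conditional law $\mu(\cdot\,|\,x)$ on $[K]$. The source sample consists of $n_P$ i.i.d. triples (covariate from $P_X$, arm from $\mu(\cdot\,|\,x)$, reward of that arm). In each of $n_Q$ target rounds an independent covariate $X_t\sim Q_X$ is observed, a (possibly randomized) policy $\pi$ pulls an arm $\pi_t$ depending on $X_t$, the source sample and the past target rounds, and the reward of that arm is observed. The expected regret is $\mathbb E[R_{n_Q}(\pi)]=\mathbb E\sum_{t=1}^{n_Q}\big(\max_k f_k(X_t)-f_{\pi_t}(X_t)\big)$. Let $f_{(1)}=\max_kf_k$ pointwise, and let $f_{(2)}(x)$ be the largest of the values $f_k(x)$ strictly below $f_{(1)}(x)$, or $f_{(1)}(x)$ if there is none. A function $f$ is self-similar under a probability measure $\nu$ with parameters $l_0,b$ if for every integer $l\ge l_0$,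 $$\max_{B}\ \sup_{x\in B}\big|\Gamma_l f(x;B,\nu)-f(x)\big|\ge b\,2^{-\beta l},$$ where $B$ runs over the closed dyadic cubes of side $2^{-l}$ in $\mathcal X$ with $\nu(B)>0$ and $\Gamma_l f(x;B,\nu)$ is the constant $g$ minimizing $\int |f(u)-g|^2\,\mathbf 1\{\|x-u\|_\infty\le 2^{-l}\}\,\nu(du\,|\,B)$. The class $\Pi(K,\beta,C_\beta,\alpha,C_\alpha,\underline q,\overline q,\gamma,c_\gamma,\kappa,l_0,b)$ consists of the instances such that: 1. $|f_k(x)-f_k(x')|\le C_\beta\|x-x'\|_\infty^\beta$ for all $k,x,x'$; 2. $Q_X(0<f_{(1)}-f_{(2)}\le\delta)\le C_\alpha\delta^\alpha$ for all $0<\delta\le1$; 3. $\underline q r^d\le Q_X(B(x,r))\le\overline q r^d$ for all $x\in\operatorname{supp}Q_X$, $r\in(0,1]$; 4. $\gamma\in[0,\infty]$ is the transfer exponent: $P_X(B(x,r))\ge c_\gamma r^\gamma Q_X(B(x,r))$ for all $x\in\operatorname{supp}Q_X$, $r\in(0,1]$ (no condition if $\gamma=\infty$), and no smaller exponent satisfies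 this with any constant in $(0,1]$; 5. $\kappa=\inf_{k\in[K],\,x\in\operatorname{supp}Q_X}K\mu(k\,|\,x)$; 6. some $f_k$ is self-similar under both $Q_X$ and $P_X$ with parameters $l_0,b$. **Theorem.** Let $\beta\in(0,1]$, $C_\beta>0$, $0<\underline q\le1$ and $\overline q>2^d$. There are constants $b>0$ and $C_0>0$ depending only on $\beta,C_\beta,\underline q,\overline q,d$ such that the following holds. Let $\alpha\ge0$ with $\alpha\beta\le d$, let $C_\alpha>0$, with $C_\alpha\ge C_0$ in the case $\alpha\beta=d$, and let $K\ge2$, $\gamma\in[0,\infty]$, $c_\gamma\in(0,1]$, $\kappa\in[0,1]$, $l_0\ge0$. Then there is a constant $c_1>0$, independent of $n_Q$ and $n_P$, such that for all integers $n_Q,n_P\ge0$ $$\inf_\pi\ \sup_{\Pi(K,\beta,C_\beta,\alpha,C_\alpha,\underline q,\overline q,\gamma,c_\gamma,\kappa,l_0,b)}\mathbb E[R_{n_Q}(\pi)]\ \ge\ c_1\,n_Q\Big(n_Q+(\kappa n_P)^{\frac{d+2\beta}{d+2\beta+\gamma}}\Big)^{-\frac{\beta(1+\alpha)}{2\beta+d}},$$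 where for $\gamma=\infty$ the inner exponent is $0$ and $(\kappa n_P)^0=1$. -/

import Mathlib

open MeasureTheory ProbabilityTheory
open scoped ENNReal

namespace TransferBandit

noncomputable section

/-- The covariate space `[0,1]^d`. Its metric is the sup-norm distance, so `Metric.closedBall x r`
is the sup-norm ball of radius `r` about `x` intersected with `[0,1]^d`. -/
abbrev Cube (d : ℕ) : Type := Fin d → unitInterval

/-- One round of observed data: covariate, pulled arm, reward in `[0,1]` of the pulled arm. -/
abbrev Obs (d K : ℕ) : Type := Cube d × Fin K × unitInterval

/-- A pair of `K`-armed contextual bandits (target `Q`, source `P`) under covariate shift, together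
with the behaviour policy that collected the source data. `reward (x, k)` is the conditional law
of the reward of arm `k` given the covariate `x`; it is common to the two bandits. Only the reward
of the pulled arm is ever observed, so these arm-wise conditional laws determine everything. -/
structure Bandit (d K : ℕ) where
  /-- marginal law of the target covariates -/
  QX : Measure (Cube d)
  /-- marginal law of the source covariates -/
  PX : Measure (Cube d)
  /-- conditional law of the reward given covariate and arm -/
  reward : Kernel (Cube d × Fin K) unitInterval
  /-- conditional law of the arm pulled in the source data given the covariate -/
  behav : Kernel (Cube d) (Fin K)
  isProbQX : IsProbabilityMeasure QX
  isProbPX : IsProbabilityMeasure PX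
  isMarkovReward : IsMarkovKernel reward
  isMarkovBehav : IsMarkovKernel behav

attribute [instance] Bandit.isProbQX Bandit.isProbPX Bandit.isMarkovReward Bandit.isMarkovBehav

/-- What is known before the covariate of round `t` (counted from `0`) of the target bandit is
seen: the whole source sample and the first `t` rounds of target data. -/
abbrev Hist (d K nP t : ℕ) : Type := (Fin nP → Obs d K) × (Fin t → Obs d K)

/-- A (possibly randomized) policy: the law of the arm pulled in round `t` given the source sample,
the past target data and the current covariate. -/
structure Policy (d K nP : ℕ) where
  act : (t : ℕ) → Kernel (Hist d K nP t × Cube d) (Fin K)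
  isMarkovAct : ∀ t, IsMarkovKernel (act t)

attribute [instance] Policy.isMarkovAct

namespace Bandit

variable {d K : ℕ}

/-- The reward function `f_k`. -/
def f (M : Bandit d K) (k : Fin K) (x : Cube d) : ℝ := ∫ y, (y : ℝ) ∂(M.reward (x, k))

/-- The pointwise maximum of the reward functions. -/
def fmax (M : Bandit d K) (x : Cube d) : ℝ := ⨆ k, M.f k x

open Classical in
/-- The second pointwise maximum of the reward functions: the largest value strictly below the
maximum if the values are not all equal, and the maximum otherwise. -/
def fsnd (M : Bandit d K) (x : Cube d) : ℝ :=
  if ∃ k, M.f k x < M.fmax x then sSup {v | v < M.fmax x ∧ ∃ k, M.f k x = v} else M.fmax x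

/-- The law of one source observation. -/
def sourceLaw (M : Bandit d K) : Measure (Obs d K) := M.PX ⊗ₘ (M.behav ⊗ₖ M.reward)

/-- The conditional law of the next target observation given the history: a fresh covariate from
`QX`, an arm chosen by the policy, a reward from the law of that arm at that covariate. -/
def stepKernel (M : Bandit d K) {nP : ℕ} (π : Policy d K nP) (t : ℕ) :
    Kernel (Hist d K nP t) (Obs d K) :=
  Kernel.const (Hist d K nP t) M.QX ⊗ₖ
    (π.act t ⊗ₖ M.reward.comap
      (fun z : (Hist d K nP t × Cube d) × Fin K => (z.1.2, z.2)) (by fun_prop))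

/-- The joint law of the source sample (`nP` i.i.d. observations) and of the first `t` rounds of
target data under the policy `π`. -/
def law (M : Bandit d K) {nP : ℕ} (π : Policy d K nP) : (t : ℕ) → Measure (Hist d K nP t)
  | 0 => (Measure.pi fun _ : Fin nP => M.sourceLaw).map fun p => (p, Fin.elim0)
  | t + 1 => (M.law π t ⊗ₘ M.stepKernel π t).map
      fun w => (w.1.1, Fin.snoc (α := fun _ => Obs d K) w.1.2 w.2)

/-- The expected cumulative regret of the policy `π` over `nQ` rounds. -/
def regret (M : Bandit d K) {nP : ℕ} (π : Policy d K nP) (nQ : ℕ) : ℝ≥0∞ :=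
  ∫⁻ ω, ∑ t : Fin nQ, ENNReal.ofReal (M.fmax (ω.2 t).1 - M.f (ω.2 t).2.1 (ω.2 t).1) ∂(M.law π nQ)

end Bandit

/-- `P_X(B(x,r)) ≥ c r^γ Q_X(B(x,r))` for all `x ∈ supp Q_X` and `r ∈ (0,1]`. It holds vacuously
when `γ = ∞`. -/
def TransferCond {d : ℕ} (QX PX : Measure (Cube d)) (γ : ℝ≥0∞) (c : ℝ) : Prop :=
  γ ≠ ⊤ → ∀ x ∈ QX.support, ∀ r : ℝ, 0 < r → r ≤ 1 →
    c * r ^ γ.toReal * QX.real (Metric.closedBall x r) ≤ PX.real (Metric.closedBall x r)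

/-- `γ` is the transfer exponent of `PX` with respect to `QX`, with constant `cγ`: the inequality
holds for `γ` with the constant `cγ`, and `γ` is the smallest exponent for which it holds with
some constant in `(0,1]`. -/
def IsTransferExponent {d : ℕ} (QX PX : Measure (Cube d)) (γ : ℝ≥0∞) (cγ : ℝ) : Prop :=
  TransferCond QX PX γ cγ ∧
    ∀ (γ' : ℝ≥0∞) (c' : ℝ), 0 < c' → c' ≤ 1 → TransferCond QX PX γ' c' → γ ≤ γ'

/-- The dyadic closed bin of side length `2^{-l}` with index `k` (counted from `0`). -/
def bin {d : ℕ} (l : ℕ) (k : Fin d → Fin (2 ^ l)) : Set (Cube d) :=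
  {x | ∀ i, ((k i : ℕ) : ℝ) / 2 ^ l ≤ (x i : ℝ) ∧ (x i : ℝ) ≤ (((k i : ℕ) : ℝ) + 1) / 2 ^ l}

/-- Value of a polynomial in `d` variables at a point of the cube. -/
def polyEval {d : ℕ} (g : MvPolynomial (Fin d) ℝ) (x : Cube d) : ℝ :=
  MvPolynomial.eval (fun i => (x i : ℝ)) g

/-- The squared error `∫_B |f(u) - g(u)|² 1{‖x - u‖_∞ ≤ h} μ(du | B)`. -/
def localError {d : ℕ} (μ : Measure (Cube d)) (f : Cube d → ℝ) (B : Set (Cube d)) (h : ℝ)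
    (x : Cube d) (g : MvPolynomial (Fin d) ℝ) : ℝ :=
  ∫ u in Metric.closedBall x h, |f u - polyEval g u| ^ 2 ∂(ProbabilityTheory.cond μ B)

/-- `g` is an `L₂(μ)`-projection, local at `x` with bandwidth `h`, of `f` on the polynomials of
degree at most `p` over the bin `B`. The value of this projection at `x` is `polyEval g x`. -/
def IsLocalProj {d : ℕ} (p : ℕ) (h : ℝ) (f : Cube d → ℝ) (B : Set (Cube d))
    (μ : Measure (Cube d)) (x : Cube d) (g : MvPolynomial (Fin d) ℝ) : Prop :=
  g.totalDegree ≤ p ∧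
    ∀ g' : MvPolynomial (Fin d) ℝ, g'.totalDegree ≤ p →
      localError μ f B h x g ≤ localError μ f B h x g'

/-- Self-similarity of a function under `μ` at smoothness `β` with parameters `l₀` and `b`: for
every integer `l ≥ l₀`, the maximum over the bins `B` of side `2^{-l}` of the supremum over `x ∈ B`
of `|Γ f(x) - f(x)|` is at least `b 2^{-β l}`, where `Γ` is the local projection of degree `0` and
bandwidth `2^{-l}`. Bins of `μ`-measure zero, for which `Γ` is undefined, do not count. -/
def SelfSimilar {d : ℕ} (β l₀ b : ℝ) (μ : Measure (Cube d)) (f : Cube d → ℝ) : Prop :=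
  ∀ l : ℕ, l₀ ≤ (l : ℝ) →
    ENNReal.ofReal (b * (2 : ℝ) ^ (-(β * (l : ℝ)))) ≤
      ⨆ (k : Fin d → Fin (2 ^ l)) (_ : 0 < μ (bin l k)) (x ∈ bin l k)
        (g : MvPolynomial (Fin d) ℝ)
        (_ : IsLocalProj 0 ((2 : ℝ) ^ (-(l : ℝ))) f (bin l k) μ x g),
        ENNReal.ofReal |polyEval g x - f x|

/-- The class of self-similar transfer-learning problems with the given parameters. -/
structure InClass {d K : ℕ} (β Cβ α Cα qlo qhi : ℝ) (γ : ℝ≥0∞) (cγ κ l₀ b : ℝ)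
    (M : Bandit d K) : Prop where
  /-- Hölder smoothness of the reward functions -/
  smooth : ∀ k x x', |M.f k x - M.f k x'| ≤ Cβ * dist x x' ^ β
  /-- margin condition -/
  margin : ∀ δ : ℝ, 0 < δ → δ ≤ 1 →
    M.QX.real {x | 0 < M.fmax x - M.fsnd x ∧ M.fmax x - M.fsnd x ≤ δ} ≤ Cα * δ ^ α
  /-- bounded density -/
  density : ∀ x ∈ M.QX.support, ∀ r : ℝ, 0 < r → r ≤ 1 →
    qlo * r ^ d ≤ M.QX.real (Metric.closedBall x r) ∧
      M.QX.real (Metric.closedBall x r) ≤ qhi * r ^ d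
  /-- transfer exponent -/
  transfer : IsTransferExponent M.QX M.PX γ cγ
  /-- `κ` is the exploration coefficient, the infimum of `K μ(k | x)` over arms and `supp Q_X` -/
  explore : IsGLB {v : ℝ | ∃ k : Fin K, ∃ x ∈ M.QX.support, v = K * (M.behav x).real {k}} κ
  /-- some reward function is self-similar under both covariate laws -/
  selfSimilar : ∃ k, SelfSimilar β l₀ b M.QX (M.f k) ∧ SelfSimilar β l₀ b M.PX (M.f k)

/-- The exponent `(d + 2β) / (d + 2β + γ)`, which is `0` when `γ = ∞`. -/
def sourceExponent (d : ℕ) (β : ℝ) (γ : ℝ≥0∞) : ℝ :=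
  if γ = ⊤ then 0 else (d + 2 * β) / (d + 2 * β + γ.toReal)

end

end TransferBandit

/-! ### Change of measure for adaptively collected data, and Le Cam's inequality. -/

namespace TransferBandit

open Finset

/-! The proof is an Assouad argument over a grid. The target law is uniform on `N ^ d` small cells
separated by gaps of width `2w`, with `w` of order `1/N`. All arms share the mean `base`, except arm
`k₁`, which is shifted by `±Δ`, `Δ = c₀ w ^ β`, on `m` selected cells and by `0` on the others. On a
selected cell, either `k₁` or all the other arms lose `Δ`, depending on a hidden sign. The gaps
leave room for the shift to change from cell to cell while staying `β`-Hölder. The margin condition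
caps the number of signs: `m N ^ (-d)` must be at most `Cα Δ ^ α`, so `m` is taken of order `N ^ (d
- αβ)`.

Flipping one sign changes the reward law only for arm `k₁` in one cell, so the Hellinger affinity of
one observation is at least `1 - 16 Δ²` times the chance of seeing that arm and cell. That chance is
at most `N ^ (-d)` for a target round. For a source observation it is at most `κ` times the source
mass of the cell. Affinities multiply along the data even for adaptive policies (`affinity_le`),
because the policy is the same under both signs and drops out of the likelihood ratio. If `nQ Δ² N ^
(-d)` and `nP κ Δ² P(cell)` are small, no policy learns a sign, and `assouad` gives regret of order
`nQ m Δ N ^ (-d)`, that is `nQ N ^ (-β(1+α))`.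

The delicate object is the source law (`exists_source`). It must have transfer exponent exactly `γ`
and yet give each selected cell only mass of order `N ^ (-γ-d)`. For `0 < γ < ∞` it has density
proportional to `min(‖x‖, C/N) ^ γ` on the cells, and puts the remaining mass on the midpoints of
the gaps, where the shift vanishes and nothing is learned. At scales up to order `1/N` the density
supplies the required mass; at larger scales the lattice of midpoints imitates the target law. The
decay of the density at `0` shows that no smaller exponent works. For `γ = ∞` a point mass at `0`
serves, for `γ = 0` the target law itself.

Self-similarity is independent of the signs: `base` has a cusp `c₁ ‖x‖ ^ β` at `0`, and both
covariate laws charge every neighbourhood of `0`, so the mean of `base` over the corner bin misses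
its value at one of two opposite corners.

Finally `N` is of order `(nQ + (κ nP) ^ ((d+2β)/(d+2β+γ))) ^ (1/(d+2β))`, the smallest order for
which both information budgets are respected. -/

/-- Appending a last entry to a finite sequence is measurable. -/
lemma measurable_finSnoc {α : Type*} [MeasurableSpace α] (n : ℕ) :
    Measurable fun w : (Fin n → α) × α => (Fin.snoc (α := fun _ => α) w.1 w.2 : Fin (n + 1) → α) := by
  refine measurable_pi_iff.2 fun i => ?_
  induction i using Fin.lastCases with
  | last => simpa using measurable_snd
  | cast i =>
    simp only [Fin.snoc_castSucc]
    exact (measurable_pi_apply i).comp measurable_fst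

/-- The integral over a finite product measure of a product of functions of one coordinate each. -/
lemma lintegral_pi_prod {ι α : Type*} [Fintype ι] [MeasurableSpace α] (μ : Measure α)
    [IsProbabilityMeasure μ] (g : ι → α → ℝ≥0∞) (hg : ∀ i, Measurable (g i)) :
    ∫⁻ ω, ∏ i, g i (ω i) ∂(Measure.pi fun _ : ι => μ) = ∏ i, ∫⁻ x, g i x ∂μ := by
  rw [lintegral_prod_eq_prod_lintegral_of_indepFun Finset.univ (fun i (ω : ι → α) => g i (ω i))
    (iIndepFun_pi (X := g) fun i => (hg i).aemeasurable)
    (fun i => (hg i).comp (measurable_pi_apply i))]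
  refine Finset.prod_congr rfl fun i _ => ?_
  exact (measurePreserving_eval (fun _ : ι => μ) i).lintegral_comp (hg i)

/-- A finite product of copies of a measure with a density has the product density. -/
lemma pi_withDensity_const {ι α : Type*} [Fintype ι] [MeasurableSpace α] (μ : Measure α)
    [IsProbabilityMeasure μ] (g : α → ℝ≥0∞) (hg : Measurable g)
    [IsProbabilityMeasure (μ.withDensity g)] :
    (Measure.pi fun _ : ι => μ.withDensity g) =
      (Measure.pi fun _ : ι => μ).withDensity fun ω => ∏ i, g (ω i) := by
  refine (Measure.pi_eq fun s hs => ?_)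
  rw [withDensity_apply _ (MeasurableSet.univ_pi hs),
    ← lintegral_indicator (MeasurableSet.univ_pi hs)]
  have : ∀ ω : ι → α, (Set.univ.pi s).indicator (fun ω => ∏ i, g (ω i)) ω =
      ∏ i, (s i).indicator g (ω i) := by
    intro ω
    by_cases h : ω ∈ Set.univ.pi s
    · rw [Set.indicator_of_mem h]
      exact Finset.prod_congr rfl fun i _ => (Set.indicator_of_mem (h i trivial) g).symm
    · rw [Set.indicator_of_notMem h]
      simp only [Set.mem_univ_pi, not_forall] at h
      obtain ⟨i, hi⟩ := h
      exact (Finset.prod_eq_zero (Finset.mem_univ i) (Set.indicator_of_notMem hi g)).symm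
  simp_rw [this]
  rw [lintegral_pi_prod μ (fun i => (s i).indicator g) fun i => hg.indicator (hs i)]
  refine Finset.prod_congr rfl fun i _ => ?_
  rw [lintegral_indicator (hs i), withDensity_apply _ (hs i)]

namespace Bandit

variable {d K nP : ℕ}

instance (M : Bandit d K) : IsProbabilityMeasure M.sourceLaw := by
  unfold sourceLaw; infer_instance

instance (M : Bandit d K) (π : Policy d K nP) (t : ℕ) : IsMarkovKernel (M.stepKernel π t) := by
  have : IsMarkovKernel (M.reward.comap
      (fun z : (Hist d K nP t × Cube d) × Fin K => (z.1.2, z.2)) (by fun_prop)) :=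
    Kernel.IsMarkovKernel.comap _ _
  unfold stepKernel; infer_instance

/-- The map that appends an observation to the target data. -/
lemma measurable_append (t : ℕ) :
    Measurable fun w : Hist d K nP t × Obs d K =>
      ((w.1.1, Fin.snoc (α := fun _ => Obs d K) w.1.2 w.2) : Hist d K nP (t + 1)) :=
  (measurable_fst.comp measurable_fst).prodMk
    ((measurable_finSnoc t).comp ((measurable_snd.comp measurable_fst).prodMk measurable_snd))

lemma measurable_start :
    Measurable fun p : Fin nP → Obs d K =>
      ((p, Fin.elim0) : Hist d K nP 0) :=
  measurable_id.prodMk measurable_const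

instance (M : Bandit d K) (π : Policy d K nP) (t : ℕ) : IsProbabilityMeasure (M.law π t) := by
  induction t with
  | zero => exact Measure.isProbabilityMeasure_map measurable_start.aemeasurable
  | succ t ih => exact Measure.isProbabilityMeasure_map (measurable_append t).aemeasurable

lemma lintegral_sourceLaw (M : Bandit d K) {F : Obs d K → ℝ≥0∞} (hF : Measurable F) :
    ∫⁻ o, F o ∂M.sourceLaw =
      ∫⁻ x, ∫⁻ k, ∫⁻ y, F (x, k, y) ∂M.reward (x, k) ∂M.behav x ∂M.PX := by
  rw [sourceLaw, Measure.lintegral_compProd hF]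
  refine lintegral_congr fun x => ?_
  exact Kernel.lintegral_compProd _ _ _ (hF.comp measurable_prodMk_left)

lemma lintegral_stepKernel (M : Bandit d K) (π : Policy d K nP) (t : ℕ) (h : Hist d K nP t)
    {F : Obs d K → ℝ≥0∞} (hF : Measurable F) :
    ∫⁻ o, F o ∂M.stepKernel π t h =
      ∫⁻ x, ∫⁻ k, ∫⁻ y, F (x, k, y) ∂M.reward (x, k) ∂π.act t (h, x) ∂M.QX := by
  have : IsMarkovKernel (M.reward.comap
      (fun z : (Hist d K nP t × Cube d) × Fin K => (z.1.2, z.2)) (by fun_prop)) :=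
    Kernel.IsMarkovKernel.comap _ _
  rw [stepKernel, Kernel.lintegral_compProd _ _ _ hF, Kernel.const_apply]
  refine lintegral_congr fun x => ?_
  exact Kernel.lintegral_compProd _ _ _ (hF.comp measurable_prodMk_left)

lemma lintegral_law_zero (M : Bandit d K) (π : Policy d K nP) {F : Hist d K nP 0 → ℝ≥0∞}
    (hF : Measurable F) :
    ∫⁻ ω, F ω ∂M.law π 0 =
      ∫⁻ p, F (p, Fin.elim0) ∂Measure.pi fun _ : Fin nP => M.sourceLaw := by
  rw [law, lintegral_map hF measurable_start]

lemma lintegral_law_succ (M : Bandit d K) (π : Policy d K nP) (t : ℕ)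
    {F : Hist d K nP (t + 1) → ℝ≥0∞} (hF : Measurable F) :
    ∫⁻ ω, F ω ∂M.law π (t + 1) =
      ∫⁻ h, ∫⁻ o, F (h.1, Fin.snoc (α := fun _ => Obs d K) h.2 o)
        ∂M.stepKernel π t h ∂M.law π t := by
  rw [law, lintegral_map hF (measurable_append t)]
  exact Measure.lintegral_compProd (hF.comp (measurable_append t))

/-- The expected total of a per-round loss is the sum over the rounds of the expectations under
the law of the data seen before that round. -/
lemma lintegral_sum_law (M : Bandit d K) (π : Policy d K nP) {g : Obs d K → ℝ≥0∞}
    (hg : Measurable g) (n : ℕ) :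
    ∫⁻ ω, ∑ t : Fin n, g (ω.2 t) ∂M.law π n =
      ∑ t ∈ range n, ∫⁻ h, ∫⁻ o, g o ∂M.stepKernel π t h ∂M.law π t := by
  induction n with
  | zero => simp
  | succ n ih =>
    have hm : ∀ m, Measurable fun ω : Hist d K nP m => ∑ t : Fin m, g (ω.2 t) := fun m =>
      Finset.measurable_sum _ fun i _ =>
        hg.comp ((measurable_pi_apply i).comp measurable_snd)
    rw [M.lintegral_law_succ π n (hm _), Finset.sum_range_succ, ← ih,
      ← lintegral_add_left (hm n)]
    refine lintegral_congr fun h => ?_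
    simp only [Fin.sum_univ_castSucc, Fin.snoc_castSucc, Fin.snoc_last]
    rw [lintegral_add_left measurable_const]
    simp

/-- The density of a history given the density `ℓ` of each single observation. -/
noncomputable def lik (ℓ : Obs d K → ℝ≥0∞) (t : ℕ) (ω : Hist d K nP t) : ℝ≥0∞ :=
  (∏ i, ℓ (ω.1 i)) * ∏ s, ℓ (ω.2 s)

lemma measurable_lik {ℓ : Obs d K → ℝ≥0∞} (hℓ : Measurable ℓ) (t : ℕ) :
    Measurable (lik (nP := nP) ℓ t) :=
  (Finset.measurable_prod _ fun i _ => hℓ.comp ((measurable_pi_apply i).comp measurable_fst)).mul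
    (Finset.measurable_prod _ fun i _ => hℓ.comp ((measurable_pi_apply i).comp measurable_snd))

lemma lik_append (ℓ : Obs d K → ℝ≥0∞) (t : ℕ) (h : Hist d K nP t) (o : Obs d K) :
    lik ℓ (t + 1) ((h.1, Fin.snoc (α := fun _ => Obs d K) h.2 o) : Hist d K nP (t + 1)) =
      lik ℓ t h * ℓ o := by
  simp [lik, Fin.prod_univ_castSucc, mul_assoc]

/-- `M'` differs from `M` only in that the rewards have density `ℓ` with respect to those of
`M`. -/
structure RewardDensity (M M' : Bandit d K) (ℓ : Obs d K → ℝ≥0∞) : Prop where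
  meas : Measurable ℓ
  QX_eq : M'.QX = M.QX
  PX_eq : M'.PX = M.PX
  behav_eq : M'.behav = M.behav
  reward_eq : ∀ x k, M'.reward (x, k) = (M.reward (x, k)).withDensity fun y => ℓ (x, k, y)

namespace RewardDensity

variable {M M' : Bandit d K} {ℓ : Obs d K → ℝ≥0∞}

lemma lintegral_reward (H : RewardDensity M M' ℓ) (x : Cube d) (k : Fin K)
    {F : unitInterval → ℝ≥0∞} (hF : Measurable F) :
    ∫⁻ y, F y ∂M'.reward (x, k) = ∫⁻ y, ℓ (x, k, y) * F y ∂M.reward (x, k) := by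
  rw [H.reward_eq]
  exact lintegral_withDensity_eq_lintegral_mul _
    (H.meas.comp (measurable_prodMk_left.comp measurable_prodMk_left)) hF

/-- The covariate law and the arm law of the policy are the same factors under both bandits, so only
the reward density remains. This makes the change of measure insensitive to adaptivity. -/
lemma lintegral_step (H : RewardDensity M M' ℓ) (π : Policy d K nP) (t : ℕ) (h : Hist d K nP t)
    {F : Obs d K → ℝ≥0∞} (hF : Measurable F) :
    ∫⁻ o, F o ∂M'.stepKernel π t h = ∫⁻ o, ℓ o * F o ∂M.stepKernel π t h := by
  refine (M'.lintegral_stepKernel π t h hF).trans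
    (Eq.trans ?_ (M.lintegral_stepKernel π t h (H.meas.mul hF)).symm)
  rw [H.QX_eq]
  refine lintegral_congr fun x => lintegral_congr fun k => ?_
  exact H.lintegral_reward x k (hF.comp (measurable_prodMk_left.comp measurable_prodMk_left))

lemma sourceLaw_eq (H : RewardDensity M M' ℓ) : M'.sourceLaw = M.sourceLaw.withDensity ℓ := by
  refine Measure.ext_of_lintegral _ fun F hF => ?_
  rw [lintegral_withDensity_eq_lintegral_mul _ H.meas hF, M'.lintegral_sourceLaw hF,
    M.lintegral_sourceLaw (H.meas.mul hF), H.PX_eq, H.behav_eq]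
  refine lintegral_congr fun x => lintegral_congr fun k => ?_
  exact H.lintegral_reward x k (hF.comp (measurable_prodMk_left.comp measurable_prodMk_left))

/-- Change of measure for the law of the data. -/
lemma lintegral_law (H : RewardDensity M M' ℓ) (π : Policy d K nP) (t : ℕ)
    {F : Hist d K nP t → ℝ≥0∞} (hF : Measurable F) :
    ∫⁻ ω, F ω ∂M'.law π t = ∫⁻ ω, lik ℓ t ω * F ω ∂M.law π t := by
  induction t with
  | zero =>
    have : IsProbabilityMeasure (M.sourceLaw.withDensity ℓ) := by
      rw [← H.sourceLaw_eq]; infer_instance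
    refine (M'.lintegral_law_zero π hF).trans
      (Eq.trans ?_ (M.lintegral_law_zero π ((measurable_lik H.meas 0).mul hF)).symm)
    have hprod : Measurable fun ω : Fin nP → Obs d K => ∏ i, ℓ (ω i) :=
      Finset.measurable_prod _ fun i _ => H.meas.comp (measurable_pi_apply i)
    rw [H.sourceLaw_eq, pi_withDensity_const _ _ H.meas]
    refine (lintegral_withDensity_eq_lintegral_mul _ hprod (hF.comp measurable_start)).trans ?_
    simp [lik]
  | succ t ih =>
    have hG := hF.comp (measurable_append (d := d) (K := K) (nP := nP) t)
    have hm : Measurable fun h : Hist d K nP t =>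
        ∫⁻ o, F (h.1, Fin.snoc (α := fun _ => Obs d K) h.2 o) ∂M'.stepKernel π t h :=
      Measurable.lintegral_kernel_prod_right' (κ := M'.stepKernel π t) hG
    rw [M'.lintegral_law_succ π t hF, ih hm]
    refine Eq.trans ?_ (M.lintegral_law_succ π t ((measurable_lik H.meas _).mul hF)).symm
    refine lintegral_congr fun h => ?_
    have hGh : Measurable fun o : Obs d K =>
        F (h.1, Fin.snoc (α := fun _ => Obs d K) h.2 o) := hG.comp measurable_prodMk_left
    rw [H.lintegral_step π t h hGh]
    refine (lintegral_const_mul _ (H.meas.mul hGh)).symm.trans (lintegral_congr fun o => ?_)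
    simp only [Pi.mul_apply, lik_append, mul_assoc]

/-- If one source observation has affinity at least `a` and one target observation has affinity
at least `c` whatever the past, the histories have affinity at least `a ^ nP * c ^ t`. -/
lemma affinity_le (H : RewardDensity M M' ℓ) (π : Policy d K nP) {a c : ℝ≥0∞}
    (ha : a ≤ ∫⁻ o, ℓ o ^ (1 / 2 : ℝ) ∂M.sourceLaw)
    (hc : ∀ t h, c ≤ ∫⁻ o, ℓ o ^ (1 / 2 : ℝ) ∂M.stepKernel π t h) (t : ℕ) :
    a ^ nP * c ^ t ≤ ∫⁻ ω, lik ℓ t ω ^ (1 / 2 : ℝ) ∂M.law π t := by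
  have hhalf : (0 : ℝ) ≤ 1 / 2 := by norm_num
  induction t with
  | zero =>
    rw [M.lintegral_law_zero π ((measurable_lik H.meas 0).pow_const _)]
    simp only [lik, Finset.univ_eq_empty, Finset.prod_empty, mul_one, pow_zero,
      ← ENNReal.prod_rpow_of_nonneg hhalf]
    rw [lintegral_pi_prod _ (fun _ o => ℓ o ^ (1 / 2 : ℝ)) fun _ => H.meas.pow_const _]
    simpa using pow_le_pow_left' ha nP
  | succ t ih =>
    rw [M.lintegral_law_succ π t ((measurable_lik H.meas _).pow_const _), pow_succ, ← mul_assoc]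
    refine (mul_le_mul_left ih c).trans ?_
    rw [← lintegral_mul_const _ ((measurable_lik H.meas _).pow_const _)]
    refine lintegral_mono fun h => ?_
    simp only [lik_append, ENNReal.mul_rpow_of_nonneg _ _ hhalf]
    rw [lintegral_const_mul _ (H.meas.pow_const _)]
    exact mul_le_mul_right (hc t h) _

end RewardDensity

end Bandit

/-- Le Cam's inequality: the overlap of two probability measures is at least half the square of
their affinity. -/
lemma affinity_sq_le_overlap {Ω : Type*} [MeasurableSpace Ω] (μ : Measure Ω)
    [IsProbabilityMeasure μ] {L : Ω → ℝ≥0∞} (hL : Measurable L) (hL1 : ∫⁻ ω, L ω ∂μ ≤ 1) :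
    (∫⁻ ω, L ω ^ (1 / 2 : ℝ) ∂μ) ^ 2 ≤ 2 * ∫⁻ ω, min 1 (L ω) ∂μ := by
  have hhalf : (0 : ℝ) ≤ 1 / 2 := by norm_num
  -- Cauchy–Schwarz is applied to `√L = √(min 1 L) · √(max 1 L)`; the second factor costs at most
  -- `2`, because `max 1 L ≤ 1 + L`.
  have hsplit : ∀ ω, L ω ^ (1 / 2 : ℝ) =
      ((fun ω => min 1 (L ω) ^ (1 / 2 : ℝ)) * fun ω => max 1 (L ω) ^ (1 / 2 : ℝ)) ω := by
    intro ω
    rw [Pi.mul_apply, ← ENNReal.mul_rpow_of_nonneg _ _ hhalf, min_mul_max, one_mul]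
  have hsq : ∀ x : ℝ≥0∞, (x ^ (1 / 2 : ℝ)) ^ (2 : ℝ) = x := fun x => by
    rw [← ENNReal.rpow_mul]; norm_num
  have hH := ENNReal.lintegral_mul_le_Lp_mul_Lq μ Real.HolderConjugate.two_two
    ((measurable_const.min hL).pow_const (1 / 2 : ℝ)).aemeasurable
    ((measurable_const.max hL).pow_const (1 / 2 : ℝ)).aemeasurable (f := fun ω => min 1 (L ω) ^ (1 / 2 : ℝ))
    (g := fun ω => max 1 (L ω) ^ (1 / 2 : ℝ))
  simp_rw [hsq] at hH
  simp_rw [hsplit]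
  refine (pow_le_pow_left' hH 2).trans ?_
  have hsq' : ∀ x : ℝ≥0∞, (x ^ (1 / 2 : ℝ)) ^ 2 = x := fun x => by
    rw [← ENNReal.rpow_natCast, ← ENNReal.rpow_mul]; norm_num
  rw [mul_pow, hsq', hsq', mul_comm]
  refine mul_le_mul_left ?_ _
  calc ∫⁻ ω, max 1 (L ω) ∂μ ≤ ∫⁻ ω, (1 + L ω) ∂μ := by
        refine lintegral_mono fun ω => max_le ?_ ?_
        · exact le_self_add
        · exact le_add_self
    _ = 1 + ∫⁻ ω, L ω ∂μ := by rw [lintegral_add_left measurable_const]; simp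
    _ ≤ 2 := by rw [← one_add_one_eq_two]; gcongr

end TransferBandit

/-! ### The two-point bound and Assouad's lemma. -/

namespace TransferBandit

open Finset

namespace Bandit

variable {d K nP : ℕ}

/-- The loss of size `Δ` incurred when the covariate lies in `B` and the pulled arm lies in `W`. -/
noncomputable def cellLoss (Δ : ℝ≥0∞) (B : Set (Cube d)) (W : Set (Fin K)) (o : Obs d K) : ℝ≥0∞ :=
  Δ * (B.indicator 1 o.1 * W.indicator 1 o.2.1)

lemma measurable_cellLoss (Δ : ℝ≥0∞) {B : Set (Cube d)} (hB : MeasurableSet B)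
    (W : Set (Fin K)) : Measurable (cellLoss Δ B W) :=
  measurable_const.mul (((measurable_one.indicator hB).comp measurable_fst).mul
    ((measurable_one.indicator (MeasurableSet.of_discrete (s := W))).comp
      (measurable_fst.comp measurable_snd)))

lemma cellLoss_add_compl (Δ : ℝ≥0∞) (B : Set (Cube d)) (W : Set (Fin K)) (o : Obs d K) :
    cellLoss Δ B W o + cellLoss Δ B Wᶜ o = Δ * B.indicator 1 o.1 := by
  have h : W.indicator (1 : Fin K → ℝ≥0∞) o.2.1 + Wᶜ.indicator 1 o.2.1 = 1 := by
    by_cases h : o.2.1 ∈ W <;> simp [h]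
  rw [cellLoss, cellLoss, ← mul_add, ← mul_add, h, mul_one]

/-- Expected loss in round `t`. -/
noncomputable def roundLoss (M : Bandit d K) (π : Policy d K nP) (g : Obs d K → ℝ≥0∞) (t : ℕ) :
    ℝ≥0∞ :=
  ∫⁻ h, ∫⁻ o, g o ∂M.stepKernel π t h ∂M.law π t

/-- Two bandits that cannot be told apart from the data cannot both be played well in a region
where they have complementary sets of bad arms. -/
lemma RewardDensity.two_point {M M' : Bandit d K} {ℓ : Obs d K → ℝ≥0∞} (H : RewardDensity M M' ℓ)
    (π : Policy d K nP) {a c : ℝ≥0∞} (ha : a ≤ ∫⁻ o, ℓ o ^ (1 / 2 : ℝ) ∂M.sourceLaw)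
    (hc : ∀ t h, c ≤ ∫⁻ o, ℓ o ^ (1 / 2 : ℝ) ∂M.stepKernel π t h) (t : ℕ)
    (Δ : ℝ≥0∞) {B : Set (Cube d)} (hB : MeasurableSet B) (W : Set (Fin K)) :
    Δ * M.QX B * (a ^ nP * c ^ t) ^ 2 ≤
      2 * (M.roundLoss π (cellLoss Δ B W) t + M'.roundLoss π (cellLoss Δ B Wᶜ) t) := by
  have hmW := measurable_cellLoss (K := K) Δ hB W
  have hmW' := measurable_cellLoss (K := K) Δ hB Wᶜ
  -- The loss does not read the reward, so given the past its expectation is the same under both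
  -- bandits; they differ only in the law of the past.
  have hstep : ∀ h, ∫⁻ o, cellLoss Δ B Wᶜ o ∂M'.stepKernel π t h =
      ∫⁻ o, cellLoss Δ B Wᶜ o ∂M.stepKernel π t h := by
    intro h
    rw [M'.lintegral_stepKernel π t h hmW', M.lintegral_stepKernel π t h hmW', H.QX_eq]
    simp [cellLoss]
  have hsum : ∀ h, ∫⁻ o, cellLoss Δ B W o ∂M.stepKernel π t h +
      ∫⁻ o, cellLoss Δ B Wᶜ o ∂M.stepKernel π t h = Δ * M.QX B := by
    intro h
    rw [← lintegral_add_left hmW]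
    simp_rw [cellLoss_add_compl]
    have hm : Measurable fun o : Obs d K => Δ * B.indicator 1 o.1 :=
      measurable_const.mul ((measurable_one.indicator hB).comp measurable_fst)
    rw [M.lintegral_stepKernel π t h hm]
    simp only [lintegral_const, measure_univ, mul_one]
    rw [lintegral_const_mul _ (measurable_one.indicator hB), lintegral_indicator_one hB]
  have hmA' : Measurable fun h => ∫⁻ o, cellLoss Δ B Wᶜ o ∂M.stepKernel π t h :=
    hmW'.lintegral_kernel
  have hL := measurable_lik (nP := nP) H.meas t
  have hL1 : ∫⁻ ω, lik ℓ t ω ∂M.law π t ≤ 1 := by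
    have := H.lintegral_law π t (F := fun _ => 1) measurable_const
    simp only [mul_one, lintegral_const, measure_univ] at this
    exact this.symm.le
  have hov := (pow_le_pow_left' (H.affinity_le π ha hc t) 2).trans
    (affinity_sq_le_overlap (M.law π t) hL hL1)
  -- Given the past the two complementary losses add up to `Δ · QX B`. Weighting this sum by `min 1
  -- L` costs at most weight `1` on the first loss and weight `L` on the second.
  have hmain : Δ * M.QX B * ∫⁻ ω, min 1 (lik ℓ t ω) ∂M.law π t ≤
      M.roundLoss π (cellLoss Δ B W) t + M'.roundLoss π (cellLoss Δ B Wᶜ) t := by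
    rw [roundLoss, roundLoss]
    simp_rw [hstep]
    rw [H.lintegral_law π t hmA', ← lintegral_const_mul _ (measurable_const.min hL)]
    refine le_trans ?_ (lintegral_add_right _ (hL.mul hmA')).le
    refine lintegral_mono fun h => ?_
    rw [← hsum h, add_mul]
    refine add_le_add ?_ ?_
    · exact (mul_le_mul_right (min_le_left _ _) _).trans (mul_one _).le
    · rw [mul_comm]
      exact mul_le_mul_left (min_le_right _ _) _
  calc Δ * M.QX B * (a ^ nP * c ^ t) ^ 2
      ≤ Δ * M.QX B * (2 * ∫⁻ ω, min 1 (lik ℓ t ω) ∂M.law π t) := by gcongr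
    _ = 2 * (Δ * M.QX B * ∫⁻ ω, min 1 (lik ℓ t ω) ∂M.law π t) := by ring
    _ ≤ _ := by gcongr

lemma sum_roundLoss_le_regret (M : Bandit d K) (π : Policy d K nP) (n : ℕ) {J : Type*}
    (S : Finset J) {g : J → Obs d K → ℝ≥0∞} (hg : ∀ j, Measurable (g j))
    (hle : ∀ o : Obs d K, ∑ j ∈ S, g j o ≤ ENNReal.ofReal (M.fmax o.1 - M.f o.2.1 o.1)) :
    ∑ t ∈ range n, ∑ j ∈ S, M.roundLoss π (g j) t ≤ M.regret π n := by
  have hm : Measurable fun o => ∑ j ∈ S, g j o := Finset.measurable_sum _ fun j _ => hg j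
  calc ∑ t ∈ range n, ∑ j ∈ S, M.roundLoss π (g j) t
      = ∑ t ∈ range n, M.roundLoss π (fun o => ∑ j ∈ S, g j o) t := by
        refine Finset.sum_congr rfl fun t _ => ?_
        simp only [roundLoss]
        rw [← lintegral_finsetSum _ fun j _ => (hg j).lintegral_kernel]
        refine lintegral_congr fun h => ?_
        rw [lintegral_finsetSum _ fun j _ => hg j]
    _ = ∫⁻ ω, ∑ t : Fin n, ∑ j ∈ S, g j (ω.2 t) ∂M.law π n :=
        (M.lintegral_sum_law π hm n).symm
    _ ≤ _ := lintegral_mono fun ω => Finset.sum_le_sum fun t _ => hle (ω.2 t)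

end Bandit

/-- Change one sign. -/
def flip {J : Type*} [DecidableEq J] (σ : J → Bool) (j : J) : J → Bool :=
  Function.update σ j (!σ j)

lemma flip_involutive {J : Type*} [DecidableEq J] (j : J) :
    Function.Involutive fun σ : J → Bool => flip σ j := by
  intro σ
  simp [flip]

/-- The bad arms in a region of sign `b`. -/
def badArms {K : ℕ} (k₁ : Fin K) (b : Bool) : Set (Fin K) := if b then {k₁}ᶜ else {k₁}

lemma badArms_not {K : ℕ} (k₁ : Fin K) (b : Bool) : badArms k₁ (!b) = (badArms k₁ b)ᶜ := by
  cases b <;> simp [badArms]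

namespace Bandit

variable {d K nP : ℕ}

/-- Assouad's lemma for a family of bandits indexed by signs. -/
theorem assouad {J : Type*} [Fintype J] [DecidableEq J] (S : Finset J)
    (M : (J → Bool) → Bandit d K) (k₁ : Fin K) {B : J → Set (Cube d)}
    (hB : ∀ j, MeasurableSet (B j)) (hdisj : Pairwise fun i j => Disjoint (B i) (B j))
    (Δ q a c : ℝ≥0∞) (hc1 : c ≤ 1) (hq : ∀ σ, ∀ j ∈ S, q ≤ (M σ).QX (B j))
    (hgap : ∀ σ, ∀ j ∈ S, ∀ x ∈ B j, ∀ k ∈ badArms k₁ (σ j),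
      Δ ≤ ENNReal.ofReal ((M σ).fmax x - (M σ).f k x))
    (π : Policy d K nP)
    (hdens : ∀ σ, ∀ j ∈ S, ∃ ℓ : Obs d K → ℝ≥0∞, RewardDensity (M σ) (M (flip σ j)) ℓ ∧
      a ≤ ∫⁻ o, ℓ o ^ (1 / 2 : ℝ) ∂(M σ).sourceLaw ∧
      ∀ t h, c ≤ ∫⁻ o, ℓ o ^ (1 / 2 : ℝ) ∂(M σ).stepKernel π t h)
    (n : ℕ) (V : ℝ≥0∞) (hV : ∀ σ, (M σ).regret π n ≤ V) :
    n * (#S * (Δ * q * (a ^ nP * c ^ n) ^ 2)) ≤ 4 * V := by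
  set r : ℝ≥0∞ := Δ * q * (a ^ nP * c ^ n) ^ 2 with hr
  let R : (J → Bool) → ℕ → J → ℝ≥0∞ := fun σ t j =>
    (M σ).roundLoss π (cellLoss Δ (B j) (badArms k₁ (σ j))) t
  have hreg : ∀ σ, ∑ t ∈ range n, ∑ j ∈ S, R σ t j ≤ V := by
    intro σ
    refine ((M σ).sum_roundLoss_le_regret π n S
      (g := fun j => cellLoss Δ (B j) (badArms k₁ (σ j)))
      (fun j => measurable_cellLoss Δ (hB j) _) fun o => ?_).trans (hV σ)
    -- The cells are disjoint, so at most one of the cell losses is nonzero.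
    by_cases ho : ∃ j ∈ S, o.1 ∈ B j ∧ o.2.1 ∈ badArms k₁ (σ j)
    · obtain ⟨j, hj, hx, hk⟩ := ho
      rw [Finset.sum_eq_single_of_mem j hj]
      · simpa [cellLoss, hx, hk] using hgap σ j hj o.1 hx o.2.1 hk
      · intro i _ hij
        have : o.1 ∉ B i := fun h => Set.disjoint_left.1 (hdisj hij) h hx
        simp [cellLoss, this]
    · push Not at ho
      rw [Finset.sum_eq_zero]
      · exact zero_le
      · intro j hj
        by_cases hx : o.1 ∈ B j
        · simp [cellLoss, ho j hj hx]
        · simp [cellLoss, hx]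
  have hpair : ∀ σ t, t < n → ∀ j ∈ S, r ≤ 2 * (R σ t j + R (flip σ j) t j) := by
    intro σ t ht j hj
    obtain ⟨ℓ, H, ha, hc⟩ := hdens σ j hj
    have h2 := H.two_point π ha hc t Δ (hB j) (badArms k₁ (σ j))
    have hfl : (flip σ j) j = !σ j := by simp [flip]
    simp only [R, hfl, badArms_not]
    refine le_trans ?_ h2
    rw [hr]
    -- Earlier rounds have seen less data, so the affinity at the horizon `n` serves for all of
    -- them.
    have hcn : c ^ n ≤ c ^ t := pow_le_pow_right_of_le_one' hc1 ht.le
    have hqj := hq σ j hj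
    gcongr
  have hsum : ∀ t, t < n → ∀ j ∈ S, (Fintype.card (J → Bool) : ℝ≥0∞) * r ≤ 4 * ∑ σ, R σ t j := by
    intro t ht j hj
    -- Flipping permutes the sign vectors, so averaging the two-point bound over all of them pairs
    -- each with its neighbour.
    have heq : ∑ σ, R (flip σ j) t j = ∑ σ, R σ t j :=
      Equiv.sum_comp (flip_involutive j).toPerm fun σ => R σ t j
    calc (Fintype.card (J → Bool) : ℝ≥0∞) * r = ∑ _σ : J → Bool, r := by
          rw [Finset.sum_const, nsmul_eq_mul]; rfl
      _ ≤ ∑ σ, 2 * (R σ t j + R (flip σ j) t j) := Finset.sum_le_sum fun σ _ => hpair σ t ht j hj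
      _ = 4 * ∑ σ, R σ t j := by
          rw [← Finset.mul_sum, Finset.sum_add_distrib, heq]; ring
  have hcard0 : (Fintype.card (J → Bool) : ℝ≥0∞) ≠ 0 := by
    simp
  have hcardT : (Fintype.card (J → Bool) : ℝ≥0∞) ≠ ⊤ := ENNReal.natCast_ne_top _
  refine (ENNReal.mul_le_mul_iff_right hcard0 hcardT).1 ?_
  calc (Fintype.card (J → Bool) : ℝ≥0∞) * (n * (#S * r))
      = ∑ t ∈ range n, ∑ j ∈ S, (Fintype.card (J → Bool) : ℝ≥0∞) * r := by
        simp only [Finset.sum_const, nsmul_eq_mul, card_range]; ring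
    _ ≤ ∑ t ∈ range n, ∑ j ∈ S, 4 * ∑ σ, R σ t j :=
        Finset.sum_le_sum fun t ht => Finset.sum_le_sum fun j hj => hsum t (mem_range.1 ht) j hj
    _ = 4 * ∑ σ, ∑ t ∈ range n, ∑ j ∈ S, R σ t j := by
        simp_rw [← Finset.mul_sum]
        congr 1
        symm
        rw [Finset.sum_comm]
        exact Finset.sum_congr rfl fun t _ => Finset.sum_comm
    _ ≤ 4 * ∑ _σ : J → Bool, V := by gcongr with σ; exact hreg σ
    _ = (Fintype.card (J → Bool) : ℝ≥0∞) * (4 * V) := by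
        rw [Finset.sum_const, nsmul_eq_mul]
        change 4 * ((Fintype.card (J → Bool) : ℝ≥0∞) * V) = _
        ring

end Bandit

end TransferBandit

/-! ### The one-dimensional grid: separated intervals and the midpoints of their gaps. -/

namespace TransferBandit

/-- Parameters of a family of `N` separated intervals in `[0,1]` of total length `a`. -/
structure Grid where
  N : ℕ
  a : ℝ
  two_le : 2 ≤ N
  half_le : 1 / 2 ≤ a
  lt_one : a < 1

namespace Grid

variable (G : Grid)

/-- The right end of the region that is filled by the intervals and the gaps between them. -/
noncomputable def s : ℝ := (1 + G.a) / 2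

/-- Half the length of a gap. -/
noncomputable def w : ℝ := (1 - G.a) / (4 * G.N)

/-- The point at relative position `f` in the interval with index `j`. -/
noncomputable def pt (j : ℤ) (f : ℝ) : ℝ := (G.s * j + G.a * f) / G.N

/-- The increasing map that sends `[j/N, (j+1)/N)` to the interval with index `j`. -/
noncomputable def T (u : ℝ) : ℝ := G.pt ⌊G.N * u⌋ (Int.fract (G.N * u))

/-- The map that sends `[j/N, (j+1)/N)` to the middle of the gap after the interval `j`. -/
noncomputable def gap (u : ℝ) : ℝ := G.pt ⌊G.N * u⌋ 1 + G.w

lemma N_pos : (0 : ℝ) < G.N := by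
  have := G.two_le
  positivity

lemma a_pos : 0 < G.a := by linarith [G.half_le]

lemma a_lt_s : G.a < G.s := by unfold s; linarith [G.lt_one]

lemma s_lt_one : G.s < 1 := by unfold s; linarith [G.lt_one]

lemma s_pos : 0 < G.s := G.a_pos.trans G.a_lt_s

lemma w_pos : 0 < G.w := by
  have := G.lt_one
  have := G.N_pos
  unfold w
  exact div_pos (by linarith) (by linarith)

lemma N_mul_w : G.N * G.w = (G.s - G.a) / 2 := by
  have := G.N_pos.ne'
  unfold w s
  field_simp
  ring

lemma N_mul_pt (j : ℤ) (f : ℝ) : G.N * G.pt j f = G.s * j + G.a * f := by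
  have := G.N_pos.ne'
  unfold pt
  field_simp

lemma N_mul_T (u : ℝ) : G.N * G.T u = G.s * ⌊G.N * u⌋ + G.a * Int.fract (G.N * u) :=
  G.N_mul_pt _ _

lemma N_mul_gap (u : ℝ) : G.N * G.gap u = G.s * ⌊G.N * u⌋ + G.a + (G.s - G.a) / 2 := by
  rw [gap, mul_add, N_mul_pt, N_mul_w, mul_one]

lemma le_iff (x y : ℝ) : x ≤ y ↔ G.N * x ≤ G.N * y := (mul_le_mul_iff_right₀ G.N_pos).symm

lemma T_le_of_floor_le {v : ℝ} {j : ℤ} (h : G.N * v < j + 1) : G.T v ≤ G.pt j 1 := by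
  rw [le_iff, N_mul_T, N_mul_pt]
  have h1 := Int.fract_lt_one (G.N * v)
  have h2 : ⌊G.N * v⌋ ≤ j := by
    have : ⌊G.N * v⌋ < j + 1 := Int.floor_lt.2 (by push_cast; exact h)
    omega
  have h3 : (⌊G.N * v⌋ : ℝ) ≤ j := by exact_mod_cast h2
  nlinarith [G.s_pos, G.a_pos]

lemma le_T_of_le_floor {v : ℝ} {j : ℤ} (h : j ≤ G.N * v) : G.pt j 0 ≤ G.T v := by
  rw [le_iff, N_mul_T, N_mul_pt]
  have h1 := Int.fract_nonneg (G.N * v)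
  have h2 : j ≤ ⌊G.N * v⌋ := Int.le_floor.2 h
  have h3 : (j : ℝ) ≤ ⌊G.N * v⌋ := by exact_mod_cast h2
  nlinarith [G.s_pos, G.a_pos]

/-- With `mul_le_T`, this traps the graph of `T` between two lines of slope `s < 1` at vertical
distance one gap; this controls `T` over windows that cross several intervals. -/
lemma T_le_mul (v : ℝ) : G.N * G.T v ≤ G.s * (G.N * v) := by
  rw [N_mul_T]
  have h1 := Int.fract_nonneg (G.N * v)
  have h2 : G.s * (G.N * v) = G.s * ⌊G.N * v⌋ + G.s * Int.fract (G.N * v) := by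
    rw [← mul_add, Int.floor_add_fract]
  nlinarith [G.a_lt_s]

lemma mul_le_T (v : ℝ) : G.s * (G.N * v) + G.a - G.s ≤ G.N * G.T v := by
  rw [N_mul_T]
  have h1 := Int.fract_lt_one (G.N * v)
  have h2 : G.s * (G.N * v) = G.s * ⌊G.N * v⌋ + G.s * Int.fract (G.N * v) := by
    rw [← mul_add, Int.floor_add_fract]
  nlinarith [G.a_lt_s]

lemma T_of_mem {v : ℝ} {j : ℤ} (h : j ≤ G.N * v) (h' : G.N * v < j + 1) :
    G.N * G.T v = G.s * j + G.a * (G.N * v - j) := by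
  rw [N_mul_T, Int.fract, (Int.floor_eq_iff).2 ⟨h, h'⟩]

/-- Any ball centred on the intervals contains the image of an interval as long as its radius. -/
lemma exists_Ioo_subset {j : ℤ} {f r : ℝ} (hj0 : 0 ≤ j) (hj : j < G.N) (hf0 : 0 ≤ f) (hf1 : f ≤ 1)
    (hr1 : r ≤ 1) :
    ∃ c, 0 ≤ c ∧ c + r ≤ 1 ∧ ∀ v, c < v → v < c + r → |G.T v - G.pt j f| ≤ r := by
  have hN := G.N_pos
  have ha := G.a_pos
  have has := G.a_lt_s
  have hs1 := G.s_lt_one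
  have hj0' : (0 : ℝ) ≤ j := by exact_mod_cast hj0
  have hj1' : (j : ℝ) + 1 ≤ G.N := by exact_mod_cast (show j + 1 ≤ (G.N : ℤ) by omega)
  set n : ℝ := (G.N : ℝ) with hn
  have key : ∀ v, n * (G.pt j f - r) ≤ n * G.T v → n * G.T v ≤ n * (G.pt j f + r) →
      |G.T v - G.pt j f| ≤ r := by
    intro v h1 h2
    have h1' := le_of_mul_le_mul_left h1 hN
    have h2' := le_of_mul_le_mul_left h2 hN
    exact abs_le.2 ⟨by linarith, by linarith⟩
  have hpt := G.N_mul_pt j f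
  rw [← hn] at hpt
  have hdiv : n * ((j + f) / n) = j + f := by field_simp
  have hdivj : n * (j / n) = j := by field_simp
  have hdivj1 : n * ((j + 1) / n) = j + 1 := by field_simp
  -- The ball does not reach the left end of interval `j`: a window to the left of the preimage of
  -- the centre stays in one branch, where `T` is affine of slope `a < 1`. The next case is its
  -- mirror image.
  by_cases hA : n * r < G.a * f
  · refine ⟨(j + f) / n - r, ?_, ?_, fun v hv1 hv2 => ?_⟩
    · refine le_of_mul_le_mul_left ?_ hN
      rw [mul_sub, hdiv]; nlinarith
    · refine le_of_mul_le_mul_left ?_ hN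
      rw [sub_add_cancel, hdiv]; nlinarith
    · have h1 := mul_lt_mul_of_pos_left hv1 hN
      have h2 := mul_lt_mul_of_pos_left hv2 hN
      rw [mul_sub, hdiv] at h1
      rw [sub_add_cancel, hdiv] at h2
      have hT := G.T_of_mem (v := v) (j := j) (by nlinarith) (by nlinarith)
      rw [← hn] at hT
      refine key v ?_ ?_
      · rw [hT, mul_sub, hpt]; nlinarith
      · rw [hT, mul_add, hpt]; nlinarith
  by_cases hB : n * r < G.a * (1 - f)
  · refine ⟨(j + f) / n, ?_, ?_, fun v hv1 hv2 => ?_⟩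
    · positivity
    · refine le_of_mul_le_mul_left ?_ hN
      rw [mul_add, hdiv]; nlinarith
    · have h1 := mul_lt_mul_of_pos_left hv1 hN
      have h2 := mul_lt_mul_of_pos_left hv2 hN
      rw [hdiv] at h1
      rw [mul_add, hdiv] at h2
      have hT := G.T_of_mem (v := v) (j := j) (by nlinarith) (by nlinarith)
      rw [← hn] at hT
      refine key v ?_ ?_
      · rw [hT, mul_sub, hpt]; nlinarith
      · rw [hT, mul_add, hpt]; nlinarith
  -- Now the ball contains all of interval `j`. A window that starts at `j/N` or ends at `(j+1)/N`
  -- works, since beyond the interval `T` moves away with slope at most `s < 1`.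
  push Not at hA hB
  have low1 : ∀ v, (j : ℝ) ≤ n * v → n * (G.pt j f - r) ≤ n * G.T v := by
    intro v hv
    have := (G.le_iff _ _).1 (G.le_T_of_le_floor hv)
    rw [N_mul_pt, ← hn] at this
    rw [mul_sub, hpt]; linarith
  have up1 : ∀ v, n * v - j ≤ n * r → n * G.T v ≤ n * (G.pt j f + r) := by
    intro v hv
    have := G.T_le_mul v
    rw [mul_add, hpt]; nlinarith
  have up2 : ∀ v, n * v < j + 1 → n * G.T v ≤ n * (G.pt j f + r) := by
    intro v hv
    have := (G.le_iff _ _).1 (G.T_le_of_floor_le hv)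
    rw [N_mul_pt, ← hn] at this
    rw [mul_add, hpt]; linarith
  have low2 : ∀ v, j + 1 - n * v ≤ n * r → n * (G.pt j f - r) ≤ n * G.T v := by
    intro v hv
    have := G.mul_le_T v
    rw [mul_sub, hpt]; nlinarith
  by_cases hC1 : j + n * r ≤ n
  · refine ⟨j / n, by positivity, ?_, fun v hv1 hv2 => ?_⟩
    · refine le_of_mul_le_mul_left ?_ hN
      rw [mul_add, hdivj]; linarith
    · have h1 := mul_lt_mul_of_pos_left hv1 hN
      have h2 := mul_lt_mul_of_pos_left hv2 hN
      rw [mul_add] at h2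
      rw [hdivj] at h1 h2
      exact key v (low1 v h1.le) (up1 v (by linarith))
  by_cases hC2 : n * r ≤ j + 1
  · refine ⟨(j + 1) / n - r, ?_, ?_, fun v hv1 hv2 => ?_⟩
    · refine le_of_mul_le_mul_left ?_ hN
      rw [mul_sub, hdivj1]; linarith
    · refine le_of_mul_le_mul_left ?_ hN
      rw [sub_add_cancel, hdivj1]; linarith
    · have h1 := mul_lt_mul_of_pos_left hv1 hN
      have h2 := mul_lt_mul_of_pos_left hv2 hN
      rw [mul_sub, hdivj1] at h1
      rw [sub_add_cancel, hdivj1] at h2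
      exact key v (low2 v (by linarith)) (up2 v h2)
  push Not at hC1 hC2
  -- Neither window fits into `[0,1]`, so `r` is large enough for the window at the origin.
  refine ⟨0, le_rfl, by linarith, fun v hv1 hv2 => ?_⟩
  have h1 := mul_lt_mul_of_pos_left hv1 hN
  have h2 := mul_lt_mul_of_pos_left hv2 hN
  have h3 : n * r ≤ n := by nlinarith
  rw [zero_add] at h2
  by_cases hv : (j : ℝ) ≤ n * v
  · exact key v (low1 v hv) (up1 v (by linarith))
  · exact key v (low2 v (by linarith)) (up2 v (by linarith))

/-- The map `T` expands distances by a factor at least `a`. -/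
lemma mul_abs_sub_le (u v : ℝ) : G.a * |u - v| ≤ |G.T u - G.T v| := by
  wlog h : v ≤ u generalizing u v
  · rw [abs_sub_comm u, abs_sub_comm (G.T u)]
    exact this v u (by linarith)
  rw [abs_of_nonneg (sub_nonneg.2 h)]
  refine le_trans ?_ (le_abs_self _)
  have hN := G.N_pos
  refine le_of_mul_le_mul_left ?_ hN
  rw [mul_sub (G.N : ℝ), N_mul_T, N_mul_T]
  have h1 : G.a * (G.N * u) = G.a * ⌊G.N * u⌋ + G.a * Int.fract (G.N * u) := by
    rw [← mul_add, Int.floor_add_fract]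
  have h2 : G.a * (G.N * v) = G.a * ⌊G.N * v⌋ + G.a * Int.fract (G.N * v) := by
    rw [← mul_add, Int.floor_add_fract]
  have h3 : (⌊G.N * v⌋ : ℝ) ≤ ⌊G.N * u⌋ := by
    exact_mod_cast Int.floor_le_floor (mul_le_mul_of_nonneg_left h hN.le)
  nlinarith [G.a_lt_s]

/-- Both points lie in one period of the grid, whose length is `s/N`. Using the same `u` for both
makes this a coupling of `unif` and `atoms`. -/
lemma abs_gap_sub_T_le (u : ℝ) : |G.gap u - G.T u| ≤ 1 / G.N := by
  have hN := G.N_pos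
  have h0 := Int.fract_nonneg (G.N * u)
  have h1 := Int.fract_lt_one (G.N * u)
  have hdiv : (G.N : ℝ) * (1 / G.N) = 1 := by field_simp
  have ha := G.a_pos
  have has := G.a_lt_s
  have hs1 := G.s_lt_one
  have hp : G.a * Int.fract (G.N * u) ≤ G.a := by nlinarith
  have hp0 : 0 ≤ G.a * Int.fract (G.N * u) := by positivity
  refine abs_le.2 ⟨le_of_mul_le_mul_left ?_ hN, le_of_mul_le_mul_left ?_ hN⟩
  · rw [mul_neg, hdiv, mul_sub, N_mul_T, N_mul_gap]; linarith
  · rw [hdiv, mul_sub, N_mul_T, N_mul_gap]; linarith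

lemma floor_mem {u : ℝ} (h0 : 0 ≤ u) (h1 : u < 1) : 0 ≤ ⌊G.N * u⌋ ∧ ⌊G.N * u⌋ < G.N := by
  have hN := G.N_pos
  refine ⟨Int.floor_nonneg.2 (by positivity), Int.floor_lt.2 ?_⟩
  push_cast
  nlinarith

lemma pt_mem {j : ℤ} {f : ℝ} (hj0 : 0 ≤ j) (hj : j < G.N) (hf0 : 0 ≤ f) (hf1 : f ≤ 1) :
    0 ≤ G.pt j f ∧ G.pt j f + G.w ≤ G.s := by
  have hN := G.N_pos
  have hj0' : (0 : ℝ) ≤ j := by exact_mod_cast hj0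
  have hj1' : (j : ℝ) + 1 ≤ G.N := by exact_mod_cast (show j + 1 ≤ (G.N : ℤ) by omega)
  have ha := G.a_pos
  have has := G.a_lt_s
  refine ⟨le_of_mul_le_mul_left ?_ hN, le_of_mul_le_mul_left ?_ hN⟩
  · rw [mul_zero, N_mul_pt]; nlinarith
  · rw [mul_add, N_mul_pt, N_mul_w]; nlinarith

lemma T_mem {u : ℝ} (h0 : 0 ≤ u) (h1 : u < 1) : 0 ≤ G.T u ∧ G.T u ≤ 1 := by
  obtain ⟨h2, h3⟩ := G.floor_mem h0 h1
  have := G.pt_mem h2 h3 (Int.fract_nonneg (G.N * u)) (Int.fract_lt_one _).le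
  exact ⟨this.1, by unfold T; linarith [G.w_pos, G.s_lt_one]⟩

lemma gap_mem {u : ℝ} (h0 : 0 ≤ u) (h1 : u < 1) : 0 ≤ G.gap u ∧ G.gap u ≤ G.s := by
  obtain ⟨h2, h3⟩ := G.floor_mem h0 h1
  have := G.pt_mem h2 h3 zero_le_one le_rfl
  exact ⟨by unfold gap; linarith [G.w_pos], this.2⟩

lemma measurable_T : Measurable G.T := by
  unfold T pt
  have h1 : Measurable fun u : ℝ => ((⌊(G.N : ℝ) * u⌋ : ℤ) : ℝ) :=
    (measurable_from_top (f := ((↑) : ℤ → ℝ))).comp (Int.measurable_floor.comp (by fun_prop))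
  have h2 : Measurable fun u : ℝ => Int.fract ((G.N : ℝ) * u) :=
    measurable_fract.comp (by fun_prop)
  fun_prop

lemma measurable_gap : Measurable G.gap := by
  unfold gap pt
  have h1 : Measurable fun u : ℝ => ((⌊(G.N : ℝ) * u⌋ : ℤ) : ℝ) :=
    (measurable_from_top (f := ((↑) : ℤ → ℝ))).comp (Int.measurable_floor.comp (by fun_prop))
  fun_prop

/-- A measurable real function as a map of the unit interval. -/
noncomputable def clamp (φ : ℝ → ℝ) (u : unitInterval) : unitInterval :=
  Set.projIcc 0 1 zero_le_one (φ u)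

lemma measurable_clamp {φ : ℝ → ℝ} (h : Measurable φ) : Measurable (clamp φ) :=
  continuous_projIcc.measurable.comp (h.comp measurable_subtype_coe)

lemma coe_clamp {φ : ℝ → ℝ} {u : unitInterval} (h : 0 ≤ φ u ∧ φ u ≤ 1) :
    (clamp φ u : ℝ) = φ u := by
  rw [clamp, Set.projIcc_of_mem _ h]

/-- The uniform law on the intervals. -/
noncomputable def unif : Measure unitInterval := volume.map (clamp G.T)

/-- The uniform law on the midpoints of the gaps. -/
noncomputable def atoms : Measure unitInterval := volume.map (clamp G.gap)

instance : IsProbabilityMeasure G.unif :=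
  Measure.isProbabilityMeasure_map (measurable_clamp G.measurable_T).aemeasurable

instance : IsProbabilityMeasure G.atoms :=
  Measure.isProbabilityMeasure_map (measurable_clamp G.measurable_gap).aemeasurable

lemma ae_lt_one : ∀ᵐ u : unitInterval, (u : ℝ) < 1 := by
  have : ∀ᵐ u : unitInterval, u ≠ 1 := by simp [ae_iff, measure_singleton]
  filter_upwards [this] with u hu
  exact lt_of_le_of_ne u.2.2 fun h => hu (Subtype.ext h)

lemma real_unif {A : Set unitInterval} (hA : MeasurableSet A) :
    G.unif.real A = volume.real {u : unitInterval | clamp G.T u ∈ A} := by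
  rw [unif, map_measureReal_apply (measurable_clamp G.measurable_T) hA]; rfl

lemma real_atoms {A : Set unitInterval} (hA : MeasurableSet A) :
    G.atoms.real A = volume.real {u : unitInterval | clamp G.gap u ∈ A} := by
  rw [atoms, map_measureReal_apply (measurable_clamp G.measurable_gap) hA]; rfl

lemma le_volume_real {A : Set unitInterval} {c r : ℝ} (hc : 0 ≤ c) (hr : c + r ≤ 1)
    (h : ∀ u : unitInterval, c < u → (u : ℝ) < c + r → u ∈ A) : r ≤ volume.real A := by
  by_cases hr0 : r ≤ 0
  · exact hr0.trans measureReal_nonneg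
  have hsub : Set.Ioo c (c + r) ⊆ Subtype.val '' A := fun v hv =>
    ⟨⟨v, by linarith [hv.1], by linarith [hv.2]⟩, h _ hv.1 hv.2, rfl⟩
  have := measure_mono (μ := volume) hsub
  rw [Real.volume_Ioo, ← unitInterval.volume_apply, add_sub_cancel_left] at this
  exact (ENNReal.ofReal_le_iff_le_toReal (measure_ne_top _ _)).1 this

/-- Length is at most diameter. The point `1` is discarded because there `⌊N u⌋ = N` is not the
index of an interval. -/
lemma volume_real_le {A : Set unitInterval} {D : ℝ} (hD : 0 ≤ D)
    (h : ∀ u ∈ A, (u : ℝ) < 1 → ∀ v ∈ A, (v : ℝ) < 1 → |(u : ℝ) - v| ≤ D) : volume.real A ≤ D := by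
  have hA : volume A = volume (A ∩ {u | (u : ℝ) < 1}) :=
    (measure_inter_conull (ae_iff.1 ae_lt_one)).symm
  rw [measureReal_def, hA, unitInterval.volume_apply]
  refine ENNReal.toReal_le_of_le_ofReal hD ((Real.volume_le_diam _).trans ?_)
  refine Metric.ediam_le ?_
  rintro _ ⟨u, ⟨huA, hu⟩, rfl⟩ _ ⟨v, ⟨hvA, hv⟩, rfl⟩
  rw [edist_dist, Real.dist_eq]
  exact ENNReal.ofReal_le_ofReal (h u huA hu v hvA hv)

lemma mem_closedBall_clamp {φ : ℝ → ℝ} {u x : unitInterval} {r : ℝ} (h : 0 ≤ φ u ∧ φ u ≤ 1) :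
    clamp φ u ∈ Metric.closedBall x r ↔ |φ u - x| ≤ r := by
  rw [Metric.mem_closedBall, Subtype.dist_eq, Real.dist_eq, coe_clamp h]

lemma le_unif_closedBall {j : ℤ} {f r : ℝ} {x : unitInterval} (hj0 : 0 ≤ j) (hj : j < G.N)
    (hf0 : 0 ≤ f) (hf1 : f ≤ 1) (hx : (x : ℝ) = G.pt j f) (hr1 : r ≤ 1) :
    r ≤ G.unif.real (Metric.closedBall x r) := by
  obtain ⟨c, hc, hcr, h⟩ := G.exists_Ioo_subset hj0 hj hf0 hf1 hr1
  rw [G.real_unif Metric.isClosed_closedBall.measurableSet]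
  refine le_volume_real hc hcr fun u hu1 hu2 => ?_
  rw [Set.mem_ofPred_eq, mem_closedBall_clamp (G.T_mem (hc.trans hu1.le) (by linarith)), hx]
  exact h u hu1 hu2

/-- Distances shrink by at most the factor `a` under `T`, so the preimage of a ball has diameter at
most `2r/a`. -/
lemma unif_closedBall_le (x : unitInterval) {r : ℝ} (hr : 0 ≤ r) :
    G.unif.real (Metric.closedBall x r) ≤ 2 / G.a * r := by
  have ha := G.a_pos
  rw [G.real_unif Metric.isClosed_closedBall.measurableSet]
  refine volume_real_le (by positivity) fun u hu hu1 v hv hv1 => ?_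
  rw [Set.mem_ofPred_eq, mem_closedBall_clamp (G.T_mem u.2.1 hu1)] at hu
  rw [Set.mem_ofPred_eq, mem_closedBall_clamp (G.T_mem v.2.1 hv1)] at hv
  have h := G.mul_abs_sub_le u v
  have : |G.T u - G.T v| ≤ 2 * r := by
    rw [abs_le] at hu hv ⊢; constructor <;> linarith [hu.1, hu.2, hv.1, hv.2]
  rw [div_mul_eq_mul_div, le_div_iff₀ ha]
  linarith

/-- The laws `unif` and `atoms` give nearly the same mass to a ball. -/
lemma unif_le_atoms_add (x : unitInterval) (r : ℝ) :
    G.unif.real (Metric.closedBall x r) ≤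
      G.atoms.real (Metric.closedBall x r) + 2 / (G.a * G.N) := by
  have ha := G.a_pos
  have hN := G.N_pos
  rw [G.real_unif Metric.isClosed_closedBall.measurableSet,
    G.real_atoms Metric.isClosed_closedBall.measurableSet]
  set A : Set unitInterval := {u | clamp G.gap u ∈ Metric.closedBall x r}
  -- If `T u` is in the ball and `gap u` is not, then `T u` lies within `1/N` of one of the two ends
  -- of the ball; `B₁` and `B₂` collect these `u`.
  set B₁ : Set unitInterval := {u | (u : ℝ) < 1 ∧ r - 1 / G.N ≤ G.T u - x ∧ G.T u - x ≤ r}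
  set B₂ : Set unitInterval := {u | (u : ℝ) < 1 ∧ r - 1 / G.N ≤ x - G.T u ∧ x - G.T u ≤ r}
  have hB : ∀ B : Set unitInterval, (∀ u ∈ B, ∀ v ∈ B, |G.T u - G.T v| ≤ 1 / G.N) →
      volume.real B ≤ 1 / (G.a * G.N) := by
    intro B h
    refine volume_real_le (by positivity) fun u hu _ v hv _ => ?_
    rw [← div_div, div_right_comm, le_div_iff₀ ha, mul_comm]
    exact (G.mul_abs_sub_le u v).trans (h u hu v hv)
  have h1 : volume.real B₁ ≤ 1 / (G.a * G.N) := hB _ fun u hu v hv => by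
    rw [abs_le]; constructor <;> linarith [hu.2.1, hu.2.2, hv.2.1, hv.2.2]
  have h2 : volume.real B₂ ≤ 1 / (G.a * G.N) := hB _ fun u hu v hv => by
    rw [abs_le]; constructor <;> linarith [hu.2.1, hu.2.2, hv.2.1, hv.2.2]
  have hsub : volume {u : unitInterval | clamp G.T u ∈ Metric.closedBall x r} ≤
      volume (A ∪ (B₁ ∪ B₂)) := by
    refine measure_mono_ae ?_
    filter_upwards [ae_lt_one] with u hu1 hu
    change clamp G.T u ∈ Metric.closedBall x r at hu
    rw [mem_closedBall_clamp (G.T_mem u.2.1 hu1)] at hu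
    by_contra hcon
    change ¬ (u ∈ A ∪ (B₁ ∪ B₂)) at hcon
    simp only [Set.mem_union, not_or] at hcon
    obtain ⟨hA, hB1, hB2⟩ := hcon
    have hg := G.gap_mem u.2.1 hu1
    simp only [A, Set.mem_ofPred_eq,
      mem_closedBall_clamp (φ := G.gap) (u := u) ⟨hg.1, hg.2.trans G.s_lt_one.le⟩, not_le] at hA
    have hd := abs_le.1 (G.abs_gap_sub_T_le u)
    rw [abs_le] at hu
    rcases lt_abs.1 hA with h | h
    · exact hB1 ⟨hu1, by linarith [hd.1, hd.2], hu.2⟩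
    · exact hB2 ⟨hu1, by linarith [hd.1, hd.2], by linarith [hu.1]⟩
  have hreal : volume.real {u : unitInterval | clamp G.T u ∈ Metric.closedBall x r} ≤
      volume.real (A ∪ (B₁ ∪ B₂)) := ENNReal.toReal_mono (measure_ne_top _ _) hsub
  have h3 := measureReal_union_le (μ := (volume : Measure unitInterval)) A (B₁ ∪ B₂)
  have h4 := measureReal_union_le (μ := (volume : Measure unitInterval)) B₁ B₂
  have h5 : 2 / (G.a * G.N) = 1 / (G.a * G.N) + 1 / (G.a * G.N) := by ring
  linarith

/-- The union of the intervals. -/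
def range : Set unitInterval :=
  ⋃ j : Fin G.N, {y | G.pt (j : ℕ) 0 ≤ y ∧ (y : ℝ) ≤ G.pt (j : ℕ) 1}

lemma isClosed_range : IsClosed G.range := by
  refine isClosed_iUnion_of_finite fun j => ?_
  exact (isClosed_le continuous_const continuous_subtype_val).inter
    (isClosed_le continuous_subtype_val continuous_const)

lemma exists_of_mem_Icc {j : ℤ} {y : ℝ} (h0 : G.pt j 0 ≤ y) (h1 : y ≤ G.pt j 1) :
    ∃ f, 0 ≤ f ∧ f ≤ 1 ∧ y = G.pt j f := by
  have hN := G.N_pos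
  have ha := G.a_pos
  rw [le_iff, N_mul_pt] at h0 h1
  refine ⟨(G.N * y - G.s * j) / G.a, ?_, ?_, ?_⟩
  · exact div_nonneg (by linarith) ha.le
  · rw [div_le_one ha]; linarith
  · unfold pt
    field_simp
    ring

lemma T_mem_cell (u : ℝ) : G.pt ⌊G.N * u⌋ 0 ≤ G.T u ∧ G.T u ≤ G.pt ⌊G.N * u⌋ 1 :=
  ⟨G.le_T_of_le_floor (Int.floor_le _), G.T_le_of_floor_le (Int.lt_floor_add_one _)⟩

lemma ae_unif_mem_range : ∀ᵐ y ∂G.unif, y ∈ G.range := by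
  refine (ae_map_iff (measurable_clamp G.measurable_T).aemeasurable
    (p := (· ∈ G.range)) G.isClosed_range.measurableSet).2 ?_
  filter_upwards [ae_lt_one] with u hu
  obtain ⟨h2, h3⟩ := G.floor_mem u.2.1 hu
  obtain ⟨m, hm⟩ := Int.eq_ofNat_of_zero_le h2
  have hmN : m < G.N := by omega
  refine Set.mem_iUnion.2 ⟨⟨m, hmN⟩, ?_⟩
  have := G.T_mem_cell u
  rw [hm] at this
  rw [Set.mem_ofPred_eq, coe_clamp (G.T_mem u.2.1 hu)]
  exact this

/-- The midpoints of the gaps. -/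
def gaps : Set unitInterval := ⋃ j : Fin G.N, {y | (y : ℝ) = G.pt (j : ℕ) 1 + G.w}

lemma measurableSet_gaps : MeasurableSet G.gaps := by
  exact MeasurableSet.iUnion fun j =>
    (isClosed_eq continuous_subtype_val continuous_const).measurableSet

lemma ae_atoms_mem_gaps : ∀ᵐ y ∂G.atoms, y ∈ G.gaps := by
  refine (ae_map_iff (measurable_clamp G.measurable_gap).aemeasurable
    (p := (· ∈ G.gaps)) G.measurableSet_gaps).2 ?_
  filter_upwards [ae_lt_one] with u hu
  obtain ⟨h2, h3⟩ := G.floor_mem u.2.1 hu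
  obtain ⟨m, hm⟩ := Int.eq_ofNat_of_zero_le h2
  have hmN : m < G.N := by omega
  have hg := G.gap_mem u.2.1 hu
  refine Set.mem_iUnion.2 ⟨⟨m, hmN⟩, ?_⟩
  rw [Set.mem_ofPred_eq, coe_clamp ⟨hg.1, hg.2.trans G.s_lt_one.le⟩, gap, hm]

/-- All the midpoints lie in `[0, s]` with `s < 1`. Leaving `(s, 1]` empty means that radii not
covering everything satisfy `r ^ γ < s ^ γ < 1`, and this slack pays for the discretization. -/
lemma atoms_closedBall_eq_one {x : unitInterval} (hx : (x : ℝ) ≤ G.s) {r : ℝ} (hr : G.s ≤ r) :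
    G.atoms.real (Metric.closedBall x r) = 1 := by
  have : ∀ᵐ y ∂G.atoms, y ∈ Metric.closedBall x r := by
    filter_upwards [G.ae_atoms_mem_gaps] with y hy
    obtain ⟨j, hj : (y : ℝ) = _⟩ := Set.mem_iUnion.1 hy
    have := G.pt_mem (j := (j : ℕ)) (f := 1) (by omega) (by exact_mod_cast j.2) zero_le_one le_rfl
    rw [Metric.mem_closedBall, Subtype.dist_eq, Real.dist_eq, abs_le]
    constructor <;> linarith [this.1, this.2, x.2.1, y.2.1, G.w_pos]
  rw [measureReal_def, (prob_compl_eq_zero_iff Metric.isClosed_closedBall.measurableSet).1 this]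
  simp

/-- Each interval has mass `1/N`. -/
lemma unif_cell (j : Fin G.N) :
    G.unif.real {y | G.pt (j : ℕ) 0 ≤ y ∧ (y : ℝ) ≤ G.pt (j : ℕ) 1} = 1 / G.N := by
  have hN := G.N_pos
  have ha := G.a_pos
  have hms : MeasurableSet {y : unitInterval | G.pt (j : ℕ) 0 ≤ y ∧ (y : ℝ) ≤ G.pt (j : ℕ) 1} :=
    ((isClosed_le continuous_const continuous_subtype_val).inter
      (isClosed_le continuous_subtype_val continuous_const)).measurableSet
  have hj1 : ((j : ℕ) : ℝ) + 1 ≤ G.N := by exact_mod_cast j.2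
  rw [G.real_unif hms]
  refine le_antisymm (volume_real_le (by positivity) ?_) ?_
  · have hidx : ∀ u : unitInterval, u ∈ {u : unitInterval | clamp G.T u ∈
        {y : unitInterval | G.pt (j : ℕ) 0 ≤ y ∧ (y : ℝ) ≤ G.pt (j : ℕ) 1}} → (u : ℝ) < 1 →
        ((j : ℕ) : ℝ) ≤ G.N * (u : ℝ) ∧ G.N * (u : ℝ) < (j : ℕ) + 1 := by
      intro u hu hu1
      simp only [Set.mem_ofPred_eq, coe_clamp (G.T_mem u.2.1 hu1)] at hu
      have h1 := (G.le_iff _ _).1 hu.1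
      have h2 := (G.le_iff _ _).1 hu.2
      rw [N_mul_pt, N_mul_T] at h1
      rw [N_mul_pt, N_mul_T] at h2
      have hf0 := Int.fract_nonneg (G.N * (u : ℝ))
      have hf1 := Int.fract_lt_one (G.N * (u : ℝ))
      have has := G.a_lt_s
      suffices hfl : ⌊G.N * (u : ℝ)⌋ = ((j : ℕ) : ℤ) by
        have := Int.floor_eq_iff.1 hfl
        exact_mod_cast this
      push_cast at h1 h2
      rcases lt_trichotomy ⌊G.N * (u : ℝ)⌋ ((j : ℕ) : ℤ) with h | h | h
      · have h' : (⌊G.N * (u : ℝ)⌋ : ℝ) + 1 ≤ (j : ℕ) := by exact_mod_cast h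
        nlinarith
      · exact h
      · have h' : ((j : ℕ) : ℝ) + 1 ≤ ⌊G.N * (u : ℝ)⌋ := by exact_mod_cast h
        nlinarith
    intro u hu hu1 v hv hv1
    have h1 := hidx u hu hu1
    have h2 := hidx v hv hv1
    have h3 : |((u : ℝ) - v) * G.N| ≤ 1 := by
      rw [abs_le]
      constructor <;> linarith [h1.1, h1.2, h2.1, h2.2]
    rwa [abs_mul, abs_of_pos hN, ← le_div_iff₀ hN] at h3
  · refine le_volume_real (c := (j : ℕ) / G.N) (by positivity) ?_ fun u hu1 hu2 => ?_
    · rw [← add_div, div_le_one hN]; exact hj1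
    · have hu3 : (u : ℝ) < 1 := by
        refine hu2.trans_le ?_
        rw [← add_div, div_le_one hN]; exact hj1
      rw [← add_div, lt_div_iff₀ hN] at hu2
      rw [div_lt_iff₀ hN] at hu1
      simp only [Set.mem_ofPred_eq, coe_clamp (G.T_mem u.2.1 hu3)]
      refine ⟨G.le_T_of_le_floor ?_, G.T_le_of_floor_le ?_⟩
      · push_cast; linarith
      · push_cast; linarith

end Grid

end TransferBandit

/-! ### The target law on product cells and the lattice law. -/

namespace TransferBandit

namespace Grid

variable (G : Grid) (d : ℕ)

/-- The uniform law on the product cells. -/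
noncomputable def target : Measure (Cube d) := Measure.pi fun _ => G.unif

/-- The uniform law on the points all of whose coordinates are midpoints of gaps. -/
noncomputable def lattice : Measure (Cube d) := Measure.pi fun _ => G.atoms

instance : IsProbabilityMeasure (G.target d) := by unfold target; infer_instance

instance : IsProbabilityMeasure (G.lattice d) := by unfold lattice; infer_instance

variable {d}

/-- The product cell with multi-index `j`. -/
def box (j : Fin d → Fin G.N) : Set (Cube d) :=
  Set.univ.pi fun i => {y | G.pt (j i : ℕ) 0 ≤ y ∧ (y : ℝ) ≤ G.pt (j i : ℕ) 1}

lemma mem_box {j : Fin d → Fin G.N} {x : Cube d} :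
    x ∈ G.box j ↔ ∀ i, G.pt (j i : ℕ) 0 ≤ x i ∧ (x i : ℝ) ≤ G.pt (j i : ℕ) 1 :=
  ⟨fun h i => h i trivial, fun h i _ => h i⟩

lemma measurableSet_box (j : Fin d → Fin G.N) : MeasurableSet (G.box j) :=
  MeasurableSet.univ_pi fun _ => ((isClosed_le continuous_const continuous_subtype_val).inter
    (isClosed_le continuous_subtype_val continuous_const)).measurableSet

lemma pi_real {μ : Measure unitInterval} [IsProbabilityMeasure μ] (t : Fin d → Set unitInterval) :
    (Measure.pi fun _ : Fin d => μ).real (Set.univ.pi t) = ∏ i, μ.real (t i) := by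
  rw [measureReal_def, Measure.pi_pi, ENNReal.toReal_prod]
  rfl

lemma target_box (j : Fin d → Fin G.N) : (G.target d).real (G.box j) = (1 / G.N) ^ d := by
  rw [target, box, pi_real]
  simp_rw [unif_cell]
  simp

lemma exists_box {x : Cube d} (hx : ∀ i, x i ∈ G.range) : ∃ j, x ∈ G.box j := by
  choose j hj using fun i => Set.mem_iUnion.1 (hx i)
  exact ⟨j, G.mem_box.2 hj⟩

lemma mem_range_of_box {j : Fin d → Fin G.N} {x : Cube d} (hx : x ∈ G.box j) (i : Fin d) :
    x i ∈ G.range :=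
  Set.mem_iUnion.2 ⟨j i, G.mem_box.1 hx i⟩

lemma ae_target_mem : ∀ᵐ x ∂G.target d, ∀ i, x i ∈ G.range := by
  rw [ae_all_iff]
  intro i
  exact (Measure.tendsto_eval_ae_ae (μ := fun _ : Fin d => G.unif)).eventually
    G.ae_unif_mem_range

lemma ae_lattice_mem : ∀ᵐ x ∂G.lattice d, ∀ i, x i ∈ G.gaps := by
  rw [ae_all_iff]
  intro i
  exact (Measure.tendsto_eval_ae_ae (μ := fun _ : Fin d => G.atoms)).eventually
    G.ae_atoms_mem_gaps

lemma support_subset {x : Cube d} (hx : x ∈ (G.target d).support) (i : Fin d) :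
    x i ∈ G.range := by
  have hc : IsClosed {x : Cube d | ∀ i, x i ∈ G.range} := by
    simp only [Set.ofPred_forall]
    exact isClosed_iInter fun i => G.isClosed_range.preimage (continuous_apply i)
  exact Measure.support_subset_of_isClosed hc G.ae_target_mem hx i

lemma le_s_of_mem_range {y : unitInterval} (hy : y ∈ G.range) : (y : ℝ) ≤ G.s := by
  obtain ⟨j, hj⟩ := Set.mem_iUnion.1 hy
  have := G.pt_mem (j := (j : ℕ)) (f := 1) (by omega) (by exact_mod_cast j.2) zero_le_one le_rfl
  linarith [hj.2, G.w_pos]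

lemma le_unif_of_mem_range {y : unitInterval} (hy : y ∈ G.range) {r : ℝ} (hr : r ≤ 1) :
    r ≤ G.unif.real (Metric.closedBall y r) := by
  obtain ⟨j, hj⟩ := Set.mem_iUnion.1 hy
  obtain ⟨f, hf0, hf1, hf⟩ := G.exists_of_mem_Icc hj.1 hj.2
  exact G.le_unif_closedBall (by omega) (by exact_mod_cast j.2) hf0 hf1 hf hr

lemma le_target_closedBall {x : Cube d} (hx : ∀ i, x i ∈ G.range) {r : ℝ} (hr0 : 0 < r)
    (hr : r ≤ 1) : r ^ d ≤ (G.target d).real (Metric.closedBall x r) := by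
  rw [closedBall_pi x hr0.le, target, pi_real]
  calc r ^ d = ∏ _i : Fin d, r := by simp
    _ ≤ _ := Finset.prod_le_prod (fun _ _ => hr0.le) fun i _ => G.le_unif_of_mem_range (hx i) hr

lemma target_closedBall_le (x : Cube d) {r : ℝ} (hr0 : 0 ≤ r) :
    (G.target d).real (Metric.closedBall x r) ≤ (2 / G.a * r) ^ d := by
  rw [closedBall_pi x hr0, target, pi_real]
  calc _ ≤ ∏ _i : Fin d, (2 / G.a * r) :=
        Finset.prod_le_prod (fun _ _ => measureReal_nonneg) fun i _ => G.unif_closedBall_le _ hr0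
    _ = _ := by simp

lemma mem_support {x : Cube d} (hx : ∀ i, x i ∈ G.range) : x ∈ (G.target d).support := by
  rw [Measure.mem_support_iff_forall]
  intro U hU
  obtain ⟨r, hr, hrU⟩ := Metric.nhds_basis_closedBall.mem_iff.1 hU
  have h1 := G.le_target_closedBall hx (lt_min hr one_pos) (min_le_right r 1)
  have h2 : 0 < (G.target d).real (Metric.closedBall x (min r 1)) :=
    (pow_pos (lt_min hr one_pos) d).trans_le h1
  exact (ENNReal.toReal_pos_iff.1 h2).1.trans_le
    (measure_mono ((Metric.closedBall_subset_closedBall (min_le_left _ _)).trans hrU))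

lemma zero_mem_range : (0 : unitInterval) ∈ G.range := by
  have := G.two_le
  refine Set.mem_iUnion.2 ⟨⟨0, by omega⟩, ?_⟩
  have hN := G.N_pos
  have ha := G.a_pos
  constructor
  · simp [pt]
  · simp only [pt, Nat.cast_zero, Int.cast_zero, mul_zero, zero_add, mul_one,
      Set.Icc.coe_zero]
    positivity

lemma pt_add_lt {j k : ℕ} (h : j < k) : G.pt j 1 + 2 * G.w ≤ G.pt k 0 := by
  have hk : (j : ℝ) + 1 ≤ k := by exact_mod_cast h
  rw [le_iff, mul_add, N_mul_pt, mul_left_comm, N_mul_w, N_mul_pt]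
  push_cast
  nlinarith [G.s_pos]

lemma box_disjoint : Pairwise fun j k : Fin d → Fin G.N => Disjoint (G.box j) (G.box k) := by
  intro j k hjk
  rw [Set.disjoint_left]
  intro x hj hk
  obtain ⟨i, hi⟩ := Function.ne_iff.1 hjk
  have h1 := G.mem_box.1 hj i
  have h2 := G.mem_box.1 hk i
  rcases lt_or_gt_of_ne (fun h => hi (Fin.ext h) : (j i : ℕ) ≠ k i) with h | h
  · linarith [G.pt_add_lt h, G.w_pos]
  · linarith [G.pt_add_lt h, G.w_pos]

lemma gaps_disjoint_range {y : unitInterval} (hy : y ∈ G.gaps) : y ∉ G.range := by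
  intro hy'
  obtain ⟨j, hj : (y : ℝ) = _⟩ := Set.mem_iUnion.1 hy
  obtain ⟨k, hk⟩ := Set.mem_iUnion.1 hy'
  have hw := G.w_pos
  rcases lt_or_ge (j : ℕ) k with h | h
  · linarith [G.pt_add_lt h, hk.1]
  · have : G.pt (k : ℕ) 1 ≤ G.pt (j : ℕ) 1 := by
      rw [le_iff, N_mul_pt, N_mul_pt]
      have : ((k : ℕ) : ℝ) ≤ (j : ℕ) := by exact_mod_cast h
      push_cast
      nlinarith [G.s_pos]
    linarith [hk.2]

lemma w_le_of_mem_gaps {y : unitInterval} (hy : y ∈ G.gaps) : G.w < y := by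
  obtain ⟨j, hj : (y : ℝ) = _⟩ := Set.mem_iUnion.1 hy
  have : 0 < G.pt (j : ℕ) 1 := by
    have := G.N_pos
    have := G.a_pos
    have := G.s_pos
    unfold pt
    push_cast
    positivity
  linarith

/-- In each coordinate the coupling error is at most `4/N ≤ (4/R) r`, and the ball has `unif`-mass
at least `r`; so the relative error is at most `4/R`. -/
lemma lattice_closedBall_ge {x : Cube d} (hx : ∀ i, x i ∈ G.range) {r R : ℝ}
    (hR : 4 ≤ R) (hr0 : 0 < r) (hr1 : r ≤ 1) (hr : R / G.N ≤ r) :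
    (1 - 4 / R) ^ d * (G.target d).real (Metric.closedBall x r) ≤
      (G.lattice d).real (Metric.closedBall x r) := by
  have hN := G.N_pos
  have ha := G.half_le
  have hR0 : 0 ≤ 1 - 4 / R := by
    rw [sub_nonneg, div_le_one (by linarith)]; exact hR
  rw [closedBall_pi x hr0.le, target, lattice, pi_real, pi_real]
  calc _ = ∏ i : Fin d, ((1 - 4 / R) * G.unif.real (Metric.closedBall (x i) r)) := by
        simp [Finset.prod_mul_distrib]
    _ ≤ _ := Finset.prod_le_prod (fun _ _ => mul_nonneg hR0 measureReal_nonneg) fun i _ => ?_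
  have h1 := G.unif_le_atoms_add (x i) r
  have h2 := G.le_unif_of_mem_range (hx i) hr1
  have h3 : 2 / (G.a * G.N) ≤ 4 / R * r := by
    have hRN : 1 / G.N ≤ r / R := by
      rw [div_le_div_iff₀ hN (by linarith)]
      rw [div_le_iff₀ hN] at hr
      linarith
    have : 2 / G.a ≤ 4 := by rw [div_le_iff₀ G.a_pos]; linarith
    calc 2 / (G.a * G.N) = 2 / G.a * (1 / G.N) := by rw [div_mul_div_comm, mul_one]
      _ ≤ 4 * (r / R) := mul_le_mul this hRN (by positivity) (by norm_num)
      _ = 4 / R * r := by ring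
  have h4 : 4 / R * r ≤ 4 / R * G.unif.real (Metric.closedBall (x i) r) :=
    mul_le_mul_of_nonneg_left h2 (by positivity)
  linarith

lemma lattice_closedBall_eq_one {x : Cube d} (hx : ∀ i, x i ∈ G.range) {r : ℝ} (hr : G.s ≤ r) :
    (G.lattice d).real (Metric.closedBall x r) = 1 := by
  rw [closedBall_pi x (G.s_pos.le.trans hr), lattice, pi_real]
  exact Finset.prod_eq_one fun i _ => G.atoms_closedBall_eq_one (G.le_s_of_mem_range (hx i)) hr

lemma target_closedBall_eq_one {x : Cube d} (hx : ∀ i, x i ∈ G.range) {r : ℝ} (hr : G.s ≤ r) :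
    G.target d (Metric.closedBall x r) = 1 := by
  refine (prob_compl_eq_zero_iff Metric.isClosed_closedBall.measurableSet).1 ?_
  change ∀ᵐ y ∂G.target d, y ∈ Metric.closedBall x r
  filter_upwards [G.ae_target_mem] with y hy
  rw [Metric.mem_closedBall, dist_pi_le_iff (G.s_pos.le.trans hr)]
  intro i
  have h1 := G.le_s_of_mem_range (hx i)
  have h2 := G.le_s_of_mem_range (hy i)
  rw [Subtype.dist_eq, Real.dist_eq, abs_le]
  constructor <;> linarith [(x i).2.1, (y i).2.1]

end Grid

end TransferBandit

/-! ### Source laws with a prescribed transfer exponent. -/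

namespace TransferBandit

namespace Grid

variable (G : Grid) {d : ℕ}

/-- A law with density `W` on the cells, the remaining mass being placed on the lattice. -/
noncomputable def mix (W : Cube d → ℝ≥0∞) : Measure (Cube d) :=
  (G.target d).withDensity W + (1 - ∫⁻ x, W x ∂G.target d) • G.lattice d

lemma isProbabilityMeasure_mix {W : Cube d → ℝ≥0∞} (hW : ∀ x, W x ≤ 1) :
    IsProbabilityMeasure (G.mix W) := by
  have h : ∫⁻ x, W x ∂G.target d ≤ 1 := by
    calc ∫⁻ x, W x ∂G.target d ≤ ∫⁻ _, 1 ∂G.target d := lintegral_mono hW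
      _ = 1 := by simp
  refine ⟨?_⟩
  simp only [mix, Measure.add_apply, Measure.smul_apply, withDensity_apply _ MeasurableSet.univ,
    Measure.restrict_univ, measure_univ, smul_eq_mul, mul_one]
  exact add_tsub_cancel_of_le h

lemma ae_mix (W : Cube d → ℝ≥0∞) :
    ∀ᵐ x ∂G.mix W, (∃ j, x ∈ G.box j) ∨ ∀ i, x i ∈ G.gaps := by
  rw [mix, ae_add_measure_iff]
  refine ⟨?_, ?_⟩
  · refine (withDensity_absolutelyContinuous _ W).ae_le ?_
    filter_upwards [G.ae_target_mem] with x hx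
    exact Or.inl (G.exists_box hx)
  · refine Measure.ae_smul_measure ?_ _
    filter_upwards [G.ae_lattice_mem] with x hx
    exact Or.inr hx

lemma mix_closedBall_eq_one {W : Cube d → ℝ≥0∞} (hW : ∀ x, W x ≤ 1) {x : Cube d}
    (hx : ∀ i, x i ∈ G.range) {r : ℝ} (hr : G.s ≤ r) :
    (G.mix W).real (Metric.closedBall x r) = 1 := by
  have := G.isProbabilityMeasure_mix hW
  have hms : MeasurableSet (Metric.closedBall x r) := Metric.isClosed_closedBall.measurableSet
  have h : ∀ᵐ y ∂G.mix W, y ∈ Metric.closedBall x r := by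
    rw [mix, ae_add_measure_iff]
    refine ⟨(withDensity_absolutelyContinuous _ W).ae_le ?_, Measure.ae_smul_measure ?_ _⟩
    · exact (prob_compl_eq_zero_iff hms).2 (G.target_closedBall_eq_one hx hr)
    · refine (prob_compl_eq_zero_iff hms).2 ?_
      have := G.lattice_closedBall_eq_one hx hr
      rw [measureReal_def] at this
      rw [← ENNReal.ofReal_toReal (measure_ne_top (G.lattice d) _), this, ENNReal.ofReal_one]
  rw [measureReal_def, (prob_compl_eq_zero_iff hms).1 h, ENNReal.toReal_one]

/-- If the density is at most `lam` on a set without lattice points, so is the ratio of the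
masses. -/
lemma mix_real_le {W : Cube d → ℝ≥0∞} {lam : ℝ} (hlam : 0 ≤ lam)
    {B : Set (Cube d)} (hB : MeasurableSet B) (hW : ∀ x ∈ B, W x ≤ ENNReal.ofReal lam)
    (hl : ∀ x ∈ B, ∃ i, x i ∉ G.gaps) :
    (G.mix W).real B ≤ lam * (G.target d).real B := by
  have hlat : G.lattice d B = 0 := by
    refine measure_eq_zero_iff_ae_notMem.2 ?_
    filter_upwards [G.ae_lattice_mem] with x hx hxB
    obtain ⟨i, hi⟩ := hl x hxB
    exact hi (hx i)
  have h1 : G.mix W B ≤ ENNReal.ofReal lam * G.target d B := by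
    rw [mix, Measure.add_apply, Measure.smul_apply, hlat, smul_zero, add_zero,
      withDensity_apply _ hB, ← setLIntegral_const]
    exact setLIntegral_mono measurable_const hW
  have := ENNReal.toReal_mono (by finiteness) h1
  rwa [ENNReal.toReal_mul, ENNReal.toReal_ofReal hlam] at this

/-- If the density is at least `lam` outside a set that holds at most half of the mass of `B`, the
ratio of the masses is at least `lam / 2`. -/
lemma le_mix_real {W : Cube d → ℝ≥0∞} (hW1 : ∀ x, W x ≤ 1) {lam : ℝ} (hlam : 0 ≤ lam)
    {B B₀ : Set (Cube d)} (hB : MeasurableSet B) (hB₀ : MeasurableSet B₀)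
    (hW : ∀ x ∈ B, x ∉ B₀ → ENNReal.ofReal lam ≤ W x)
    (hhalf : (G.target d).real B₀ ≤ 1 / 2 * (G.target d).real B) :
    lam / 2 * (G.target d).real B ≤ (G.mix W).real B := by
  have := G.isProbabilityMeasure_mix hW1
  have h1 : ENNReal.ofReal lam * G.target d (B \ B₀) ≤ G.mix W B := by
    rw [mix, Measure.add_apply]
    refine le_trans ?_ le_self_add
    refine le_trans ?_ (measure_mono (Set.sdiff_subset (s := B) (t := B₀)))
    rw [withDensity_apply _ (hB.diff hB₀), ← setLIntegral_const]
    exact setLIntegral_mono' (hB.diff hB₀) fun x hx => hW x hx.1 hx.2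
  have h2 := ENNReal.toReal_mono (measure_ne_top _ _) h1
  rw [ENNReal.toReal_mul, ENNReal.toReal_ofReal hlam] at h2
  have h3 : (G.target d).real B ≤ (G.target d).real (B \ B₀) + (G.target d).real B₀ :=
    (measureReal_mono (by intro x hx; by_cases h : x ∈ B₀ <;> simp [h, hx])).trans
      (measureReal_union_le _ _)
  have h4 : lam * ((G.target d).real B / 2) ≤ lam * (G.target d).real (B \ B₀) :=
    mul_le_mul_of_nonneg_left (by linarith) hlam
  calc lam / 2 * (G.target d).real B = lam * ((G.target d).real B / 2) := by ring
    _ ≤ _ := h4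
    _ ≤ _ := h2

lemma lattice_le_mix_real {W : Cube d → ℝ≥0∞} {lam : ℝ} (hlam : 0 ≤ lam) (hlam1 : lam ≤ 1)
    (hW : ∀ x, W x ≤ ENNReal.ofReal lam) (B : Set (Cube d)) :
    (1 - lam) * (G.lattice d).real B ≤ (G.mix W).real B := by
  have hW1 : ∀ x, W x ≤ 1 := fun x => (hW x).trans (by simpa using hlam1)
  have := G.isProbabilityMeasure_mix hW1
  have h : ∫⁻ x, W x ∂G.target d ≤ ENNReal.ofReal lam := by
    calc ∫⁻ x, W x ∂G.target d ≤ ∫⁻ _, ENNReal.ofReal lam ∂G.target d := lintegral_mono hW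
      _ = ENNReal.ofReal lam := by simp
  have h1 : ENNReal.ofReal (1 - lam) * G.lattice d B ≤ G.mix W B := by
    rw [mix, Measure.add_apply, Measure.smul_apply, smul_eq_mul]
    refine le_trans (mul_le_mul_left ?_ _) le_add_self
    rw [ENNReal.ofReal_sub _ hlam, ENNReal.ofReal_one]
    exact tsub_le_tsub_left h 1
  have h2 := ENNReal.toReal_mono (measure_ne_top _ _) h1
  rwa [ENNReal.toReal_mul, ENNReal.toReal_ofReal (by linarith)] at h2

/-- The density that is proportional to `‖x‖ ^ g` near `0` and constant further away. -/
noncomputable def weight (k L g : ℝ) (x : Cube d) : ℝ≥0∞ :=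
  ENNReal.ofReal (min (k * dist x 0) L ^ g)

lemma weight_le {k L g : ℝ} (hk : 0 ≤ k) (hL : 0 ≤ L) (hg : 0 ≤ g) (x : Cube d) :
    weight k L g x ≤ ENNReal.ofReal (L ^ g) :=
  ENNReal.ofReal_le_ofReal (Real.rpow_le_rpow (le_min (by positivity) hL) (min_le_right _ _) hg)

/-- Three ranges of radii: up to `R/N` the density on the cells gives enough mass, from there to `s`
the lattice does, and from `s` on every ball has mass `1`. -/
lemma transferCond_mix (hd : 1 ≤ d) {g R k : ℝ} (hg : 0 < g) (hR : R = 8 * d / (1 - G.s ^ g))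
    (hk : k = 2 ^ (1 / g) * (4 / G.a))
    (hL : (2 ^ (1 / g) * R / G.N) ^ g ≤ (1 - G.s ^ g) / 2) {c : ℝ} (hc : c ≤ 1) :
    TransferCond (G.target d) (G.mix (weight k (2 ^ (1 / g) * R / G.N) g))
      (ENNReal.ofReal g) c := by
  intro _ x hx r hr0 hr1
  rw [ENNReal.toReal_ofReal hg.le]
  have hxr : ∀ i, x i ∈ G.range := fun i => G.support_subset hx i
  have hN := G.N_pos
  have ha := G.a_pos
  have hd' : (1 : ℝ) ≤ d := by exact_mod_cast hd
  have hρ0 : 0 < G.s ^ g := Real.rpow_pos_of_pos G.s_pos g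
  have hρ1 : G.s ^ g < 1 := Real.rpow_lt_one G.s_pos.le G.s_lt_one hg
  set ρ := G.s ^ g with hρ
  have hR8 : 8 ≤ R := by
    rw [hR, le_div_iff₀ (by linarith)]; nlinarith
  have h2g : 0 < (2 : ℝ) ^ (1 / g) := by positivity
  set L := 2 ^ (1 / g) * R / G.N with hLdef
  have hL0 : 0 ≤ L := by positivity
  have hk0 : 0 ≤ k := by rw [hk]; positivity
  have hLg0 : 0 ≤ L ^ g := Real.rpow_nonneg hL0 g
  have hlam1 : L ^ g ≤ 1 := by linarith
  have hWl := weight_le (d := d) hk0 hL0 hg.le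
  have hW1 : ∀ x : Cube d, weight k L g x ≤ 1 := fun x => (hWl x).trans (by simpa using hlam1)
  have hQ0 : 0 ≤ (G.target d).real (Metric.closedBall x r) := measureReal_nonneg
  have hrg0 : 0 ≤ r ^ g := Real.rpow_nonneg hr0.le g
  -- The inequality holds with constant `1`, hence with every constant `c ≤ 1`.
  suffices h : r ^ g * (G.target d).real (Metric.closedBall x r) ≤
      (G.mix (weight k L g)).real (Metric.closedBall x r) by
    refine le_trans ?_ h
    rw [mul_assoc]
    exact mul_le_of_le_one_left (by positivity) hc
  rcases le_or_gt r (R / G.N) with hrR | hrR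
  · have hη : 0 ≤ G.a / 4 * r := by positivity
    -- At least half of the target mass of the ball is farther than `a r / 4` from `0`; there `k`
    -- and the cap `L` make the density at least `2 r ^ g`, which offsets the lost half.
    have hhalf : (G.target d).real (Metric.closedBall 0 (G.a / 4 * r)) ≤
        1 / 2 * (G.target d).real (Metric.closedBall x r) := by
      have h1 := G.target_closedBall_le (d := d) 0 hη
      have h2 := G.le_target_closedBall hxr hr0 hr1
      have h3 : 2 / G.a * (G.a / 4 * r) = 1 / 2 * r := by field_simp; norm_num
      rw [h3, mul_pow] at h1
      have h4 : (1 / 2 : ℝ) ^ d ≤ 1 / 2 := by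
        calc (1 / 2 : ℝ) ^ d ≤ (1 / 2) ^ 1 := pow_le_pow_of_le_one (by norm_num) (by norm_num) hd
          _ = 1 / 2 := pow_one _
      calc _ ≤ _ := h1
        _ ≤ 1 / 2 * r ^ d := mul_le_mul_of_nonneg_right h4 (by positivity)
        _ ≤ _ := by linarith
    have := G.le_mix_real (W := weight k L g) hW1 (lam := 2 * r ^ g) (by positivity)
      (B := Metric.closedBall x r) (B₀ := Metric.closedBall 0 (G.a / 4 * r))
      Metric.isClosed_closedBall.measurableSet Metric.isClosed_closedBall.measurableSet ?_ hhalf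
    · rwa [mul_div_assoc, mul_comm 2, div_mul_cancel₀ _ (two_ne_zero)] at this
    · intro y _ hy
      rw [Metric.mem_closedBall, not_le] at hy
      refine ENNReal.ofReal_le_ofReal ?_
      have h2 : 2 * r ^ g = (2 ^ (1 / g) * r) ^ g := by
        rw [Real.mul_rpow h2g.le hr0.le, ← Real.rpow_mul (by norm_num), one_div_mul_cancel hg.ne',
          Real.rpow_one]
      rw [h2]
      refine Real.rpow_le_rpow (by positivity) (le_min ?_ ?_) hg.le
      · rw [hk, mul_assoc]
        refine mul_le_mul_of_nonneg_left ?_ h2g.le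
        rw [div_mul_eq_mul_div, le_div_iff₀ ha]
        linarith
      · rw [hLdef, mul_div_assoc]
        exact mul_le_mul_of_nonneg_left hrR h2g.le
  rcases le_or_gt G.s r with hrs | hrs
  · rw [G.mix_closedBall_eq_one hW1 hxr hrs]
    calc r ^ g * (G.target d).real (Metric.closedBall x r) ≤ 1 * 1 :=
          mul_le_mul (Real.rpow_le_one hr0.le hr1 hg.le) measureReal_le_one hQ0 zero_le_one
      _ = 1 := one_mul 1
  · have h1 := G.lattice_le_mix_real (W := weight k L g) hLg0 hlam1 hWl (Metric.closedBall x r)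
    have h2 := G.lattice_closedBall_ge hxr (by linarith) hr0 hr1 hrR.le
    -- By Bernoulli's inequality `R` is just large enough for this. The lattice has weight at least
    -- `1 - L ^ g ≥ (1 + ρ) / 2` as well, and `((1 + ρ) / 2) ^ 2 ≥ ρ ≥ r ^ g`.
    have hb : (1 + ρ) / 2 ≤ (1 - 4 / R) ^ d := by
      have hneg : (-2 : ℝ) ≤ -(4 / R) := by
        have : 4 / R ≤ 2 := by rw [div_le_iff₀ (by linarith)]; linarith
        linarith
      have h3 := one_add_mul_le_pow hneg d
      have h4 : (d : ℝ) * (4 / R) = (1 - ρ) / 2 := by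
        rw [hR]
        have : 1 - ρ ≠ 0 := by linarith
        have : (d : ℝ) ≠ 0 := by positivity
        field_simp
        norm_num
      rw [← sub_eq_add_neg] at h3
      linarith
    have hrρ : r ^ g ≤ ρ := Real.rpow_le_rpow hr0.le hrs.le hg.le
    have h5 : ρ ≤ (1 - L ^ g) * (1 - 4 / R) ^ d := by
      calc ρ ≤ (1 + ρ) / 2 * ((1 + ρ) / 2) := by nlinarith [sq_nonneg (1 - ρ)]
        _ ≤ _ := mul_le_mul (by linarith) hb (by linarith) (by linarith)
    calc r ^ g * (G.target d).real (Metric.closedBall x r)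
        ≤ (1 - L ^ g) * (1 - 4 / R) ^ d * (G.target d).real (Metric.closedBall x r) :=
          mul_le_mul_of_nonneg_right (hrρ.trans h5) hQ0
      _ ≤ (1 - L ^ g) * (G.lattice d).real (Metric.closedBall x r) := by
          rw [mul_assoc]
          exact mul_le_mul_of_nonneg_left h2 (by linarith)
      _ ≤ _ := h1

/-- Balls about `0` of radius at most `w` contain no lattice point, and the density there is at most
`(k r) ^ g`. An exponent `g' < g` would give `c' ≤ k ^ g r ^ (g - g')`, which fails as `r → 0`. -/
lemma le_of_transferCond_mix (hd : 1 ≤ d) {g k L : ℝ} (hg : 0 < g) (hk : 0 ≤ k) (hL : 0 ≤ L)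
    {γ' : ℝ≥0∞} {c' : ℝ} (hc' : 0 < c')
    (h : TransferCond (G.target d) (G.mix (weight k L g)) γ' c') : ENNReal.ofReal g ≤ γ' := by
  by_cases htop : γ' = ⊤
  · rw [htop]; exact le_top
  by_contra hlt
  push Not at hlt
  set g' := γ'.toReal with hg'
  have hgg : g' < g := by
    have := (ENNReal.toReal_lt_toReal htop ENNReal.ofReal_ne_top).2 hlt
    rwa [ENNReal.toReal_ofReal hg.le] at this
  have h0 : ∀ i : Fin d, (0 : Cube d) i ∈ G.range := fun _ => G.zero_mem_range
  have key : ∀ r : ℝ, 0 < r → r ≤ G.w → r ≤ 1 → c' ≤ k ^ g * r ^ (g - g') := by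
    intro r hr0 hrw hr1
    have h1 := h htop 0 (G.mem_support h0) r hr0 hr1
    have hQ : 0 < (G.target d).real (Metric.closedBall 0 r) :=
      (pow_pos hr0 d).trans_le (G.le_target_closedBall h0 hr0 hr1)
    have h2 : (G.mix (weight k L g)).real (Metric.closedBall (0 : Cube d) r) ≤
        (k * r) ^ g * (G.target d).real (Metric.closedBall 0 r) := by
      refine G.mix_real_le (Real.rpow_nonneg (by positivity) g)
        Metric.isClosed_closedBall.measurableSet (fun x hx => ?_) fun x hx => ?_
      · exact ENNReal.ofReal_le_ofReal (Real.rpow_le_rpow (le_min (by positivity) hL)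
          ((min_le_left _ _).trans (mul_le_mul_of_nonneg_left hx hk)) hg.le)
      · refine ⟨⟨0, hd⟩, fun hgap => ?_⟩
        have h3 := G.w_le_of_mem_gaps hgap
        have h4 := (dist_le_pi_dist x 0 ⟨0, hd⟩).trans hx
        rw [Subtype.dist_eq, Real.dist_eq, Pi.zero_apply, Set.Icc.coe_zero, sub_zero] at h4
        linarith [le_abs_self ((x ⟨0, hd⟩ : unitInterval) : ℝ)]
    have h3 := le_of_mul_le_mul_right (h1.trans h2) hQ
    rw [Real.mul_rpow hk hr0.le] at h3
    rw [Real.rpow_sub hr0, ← mul_div_assoc, le_div_iff₀ (Real.rpow_pos_of_pos hr0 _)]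
    exact h3
  have hlim : Filter.Tendsto (fun r : ℝ => k ^ g * r ^ (g - g')) (nhdsWithin 0 (Set.Ioi 0))
      (nhds (k ^ g * 0)) := by
    refine Filter.Tendsto.const_mul _ ?_
    have := (Real.continuousAt_rpow_const 0 (g - g') (Or.inr (by linarith))).tendsto
    rw [Real.zero_rpow (by linarith)] at this
    exact this.mono_left nhdsWithin_le_nhds
  rw [mul_zero] at hlim
  have hev : ∀ᶠ r : ℝ in nhdsWithin 0 (Set.Ioi 0), c' ≤ k ^ g * r ^ (g - g') := by
    filter_upwards [Ioo_mem_nhdsGT (lt_min G.w_pos one_pos)] with r hr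
    exact key r hr.1 (hr.2.le.trans (min_le_left _ _)) (hr.2.le.trans (min_le_right _ _))
  exact absurd (ge_of_tendsto hlim hev) (not_le.2 hc')

end Grid

/-- Source laws with a given transfer exponent that put little mass on the cells away from `0`. -/
theorem exists_source {d : ℕ} (hd : 1 ≤ d) {a : ℝ} (ha : 1 / 2 ≤ a) (ha1 : a < 1) (γ : ℝ≥0∞)
    {c : ℝ} (hc0 : 0 < c) (hc : c ≤ 1) :
    ∃ A : ℝ, 0 ≤ A ∧ ∃ N₀ : ℕ, ∀ G : Grid, G.a = a → N₀ ≤ G.N →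
      ∃ P : Measure (Cube d), IsProbabilityMeasure P ∧ IsTransferExponent (G.target d) P γ c ∧
        (∀ r : ℝ, 0 < r → 0 < P (Metric.closedBall 0 r)) ∧
        (∀ j : Fin d → Fin G.N, (∃ i, (j i : ℕ) ≠ 0) → P.real (G.box j) ≤
          if γ = ⊤ then 0 else A * (1 / (G.N : ℝ)) ^ γ.toReal * (1 / G.N) ^ d) ∧
        ∀ᵐ x ∂P, (∃ j, x ∈ G.box j) ∨ ∀ i, x i ∈ G.gaps := by
  by_cases htop : γ = ⊤
  -- For `γ = ∞` the source sees only the origin. A ball about the corner of the cell `(1, …, 1)`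
  -- that misses `0` has source mass `0`, which rules out every finite exponent.
  · refine ⟨0, le_rfl, 0, fun G _ _ => ⟨Measure.dirac 0, inferInstance, ⟨fun h => (h htop).elim,
      fun γ' c' hc' _ h => ?_⟩, fun r hr => ?_, fun j hj => ?_, ?_⟩⟩
    · by_contra hlt
      have hγ' : γ' ≠ ⊤ := fun h' => hlt (by rw [h']; exact le_top)
      have hN := G.N_pos
      have h2 := G.two_le
      have h2' : (2 : ℝ) ≤ G.N := by exact_mod_cast h2
      set y : ℝ := G.pt 1 0 with hy
      have hyp : 0 < y := by
        have := G.s_pos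
        simp only [hy, Grid.pt, Int.cast_one, mul_one, mul_zero, add_zero]
        positivity
      have hy1 : y ≤ 1 := by
        have := G.pt_mem (j := 1) (f := 0) (by norm_num) (by omega) le_rfl zero_le_one
        linarith [this.2, G.w_pos, G.s_lt_one]
      let x : Cube d := fun _ => ⟨y, hyp.le, hy1⟩
      have hx : ∀ i, x i ∈ G.range := by
        intro i
        refine Set.mem_iUnion.2 ⟨⟨1, by omega⟩, ?_⟩
        refine ⟨le_rfl, ?_⟩
        change G.pt ((1 : ℕ) : ℤ) 0 ≤ _
        rw [G.le_iff, G.N_mul_pt, G.N_mul_pt]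
        linarith [G.a_pos]
      have h3 := h hγ' x (G.mem_support hx) (y / 2) (by linarith) (by linarith)
      have h4 := G.le_target_closedBall hx (r := y / 2) (by linarith) (by linarith)
      have h5 : (0 : Cube d) ∉ Metric.closedBall x (y / 2) := by
        intro hmem
        have h6 := (dist_le_pi_dist (0 : Cube d) x ⟨0, hd⟩).trans hmem
        rw [Subtype.dist_eq, Real.dist_eq, Pi.zero_apply, Set.Icc.coe_zero, zero_sub, abs_neg] at h6
        have h7 : ((x ⟨0, hd⟩ : unitInterval) : ℝ) = y := rfl
        rw [h7, abs_of_pos hyp] at h6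
        linarith
      rw [measureReal_def (μ := Measure.dirac _), Measure.dirac_apply' _
        Metric.isClosed_closedBall.measurableSet, Set.indicator_of_notMem h5,
        ENNReal.toReal_zero] at h3
      have h8 : 0 < (G.target d).real (Metric.closedBall x (y / 2)) :=
        (by positivity : 0 < (y / 2) ^ d).trans_le h4
      have h9 : 0 < c' * (y / 2) ^ γ'.toReal * (G.target d).real (Metric.closedBall x (y / 2)) := by
        positivity
      linarith
    · rw [Measure.dirac_apply' _ Metric.isClosed_closedBall.measurableSet,
        Set.indicator_of_mem (Metric.mem_closedBall_self hr.le)]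
      simp
    · have hnot : (0 : Cube d) ∉ G.box j := by
        intro hmem
        obtain ⟨i, hi⟩ := hj
        have h1 := (G.mem_box.1 hmem i).1
        have h2 := G.pt_add_lt (Nat.pos_of_ne_zero hi)
        have h3 := G.pt_mem (j := ((0 : ℕ) : ℤ)) (f := 1) (by simp) (by have := G.two_le; omega)
          zero_le_one le_rfl
        rw [Pi.zero_apply, Set.Icc.coe_zero] at h1
        linarith [h3.1, G.w_pos]
      rw [if_pos htop, measureReal_def, Measure.dirac_apply' _ (G.measurableSet_box j),
        Set.indicator_of_notMem hnot, ENNReal.toReal_zero]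
    · rw [ae_dirac_eq]
      exact Or.inl (G.exists_box fun _ => G.zero_mem_range)
  have hpos : ∀ (G : Grid) (P : Measure (Cube d)), TransferCond (G.target d) P γ c →
      ∀ r : ℝ, 0 < r → 0 < P (Metric.closedBall 0 r) := by
    intro G P h r hr
    have h0 : ∀ i : Fin d, (0 : Cube d) i ∈ G.range := fun _ => G.zero_mem_range
    have hm : 0 < min r 1 := lt_min hr one_pos
    have h1 := h htop 0 (G.mem_support h0) (min r 1) hm (min_le_right _ _)
    have h2 := (pow_pos hm d).trans_le (G.le_target_closedBall h0 hm (min_le_right _ _))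
    have h3 : 0 < P.real (Metric.closedBall 0 (min r 1)) := lt_of_lt_of_le (by positivity) h1
    exact (ENNReal.toReal_pos_iff.1 h3).1.trans_le
      (measure_mono (Metric.closedBall_subset_closedBall (min_le_left _ _)))
  by_cases hzero : γ = 0
  · refine ⟨1, zero_le_one, 0, fun G _ _ => ⟨G.target d, inferInstance, ?_, ?_, fun j _ => ?_, ?_⟩⟩
    · refine ⟨fun _ x _ r _ _ => ?_, fun γ' _ _ _ _ => by rw [hzero]; exact zero_le⟩
      rw [hzero, ENNReal.toReal_zero, Real.rpow_zero, mul_one]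
      exact mul_le_of_le_one_left measureReal_nonneg hc
    · refine hpos G _ fun _ x _ r _ _ => ?_
      rw [hzero, ENNReal.toReal_zero, Real.rpow_zero, mul_one]
      exact mul_le_of_le_one_left measureReal_nonneg hc
    · rw [if_neg htop, hzero, ENNReal.toReal_zero, Real.rpow_zero, mul_one, one_mul, G.target_box]
    · filter_upwards [G.ae_target_mem] with x hx
      exact Or.inl (G.exists_box hx)
  set g := γ.toReal with hg
  have hg0 : 0 < g := ENNReal.toReal_pos hzero htop
  have hγ : γ = ENNReal.ofReal g := (ENNReal.ofReal_toReal htop).symm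
  set ρ : ℝ := ((1 + a) / 2) ^ g with hρ
  have hρ1 : ρ < 1 := Real.rpow_lt_one (by linarith) (by linarith) hg0
  set R : ℝ := 8 * d / (1 - ρ) with hR
  have hR0 : 0 ≤ R := div_nonneg (by positivity) (by linarith)
  set L₀ : ℝ := 2 ^ (1 / g) * R with hL₀
  have hL₀0 : 0 ≤ L₀ := by positivity
  set ε : ℝ := ((1 - ρ) / 2) ^ (1 / g) with hε
  have hε0 : 0 < ε := Real.rpow_pos_of_pos (by linarith) _
  -- The cap `L = L₀/N` bounds the density by `L₀ ^ g N ^ (-g)`, whence the constant; the threshold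
  -- on `N` makes `L ^ g ≤ (1 - ρ)/2`, so that the lattice keeps enough mass.
  refine ⟨L₀ ^ g, Real.rpow_nonneg hL₀0 g, ⌈L₀ / ε⌉₊, fun G hGa hGN => ?_⟩
  have hN := G.N_pos
  have hs : G.s ^ g = ρ := by rw [hρ, Grid.s, hGa]
  have hLε : L₀ / G.N ≤ ε := by
    rw [div_le_iff₀ hN, mul_comm, ← div_le_iff₀ hε0]
    exact (Nat.le_ceil _).trans (by exact_mod_cast hGN)
  have hLg : (L₀ / G.N) ^ g ≤ (1 - ρ) / 2 := by
    calc (L₀ / G.N) ^ g ≤ ε ^ g := Real.rpow_le_rpow (by positivity) hLε hg0.le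
      _ = (1 - ρ) / 2 := by
        rw [hε, ← Real.rpow_mul (by linarith), one_div_mul_cancel hg0.ne', Real.rpow_one]
  have hapos := G.a_pos
  have hk0 : (0 : ℝ) ≤ 2 ^ (1 / g) * (4 / G.a) := by positivity
  have hL0 : (0 : ℝ) ≤ L₀ / G.N := by positivity
  have hW := Grid.weight_le (d := d) hk0 hL0 hg0.le
  have hρ0 : 0 ≤ ρ := Real.rpow_nonneg (by linarith) g
  have hW1 : ∀ x : Cube d, Grid.weight (2 ^ (1 / g) * (4 / G.a)) (L₀ / G.N) g x ≤ 1 := fun x =>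
    (hW x).trans (by rw [ENNReal.ofReal_le_one]; linarith)
  have hT : TransferCond (G.target d)
      (G.mix (Grid.weight (2 ^ (1 / g) * (4 / G.a)) (L₀ / G.N) g)) γ c := by
    rw [hγ]
    exact G.transferCond_mix hd hg0 (by rw [hs]) rfl (by rw [hs]; exact hLg) hc
  refine ⟨_, G.isProbabilityMeasure_mix hW1, ⟨hT, fun γ' c' hc' _ h => ?_⟩, hpos G _ hT,
    fun j _ => ?_, G.ae_mix _⟩
  · rw [hγ]
    exact G.le_of_transferCond_mix hd hg0 hk0 hL0 hc' h
  · rw [if_neg htop, ← G.target_box j, ← Real.mul_rpow hL₀0 (by positivity), mul_one_div]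
    refine G.mix_real_le (Real.rpow_nonneg hL0 g) (G.measurableSet_box j) (fun x _ => hW x)
      fun x hx => ⟨⟨0, hd⟩, fun hgap => G.gaps_disjoint_range hgap (G.mem_range_of_box hx _)⟩

end TransferBandit

/-! ### The reward functions: a self-similar base and a signed perturbation. -/

namespace TransferBandit

/-- The power function with exponent `β ≤ 1` is `β`-Hölder with constant `1`. -/
lemma abs_rpow_sub_rpow_le {β u v : ℝ} (hβ : 0 < β) (hβ1 : β ≤ 1) (hu : 0 ≤ u) (hv : 0 ≤ v) :
    |u ^ β - v ^ β| ≤ |u - v| ^ β := by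
  wlog h : v ≤ u generalizing u v
  · rw [abs_sub_comm, abs_sub_comm u]
    exact this hv hu (by linarith)
  have h1 := Real.rpow_le_rpow hv h hβ.le
  have h2 := Real.rpow_add_le_add_rpow hv (sub_nonneg.2 h) hβ.le hβ1
  rw [add_sub_cancel] at h2
  rw [abs_of_nonneg (by linarith), abs_of_nonneg (by linarith)]
  linarith

/-- The common reward function of all arms but one, with a cusp at `0`. -/
noncomputable def base {d : ℕ} (β c₁ : ℝ) (x : Cube d) : ℝ := 1 / 4 + c₁ * dist x 0 ^ β

lemma dist_zero_le_one {d : ℕ} (x : Cube d) : dist x 0 ≤ 1 := by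
  rw [dist_pi_le_iff zero_le_one]
  intro i
  rw [Subtype.dist_eq, Real.dist_eq, Pi.zero_apply, Set.Icc.coe_zero, sub_zero,
    abs_of_nonneg (x i).2.1]
  exact (x i).2.2

lemma continuous_base {d : ℕ} {β c₁ : ℝ} (hβ : 0 < β) : Continuous (base (d := d) β c₁) := by
  unfold base
  exact continuous_const.add (continuous_const.mul
    ((continuous_id.dist continuous_const).rpow_const fun _ => Or.inr hβ.le))

lemma base_mem {d : ℕ} {β c₁ : ℝ} (hβ : 0 < β) (hc0 : 0 ≤ c₁) (hc1 : c₁ ≤ 1 / 4) (x : Cube d) :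
    1 / 4 ≤ base β c₁ x ∧ base β c₁ x ≤ 1 / 2 := by
  have h0 : 0 ≤ dist x 0 ^ β := Real.rpow_nonneg dist_nonneg β
  have h1 : dist x 0 ^ β ≤ 1 := Real.rpow_le_one dist_nonneg (dist_zero_le_one x) hβ.le
  unfold base
  constructor <;> nlinarith

lemma abs_base_sub_le {d : ℕ} {β c₁ : ℝ} (hβ : 0 < β) (hβ1 : β ≤ 1) (hc : 0 ≤ c₁) (x y : Cube d) :
    |base β c₁ x - base β c₁ y| ≤ c₁ * dist x y ^ β := by
  rw [base, base, add_sub_add_left_eq_sub, ← mul_sub, abs_mul, abs_of_nonneg hc]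
  refine mul_le_mul_of_nonneg_left ?_ hc
  refine (abs_rpow_sub_rpow_le hβ hβ1 dist_nonneg dist_nonneg).trans ?_
  refine Real.rpow_le_rpow (abs_nonneg _) ?_ hβ.le
  have := abs_dist_sub_le x y 0
  exact this

/-- The mean is a local projection of degree `0` if the ball contains the bin. -/
lemma isLocalProj_mean {d : ℕ} {μ : Measure (Cube d)} [IsFiniteMeasure μ] {f : Cube d → ℝ}
    (hf : Continuous f) {B : Set (Cube d)} (hBm : MeasurableSet B) (hB : μ B ≠ 0) {h : ℝ}
    {x : Cube d} (hsub : B ⊆ Metric.closedBall x h) :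
    IsLocalProj 0 h f B μ x (MvPolynomial.C (∫ u, f u ∂ProbabilityTheory.cond μ B)) := by
  have := cond_isProbabilityMeasure (μ := μ) hB
  set ν := ProbabilityTheory.cond μ B with hν
  set m := ∫ u, f u ∂ν with hm
  have hres : ν.restrict (Metric.closedBall x h) = ν := by
    refine Measure.restrict_eq_self_of_ae_mem ?_
    filter_upwards [ae_cond_mem hBm] with u hu
    exact hsub hu
  have hint : ∀ g : Cube d → ℝ, Continuous g → Integrable g ν := fun g hg =>
    hg.integrable_of_hasCompactSupport (HasCompactSupport.of_compactSpace g)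
  refine ⟨by simp, fun g' hg' => ?_⟩
  -- Competitors are constants, so optimality of the mean is the bias–variance identity.
  rw [MvPolynomial.totalDegree_eq_zero_iff_eq_C.1 (Nat.le_zero.1 hg')]
  set c := MvPolynomial.coeff 0 g'
  simp only [localError, polyEval, MvPolynomial.eval_C, sq_abs]
  rw [← hν, hres]
  have h1 : ∀ u, (f u - c) ^ 2 = (f u - m) ^ 2 + (2 * (m - c) * (f u - m) + (m - c) ^ 2) :=
    fun u => by ring
  have h2 : ∫ u, (f u - m) ∂ν = 0 := by
    rw [integral_sub (hint f hf) (integrable_const m), integral_const, ← hm]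
    simp
  simp_rw [h1]
  rw [integral_add (hint _ (by fun_prop)) (hint _ (by fun_prop)),
    integral_add (hint _ (by fun_prop)) (integrable_const _), integral_const_mul, h2, mul_zero,
    zero_add, integral_const]
  simp only [probReal_univ, smul_eq_mul, one_mul]
  linarith [sq_nonneg (m - c)]

/-- The base function is self-similar under every law that charges all neighbourhoods of `0`. -/
lemma selfSimilar_base {d : ℕ} (hd : 1 ≤ d) {β c₁ : ℝ} (hβ : 0 < β) (l₀ : ℝ)
    (μ : Measure (Cube d)) [IsFiniteMeasure μ]
    (hμ : ∀ r : ℝ, 0 < r → 0 < μ (Metric.closedBall 0 r)) :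
    SelfSimilar β l₀ (c₁ / 2) μ (base β c₁) := by
  intro l _
  set h : ℝ := (2 : ℝ) ^ (-(l : ℝ)) with hh
  have hh0 : 0 < h := Real.rpow_pos_of_pos two_pos _
  have hl : h = 1 / 2 ^ l := by rw [hh, Real.rpow_neg two_pos.le, Real.rpow_natCast, one_div]
  have hh1 : h ≤ 1 := by
    rw [hl, div_le_one (by positivity)]; exact one_le_pow₀ one_le_two
  let k : Fin d → Fin (2 ^ l) := fun _ => ⟨0, by positivity⟩
  have hbin : bin l k = Metric.closedBall 0 h := by
    ext x
    rw [Metric.mem_closedBall, dist_pi_le_iff hh0.le, bin, Set.mem_ofPred_eq]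
    refine forall_congr' fun i => ?_
    rw [Subtype.dist_eq, Real.dist_eq, Pi.zero_apply, Set.Icc.coe_zero, sub_zero,
      abs_of_nonneg (x i).2.1, hl]
    simp [k, (x i).2.1]
  have hBm : MeasurableSet (bin l k) := by
    rw [hbin]; exact Metric.isClosed_closedBall.measurableSet
  have hBpos : 0 < μ (bin l k) := by rw [hbin]; exact hμ h hh0
  let y : Cube d := fun _ => ⟨h, hh0.le, hh1⟩
  have hy : dist y 0 = h := by
    have : ∀ i, dist (y i) ((0 : Cube d) i) = h := fun i => by
      rw [Subtype.dist_eq, Real.dist_eq, Pi.zero_apply, Set.Icc.coe_zero, sub_zero,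
        abs_of_pos hh0]
    refine le_antisymm ((dist_pi_le_iff hh0.le).2 fun i => (this i).le) ?_
    rw [← this ⟨0, hd⟩]
    exact dist_le_pi_dist _ _ _
  have hmem0 : (0 : Cube d) ∈ bin l k := by rw [hbin]; exact Metric.mem_closedBall_self hh0.le
  have hmemy : y ∈ bin l k := by rw [hbin, Metric.mem_closedBall, hy]
  -- The bandwidth equals the side of the bin, so the localization is void and the projection is the
  -- plain mean over the bin.
  have hsub : ∀ x ∈ bin l k, bin l k ⊆ Metric.closedBall x h := by
    intro x hx u hu
    rw [Metric.mem_closedBall, dist_pi_le_iff hh0.le]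
    intro i
    have h1 := hx i
    have h2 := hu i
    simp only [k, Nat.cast_zero, zero_div, zero_add, ← hl] at h1 h2
    rw [Subtype.dist_eq, Real.dist_eq, abs_le]
    constructor <;> linarith [h1.1, h1.2, h2.1, h2.2]
  have hcont := continuous_base (d := d) (c₁ := c₁) hβ
  set m := ∫ u, base β c₁ u ∂ProbabilityTheory.cond μ (bin l k) with hm
  have key : ∀ x ∈ bin l k, c₁ / 2 * (2 : ℝ) ^ (-(β * (l : ℝ))) ≤ |m - base β c₁ x| →
      ENNReal.ofReal (c₁ / 2 * (2 : ℝ) ^ (-(β * (l : ℝ)))) ≤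
        ⨆ (k : Fin d → Fin (2 ^ l)) (_ : 0 < μ (bin l k)) (x ∈ bin l k)
        (g : MvPolynomial (Fin d) ℝ)
        (_ : IsLocalProj 0 ((2 : ℝ) ^ (-(l : ℝ))) (base β c₁) (bin l k) μ x g),
        ENNReal.ofReal |polyEval g x - base β c₁ x| := by
    intro x hx hle
    refine le_iSup_of_le k (le_iSup_of_le hBpos (le_iSup_of_le x (le_iSup_of_le hx
      (le_iSup_of_le (MvPolynomial.C m) (le_iSup_of_le
        (isLocalProj_mean hcont hBm hBpos.ne' (hsub x hx)) ?_)))))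
    simp only [polyEval, MvPolynomial.eval_C]
    exact ENNReal.ofReal_le_ofReal hle
  have hpow : (2 : ℝ) ^ (-(β * (l : ℝ))) = h ^ β := by
    rw [hh, ← Real.rpow_mul two_pos.le]; ring_nf
  have hb0 : base β c₁ (0 : Cube d) = 1 / 4 := by
    simp [base, Real.zero_rpow hβ.ne']
  have hby : base β c₁ y = 1 / 4 + c₁ * h ^ β := by rw [base, hy]
  -- The values at the corners `0` and `y` differ by `c₁ h ^ β`, so the mean is at least half of
  -- that away from one of them.
  rcases le_or_gt (1 / 4 + c₁ / 2 * h ^ β) m with hcase | hcase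
  · refine key 0 hmem0 ?_
    rw [hpow, hb0]
    exact le_trans (by linarith) (le_abs_self _)
  · refine key y hmemy ?_
    rw [hpow, hby]
    exact le_trans (by linarith) (neg_le_abs _)

namespace Grid

variable (G : Grid) {d : ℕ} (S : Finset (Fin d → Fin G.N)) (σ : (Fin d → Fin G.N) → Bool)

/-- The points away from all the selected cells of sign `b`. -/
def far (b : Bool) : Set (Cube d) :=
  {x | ∀ j ∈ S, σ j = b → ∃ i, (x i : ℝ) ≤ G.pt (j i : ℕ) 0 - G.w ∨ G.pt (j i : ℕ) 1 + G.w ≤ x i}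

/-- `Metric.infDist` to the empty set is `0` by convention, which would make the bump vanish if
every cell were near; the corner `(1, …, 1)` lies beyond all cells and excludes this. -/
lemma far_nonempty (hd : 1 ≤ d) (b : Bool) : (G.far S σ b).Nonempty := by
  refine ⟨fun _ => 1, fun j _ _ => ⟨⟨0, hd⟩, Or.inr ?_⟩⟩
  have := G.pt_mem (j := ((j ⟨0, hd⟩ : ℕ) : ℤ)) (f := 1) (by omega)
    (by exact_mod_cast (j ⟨0, hd⟩).2) zero_le_one le_rfl
  rw [Set.Icc.coe_one]
  linarith [G.s_lt_one]

/-- A function that is `w ^ β` on the selected cells of sign `b` and `0` far from them. -/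
noncomputable def bump (β : ℝ) (b : Bool) (x : Cube d) : ℝ :=
  min (Metric.infDist x (G.far S σ b)) G.w ^ β

/-- The perturbation of the base function. -/
noncomputable def pert (β c₀ : ℝ) (x : Cube d) : ℝ :=
  c₀ * (G.bump S σ β true x - G.bump S σ β false x)

variable {β : ℝ}

lemma continuous_bump (hβ : 0 < β) (b : Bool) : Continuous (G.bump S σ β b) :=
  ((Metric.continuous_infDist_pt _).min continuous_const).rpow_const fun _ => Or.inr hβ.le

lemma continuous_pert (hβ : 0 < β) (c₀ : ℝ) : Continuous (G.pert S σ β c₀) :=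
  continuous_const.mul ((G.continuous_bump S σ hβ true).sub (G.continuous_bump S σ hβ false))

lemma bump_nonneg (b : Bool) (x : Cube d) : 0 ≤ G.bump S σ β b x :=
  Real.rpow_nonneg (le_min Metric.infDist_nonneg G.w_pos.le) β

lemma bump_le (hβ : 0 < β) (b : Bool) (x : Cube d) : G.bump S σ β b x ≤ G.w ^ β :=
  Real.rpow_le_rpow (le_min Metric.infDist_nonneg G.w_pos.le) (min_le_right _ _) hβ.le

lemma abs_bump_sub_le (hβ : 0 < β) (hβ1 : β ≤ 1) (b : Bool) (x y : Cube d) :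
    |G.bump S σ β b x - G.bump S σ β b y| ≤ dist x y ^ β := by
  have h0 : ∀ z : Cube d, 0 ≤ min (Metric.infDist z (G.far S σ b)) G.w := fun z =>
    le_min Metric.infDist_nonneg G.w_pos.le
  refine (abs_rpow_sub_rpow_le hβ hβ1 (h0 x) (h0 y)).trans ?_
  refine Real.rpow_le_rpow (abs_nonneg _) ?_ hβ.le
  refine (abs_min_sub_min_le_max _ _ _ _).trans ?_
  rw [sub_self, abs_zero]
  refine max_le ?_ dist_nonneg
  have h1 := Metric.infDist_le_infDist_add_dist (s := G.far S σ b) (x := x) (y := y)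
  have h2 := Metric.infDist_le_infDist_add_dist (s := G.far S σ b) (x := y) (y := x)
  rw [dist_comm] at h2
  rw [abs_le]
  constructor <;> linarith

lemma abs_pert_sub_le (hβ : 0 < β) (hβ1 : β ≤ 1) {c₀ : ℝ} (hc : 0 ≤ c₀) (x y : Cube d) :
    |G.pert S σ β c₀ x - G.pert S σ β c₀ y| ≤ 2 * c₀ * dist x y ^ β := by
  have h1 := abs_le.1 (G.abs_bump_sub_le S σ hβ hβ1 true x y)
  have h2 := abs_le.1 (G.abs_bump_sub_le S σ hβ hβ1 false x y)
  rw [pert, pert, ← mul_sub, abs_mul, abs_of_nonneg hc, mul_comm 2, mul_assoc]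
  refine mul_le_mul_of_nonneg_left (abs_le.2 ⟨?_, ?_⟩) hc <;> linarith [h1.1, h1.2, h2.1, h2.2]

lemma abs_pert_le (hβ : 0 < β) {c₀ : ℝ} (hc : 0 ≤ c₀) (x : Cube d) :
    |G.pert S σ β c₀ x| ≤ c₀ * G.w ^ β := by
  rw [pert, abs_mul, abs_of_nonneg hc]
  refine mul_le_mul_of_nonneg_left (abs_le.2 ?_) hc
  have h1 := G.bump_nonneg S σ (β := β) true x
  have h2 := G.bump_nonneg S σ (β := β) false x
  have h3 := G.bump_le S σ hβ true x
  have h4 := G.bump_le S σ hβ false x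
  constructor <;> linarith

lemma bump_eq_zero (hβ : 0 < β) {b : Bool} {x : Cube d} (hx : x ∈ G.far S σ b) :
    G.bump S σ β b x = 0 := by
  rw [bump, Metric.infDist_zero_of_mem hx, min_eq_left G.w_pos.le, Real.zero_rpow hβ.ne']

lemma bump_eq (hd : 1 ≤ d) {b : Bool} {j : Fin d → Fin G.N} (hj : j ∈ S) (hb : σ j = b)
    {x : Cube d} (hx : x ∈ G.box j) : G.bump S σ β b x = G.w ^ β := by
  rw [bump, min_eq_right]
  refine (Metric.le_infDist (G.far_nonempty S σ hd b)).2 fun y hy => ?_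
  obtain ⟨i, hi⟩ := hy j hj hb
  have h1 := G.mem_box.1 hx i
  refine le_trans ?_ (dist_le_pi_dist x y i)
  rw [Subtype.dist_eq, Real.dist_eq]
  rcases hi with hi | hi
  · exact le_trans (by linarith [h1.1]) (le_abs_self _)
  · exact le_trans (by linarith [h1.2]) (neg_le_abs _)

lemma box_subset_far {b : Bool} {j : Fin d → Fin G.N} (hj : j ∈ S → σ j ≠ b)
    {x : Cube d} (hx : x ∈ G.box j) : x ∈ G.far S σ b := by
  intro k hk hkb
  have hjk : j ≠ k := fun h => hj (h ▸ hk) (h ▸ hkb)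
  obtain ⟨i, hi⟩ := Function.ne_iff.1 hjk
  have h1 := G.mem_box.1 hx i
  refine ⟨i, ?_⟩
  have hw := G.w_pos
  rcases lt_or_gt_of_ne (fun h => hi (Fin.ext h) : (j i : ℕ) ≠ k i) with h | h
  · left; linarith [G.pt_add_lt h, h1.2]
  · right; linarith [G.pt_add_lt h, h1.1]

/-- A gap has length `2w`, so its midpoint is at distance at least `w` from every interval. Hence
source observations on the lattice carry no information on the signs. -/
lemma gaps_subset_far (hd : 1 ≤ d) {b : Bool} {x : Cube d} (hx : ∀ i, x i ∈ G.gaps) :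
    x ∈ G.far S σ b := by
  intro k _ _
  refine ⟨⟨0, hd⟩, ?_⟩
  obtain ⟨j, hj : (x ⟨0, hd⟩ : ℝ) = _⟩ := Set.mem_iUnion.1 (hx ⟨0, hd⟩)
  rcases lt_or_ge (j : ℕ) (k ⟨0, hd⟩) with h | h
  · left; linarith [G.pt_add_lt h]
  · right
    have : G.pt (k ⟨0, hd⟩ : ℕ) 1 ≤ G.pt (j : ℕ) 1 := by
      rw [le_iff, N_mul_pt, N_mul_pt]
      have : ((k ⟨0, hd⟩ : ℕ) : ℝ) ≤ (j : ℕ) := by exact_mod_cast h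
      push_cast
      nlinarith [G.s_pos]
    linarith

lemma pert_of_mem (hd : 1 ≤ d) (hβ : 0 < β) (c₀ : ℝ) {j : Fin d → Fin G.N} (hj : j ∈ S)
    {x : Cube d} (hx : x ∈ G.box j) :
    G.pert S σ β c₀ x = if σ j then c₀ * G.w ^ β else -(c₀ * G.w ^ β) := by
  cases hσ : σ j
  · rw [pert, G.bump_eq S σ hd hj hσ hx,
      G.bump_eq_zero S σ hβ (G.box_subset_far S σ (b := true) (fun _ => by simp [hσ]) hx)]
    simp
  · rw [pert, G.bump_eq S σ hd hj hσ hx,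
      G.bump_eq_zero S σ hβ (G.box_subset_far S σ (b := false) (fun _ => by simp [hσ]) hx)]
    simp

lemma pert_of_notMem (hβ : 0 < β) (c₀ : ℝ) {j : Fin d → Fin G.N} (hj : j ∉ S)
    {x : Cube d} (hx : x ∈ G.box j) : G.pert S σ β c₀ x = 0 := by
  rw [pert, G.bump_eq_zero S σ hβ (G.box_subset_far S σ (fun h => (hj h).elim) hx),
    G.bump_eq_zero S σ hβ (G.box_subset_far S σ (fun h => (hj h).elim) hx), sub_self, mul_zero]

lemma pert_of_gaps (hd : 1 ≤ d) (hβ : 0 < β) (c₀ : ℝ) {x : Cube d} (hx : ∀ i, x i ∈ G.gaps) :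
    G.pert S σ β c₀ x = 0 := by
  rw [pert, G.bump_eq_zero S σ hβ (G.gaps_subset_far S σ hd hx),
    G.bump_eq_zero S σ hβ (G.gaps_subset_far S σ hd hx), sub_self, mul_zero]

end Grid

end TransferBandit

/-! ### Bernoulli bandits and the affinity of one observation. -/

namespace TransferBandit

/-- The Bernoulli law with success probability `p`. -/
noncomputable def bern (p : ℝ) : Measure unitInterval :=
  ENNReal.ofReal p • Measure.dirac 1 + ENNReal.ofReal (1 - p) • Measure.dirac 0

lemma isProbabilityMeasure_bern {p : ℝ} (h0 : 0 ≤ p) (h1 : p ≤ 1) :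
    IsProbabilityMeasure (bern p) := by
  refine ⟨?_⟩
  simp only [bern, Measure.add_apply, Measure.smul_apply, measure_univ, smul_eq_mul, mul_one]
  rw [← ENNReal.ofReal_add h0 (by linarith)]
  simp

lemma lintegral_bern (p : ℝ) (F : unitInterval → ℝ≥0∞) :
    ∫⁻ y, F y ∂bern p = ENNReal.ofReal p * F 1 + ENNReal.ofReal (1 - p) * F 0 := by
  simp [bern, lintegral_add_measure, lintegral_smul_measure]

lemma integral_bern {p : ℝ} (h0 : 0 ≤ p) : ∫ y, (y : ℝ) ∂bern p = p := by
  have hi : ∀ x : unitInterval, Integrable (fun y : unitInterval => (y : ℝ)) (Measure.dirac x) :=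
    fun x => integrable_dirac (by simp)
  rw [bern, integral_add_measure ((hi 1).smul_measure ENNReal.ofReal_ne_top)
    ((hi 0).smul_measure ENNReal.ofReal_ne_top)]
  simp [integral_smul_measure, h0]

/-- The density of a Bernoulli law with respect to another one. -/
noncomputable def bernRatio (p p' : ℝ) (y : unitInterval) : ℝ≥0∞ :=
  if y = 1 then ENNReal.ofReal (p' / p) else ENNReal.ofReal ((1 - p') / (1 - p))

lemma measurable_bernRatio_right (p p' : ℝ) : Measurable (bernRatio p p') :=
  Measurable.ite (measurableSet_singleton _) measurable_const measurable_const

lemma bern_withDensity {p p' : ℝ} (h0 : 0 < p) (h1 : p < 1) :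
    bern p' = (bern p).withDensity (bernRatio p p') := by
  refine Measure.ext_of_lintegral _ fun F hF => ?_
  rw [lintegral_withDensity_eq_lintegral_mul _ (measurable_bernRatio_right p p') hF,
    lintegral_bern, lintegral_bern]
  have h2 : 0 < 1 - p := by linarith
  simp only [Pi.mul_apply, bernRatio, if_true, zero_ne_one, if_false]
  rw [← mul_assoc, ← mul_assoc, ← ENNReal.ofReal_mul h0.le, ← ENNReal.ofReal_mul h2.le,
    mul_div_cancel₀ _ h0.ne', mul_div_cancel₀ _ h2.ne']

/-- The difference of the arithmetic and geometric means is `(√p - √p')² / 2 = (p - p')² / (2 (√p +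
√p')²)`, and `(√p + √p')² ≥ p + p' ≥ 1/4`. -/
lemma half_add_sub_le_sqrt {p p' : ℝ} (hp : 1 / 8 ≤ p) (hp' : 1 / 8 ≤ p') :
    (p + p') / 2 - 2 * (p - p') ^ 2 ≤ √p * √p' := by
  have h1 : √p ^ 2 = p := Real.sq_sqrt (by linarith)
  have h2 : √p' ^ 2 = p' := Real.sq_sqrt (by linarith)
  have h3 := Real.sqrt_nonneg p
  have h4 := Real.sqrt_nonneg p'
  set a := √p
  set b := √p'
  rw [← h1, ← h2]
  have h5 : 1 / 4 ≤ (a + b) ^ 2 := by nlinarith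
  nlinarith [mul_nonneg (sq_nonneg (a - b)) (sub_nonneg.2 h5)]

/-- The affinity of two Bernoulli laws is close to one if their means are close. -/
lemma affinity_bern {p p' : ℝ} (hp : 1 / 8 ≤ p) (hp1 : p ≤ 7 / 8) (hp' : 1 / 8 ≤ p')
    (hp1' : p' ≤ 7 / 8) :
    ENNReal.ofReal (1 - 4 * (p - p') ^ 2) ≤ ∫⁻ y, bernRatio p p' y ^ (1 / 2 : ℝ) ∂bern p := by
  have key : ∀ q q' : ℝ, 0 < q → 0 < q' →
      ENNReal.ofReal q * ENNReal.ofReal (q' / q) ^ (1 / 2 : ℝ) = ENNReal.ofReal (√q * √q') := by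
    intro q q' hq hq'
    rw [ENNReal.ofReal_rpow_of_nonneg (by positivity) (by norm_num), ← ENNReal.ofReal_mul hq.le,
      ← Real.sqrt_eq_rpow, Real.sqrt_div hq'.le]
    congr 1
    have h := Real.mul_self_sqrt hq.le
    have h' : √q ≠ 0 := (Real.sqrt_pos.2 hq).ne'
    field_simp
    linarith
  rw [lintegral_bern]
  simp only [bernRatio, if_true, zero_ne_one, if_false]
  rw [key p p' (by linarith) (by linarith), key (1 - p) (1 - p') (by linarith) (by linarith),
    ← ENNReal.ofReal_add (by positivity) (by positivity)]
  refine ENNReal.ofReal_le_ofReal ?_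
  have h1 := half_add_sub_le_sqrt hp hp'
  have h2 := half_add_sub_le_sqrt (p := 1 - p) (p' := 1 - p') (by linarith) (by linarith)
  nlinarith

/-- The law on the arms that gives mass `κ / K` to `k₁` and is uniform on the other arms. -/
noncomputable def armLaw {K : ℕ} (k₁ : Fin K) (κ : ℝ) : Measure (Fin K) :=
  ∑ k, ENNReal.ofReal (if k = k₁ then κ / K else (1 - κ / K) / (K - 1)) • Measure.dirac k

lemma armLaw_singleton {K : ℕ} (k₁ : Fin K) (κ : ℝ) (k : Fin K) :
    armLaw k₁ κ {k} = ENNReal.ofReal (if k = k₁ then κ / K else (1 - κ / K) / (K - 1)) := by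
  rw [armLaw, Measure.finsetSum_apply, Finset.sum_eq_single k]
  · simp
  · intro b _ hb
    simp [hb]
  · simp

lemma armWeight_nonneg {K : ℕ} (hK : 2 ≤ K) (k₁ k : Fin K) {κ : ℝ} (hκ : 0 ≤ κ) (hκ1 : κ ≤ 1) :
    0 ≤ (if k = k₁ then κ / K else (1 - κ / K) / (K - 1) : ℝ) := by
  have hK' : (2 : ℝ) ≤ K := by exact_mod_cast hK
  split_ifs
  · positivity
  · refine div_nonneg ?_ (by linarith)
    rw [sub_nonneg, div_le_one (by linarith)]
    linarith

lemma isProbabilityMeasure_armLaw {K : ℕ} (hK : 2 ≤ K) (k₁ : Fin K) {κ : ℝ} (hκ : 0 ≤ κ)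
    (hκ1 : κ ≤ 1) : IsProbabilityMeasure (armLaw k₁ κ) := by
  have hK' : (2 : ℝ) ≤ K := by exact_mod_cast hK
  refine ⟨?_⟩
  rw [armLaw, Measure.finsetSum_apply]
  simp only [Measure.smul_apply, measure_univ, smul_eq_mul, mul_one]
  rw [← ENNReal.ofReal_sum_of_nonneg fun k _ => armWeight_nonneg hK k₁ k hκ hκ1,
    Finset.sum_ite, Finset.sum_const, Finset.sum_const, Finset.filter_eq' Finset.univ k₁,
    Finset.filter_ne' Finset.univ k₁]
  simp only [Finset.mem_univ, if_true, Finset.card_singleton, one_smul,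
    Finset.card_erase_of_mem, Finset.card_univ, Fintype.card_fin, nsmul_eq_mul]
  rw [Nat.cast_sub (by omega), Nat.cast_one, mul_div_cancel₀ _ (by linarith : (K : ℝ) - 1 ≠ 0)]
  simp

/-- The Bernoulli rewards with a given mean function. -/
noncomputable def bernKernel {d K : ℕ} (m : Fin K → Cube d → ℝ) (hm : ∀ k, Continuous (m k)) :
    Kernel (Cube d × Fin K) unitInterval where
  toFun z := bern (m z.2 z.1)
  measurable' := by
    have hmeas : Measurable fun z : Cube d × Fin K => m z.2 z.1 :=
      measurable_from_prod_countable_left fun k => (hm k).measurable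
    refine Measure.measurable_of_measurable_coe _ fun s hs => ?_
    simp only [bern, Measure.add_apply, Measure.smul_apply, smul_eq_mul]
    exact (hmeas.ennreal_ofReal.mul_const _).add
      ((measurable_const.sub hmeas).ennreal_ofReal.mul_const _)

/-- The bandit with Bernoulli rewards and an arm law that does not depend on the covariate. -/
noncomputable def bernBandit {d K : ℕ} (Q P : Measure (Cube d)) [IsProbabilityMeasure Q]
    [IsProbabilityMeasure P] (ν : Measure (Fin K)) [IsProbabilityMeasure ν]
    (m : Fin K → Cube d → ℝ) (hm : ∀ k, Continuous (m k))
    (hm01 : ∀ k x, m k x ∈ Set.Icc (1 / 8 : ℝ) (7 / 8)) : Bandit d K where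
  QX := Q
  PX := P
  reward := bernKernel m hm
  behav := Kernel.const _ ν
  isProbQX := inferInstance
  isProbPX := inferInstance
  isMarkovReward := ⟨fun z => isProbabilityMeasure_bern
    (by linarith [(hm01 z.2 z.1).1]) (by linarith [(hm01 z.2 z.1).2])⟩
  isMarkovBehav := inferInstance

section bernBandit

variable {d K : ℕ} {Q P : Measure (Cube d)} [IsProbabilityMeasure Q] [IsProbabilityMeasure P]
  {ν : Measure (Fin K)} [IsProbabilityMeasure ν] {m m' : Fin K → Cube d → ℝ}
  {hm : ∀ k, Continuous (m k)} {hm' : ∀ k, Continuous (m' k)}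
  {hm01 : ∀ k x, m k x ∈ Set.Icc (1 / 8 : ℝ) (7 / 8)}
  {hm01' : ∀ k x, m' k x ∈ Set.Icc (1 / 8 : ℝ) (7 / 8)}

lemma bernBandit_f (k : Fin K) (x : Cube d) : (bernBandit Q P ν m hm hm01).f k x = m k x :=
  integral_bern (by linarith [(hm01 k x).1])

/-- The density of one observation for two families of Bernoulli rewards. -/
noncomputable def obsRatio (m m' : Fin K → Cube d → ℝ) (o : Obs d K) : ℝ≥0∞ :=
  bernRatio (m o.2.1 o.1) (m' o.2.1 o.1) o.2.2

lemma rewardDensity_bernBandit :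
    Bandit.RewardDensity (bernBandit Q P ν m hm hm01) (bernBandit Q P ν m' hm' hm01')
      (obsRatio m m') where
  meas := by
    have h1 : Measurable fun o : Obs d K => m o.2.1 o.1 :=
      (measurable_from_prod_countable_left (f := fun z : Cube d × Fin K => m z.2 z.1)
        fun k => (hm k).measurable).comp
        (measurable_fst.prodMk (measurable_fst.comp measurable_snd))
    have h2 : Measurable fun o : Obs d K => m' o.2.1 o.1 :=
      (measurable_from_prod_countable_left (f := fun z : Cube d × Fin K => m' z.2 z.1)
        fun k => (hm' k).measurable).comp
        (measurable_fst.prodMk (measurable_fst.comp measurable_snd))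
    exact Measurable.ite ((measurableSet_singleton (1 : unitInterval)).preimage
      (measurable_snd.comp measurable_snd)) (h2.div h1).ennreal_ofReal
      ((measurable_const.sub h2).div (measurable_const.sub h1)).ennreal_ofReal
  QX_eq := rfl
  PX_eq := rfl
  behav_eq := rfl
  reward_eq x k := bern_withDensity (by linarith [(hm01 k x).1]) (by linarith [(hm01 k x).2])

/-- A lower bound for the affinity of one observation whose covariate has law `μ` and whose arm is
chosen by `η`, if the mean functions differ by at most `2Δ` and only for the arm `k₁` in `B`. -/
lemma le_affinity (k₁ : Fin K) {B : Set (Cube d)} (hB : MeasurableSet B) {Δ t : ℝ} (ht : 0 ≤ t)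
    (hm01 : ∀ k x, m k x ∈ Set.Icc (1 / 8 : ℝ) (7 / 8))
    (hm01' : ∀ k x, m' k x ∈ Set.Icc (1 / 8 : ℝ) (7 / 8))
    (hdiff : ∀ x, |m k₁ x - m' k₁ x| ≤ 2 * Δ) (hoff : ∀ k x, k ≠ k₁ → m k x = m' k x)
    (μ : Measure (Cube d)) [IsProbabilityMeasure μ]
    (hae : ∀ᵐ x ∂μ, x ∉ B → m k₁ x = m' k₁ x)
    (η : Cube d → Measure (Fin K)) (hη : ∀ x, IsProbabilityMeasure (η x))
    (hη1 : ∀ x, η x {k₁} ≤ ENNReal.ofReal t) :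
    ENNReal.ofReal (1 - 16 * Δ ^ 2 * (t * μ.real B)) ≤
      ∫⁻ x, ∫⁻ k, ∫⁻ y, obsRatio m m' (x, k, y) ^ (1 / 2 : ℝ) ∂bern (m k x) ∂η x ∂μ := by
  set I : Cube d → Fin K → ℝ≥0∞ := fun x k =>
    ∫⁻ y, obsRatio m m' (x, k, y) ^ (1 / 2 : ℝ) ∂bern (m k x) with hI
  have hIle : ∀ x k, ENNReal.ofReal (1 - 4 * (m k x - m' k x) ^ 2) ≤ I x k := fun x k =>
    affinity_bern (hm01 k x).1 (hm01 k x).2 (hm01' k x).1 (hm01' k x).2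
  have h16 : 0 ≤ 16 * Δ ^ 2 := by positivity
  -- The deficit is kept on the right as a summand, because subtraction in `ℝ≥0∞` truncates; it is
  -- subtracted once, after both integrations. A mean difference of `2Δ` turns `4 (p - p')²` into
  -- `16 Δ²`.
  have hpt : ∀ᵐ x ∂μ, ∀ k, 1 ≤ I x k + ENNReal.ofReal (16 * Δ ^ 2) *
      (B.indicator 1 x * ({k₁} : Set (Fin K)).indicator 1 k) := by
    filter_upwards [hae] with x hx k
    have heq : m k x = m' k x → 1 ≤ I x k := fun h => by simpa [h] using hIle x k
    by_cases hk : k = k₁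
    · by_cases hxB : x ∈ B
      · subst hk
        simp only [hxB, Set.indicator_of_mem, Set.mem_singleton_iff, Pi.one_apply, mul_one]
        refine le_trans ?_ (add_le_add_left (hIle x k) _)
        rw [← ENNReal.ofReal_one]
        refine le_trans (ENNReal.ofReal_le_ofReal ?_) ENNReal.ofReal_add_le
        have h1 := sq_le_sq' (by linarith [(abs_le.1 (hdiff x)).1]) (abs_le.1 (hdiff x)).2
        nlinarith
      · exact (heq (by rw [hk]; exact hx hxB)).trans le_self_add
    · exact (heq (hoff k x hk)).trans le_self_add
  have hstep : ∀ᵐ x ∂μ, 1 ≤ ∫⁻ k, I x k ∂η x +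
      ENNReal.ofReal (16 * Δ ^ 2) * (B.indicator 1 x * ENNReal.ofReal t) := by
    filter_upwards [hpt] with x hx
    have := hη x
    calc (1 : ℝ≥0∞) = ∫⁻ _, 1 ∂η x := by simp
      _ ≤ ∫⁻ k, (I x k + ENNReal.ofReal (16 * Δ ^ 2) *
          (B.indicator 1 x * ({k₁} : Set (Fin K)).indicator 1 k)) ∂η x := lintegral_mono hx
      _ = ∫⁻ k, I x k ∂η x + ENNReal.ofReal (16 * Δ ^ 2) * (B.indicator 1 x * η x {k₁}) := by
          have hmi : Measurable fun k : Fin K =>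
              ({k₁} : Set (Fin K)).indicator (1 : Fin K → ℝ≥0∞) k := measurable_of_countable _
          rw [lintegral_add_right _ (measurable_of_countable _),
            lintegral_const_mul _ (measurable_of_countable _), lintegral_const_mul _ hmi,
            lintegral_indicator_one (MeasurableSet.singleton k₁)]
      _ ≤ _ := by gcongr; exact hη1 x
  have hfin : 1 ≤ ∫⁻ x, ∫⁻ k, I x k ∂η x ∂μ +
      ENNReal.ofReal (16 * Δ ^ 2 * (t * μ.real B)) := by
    have hmB : Measurable fun x : Cube d => B.indicator (1 : Cube d → ℝ≥0∞) x :=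
      measurable_one.indicator hB
    have hmC : Measurable fun x : Cube d =>
        ENNReal.ofReal (16 * Δ ^ 2) * (B.indicator 1 x * ENNReal.ofReal t) :=
      measurable_const.mul (hmB.mul_const _)
    calc (1 : ℝ≥0∞) = ∫⁻ _, 1 ∂μ := by simp
      _ ≤ ∫⁻ x, (∫⁻ k, I x k ∂η x +
          ENNReal.ofReal (16 * Δ ^ 2) * (B.indicator 1 x * ENNReal.ofReal t)) ∂μ :=
          lintegral_mono_ae hstep
      _ = ∫⁻ x, ∫⁻ k, I x k ∂η x ∂μ + ENNReal.ofReal (16 * Δ ^ 2 * (t * μ.real B)) := by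
          rw [lintegral_add_right _ hmC,
            lintegral_const_mul _ (hmB.mul_const _), lintegral_mul_const _ hmB,
            lintegral_indicator_one hB, ENNReal.ofReal_mul h16, ENNReal.ofReal_mul ht,
            measureReal_def, ENNReal.ofReal_toReal (measure_ne_top _ _), mul_comm (μ B)]
  rw [ENNReal.ofReal_sub _ (by positivity), ENNReal.ofReal_one]
  exact tsub_le_iff_right.2 hfin

end bernBandit

end TransferBandit

/-! ### The family of perturbed bandits: membership in the class and its regret bound. -/

namespace TransferBandit

open Finset

namespace Bandit

variable {d K : ℕ} {M : Bandit d K} {k₁ : Fin K} {u p : Cube d → ℝ}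

lemma fmax_eq (hK : 2 ≤ K) (hf : ∀ k x, M.f k x = u x + if k = k₁ then p x else 0) (x : Cube d) :
    M.fmax x = u x + max (p x) 0 := by
  have : Nontrivial (Fin K) := Fin.nontrivial_iff_two_le.2 hK
  obtain ⟨k₀, hk₀⟩ := exists_ne k₁
  have hbdd : BddAbove (Set.range fun k => M.f k x) := Set.finite_range _ |>.bddAbove
  refine le_antisymm (ciSup_le fun k => ?_) ?_
  · rw [hf]
    split_ifs
    · linarith [le_max_left (p x) 0]
    · linarith [le_max_right (p x) 0]
  · have h1 : M.f k₁ x ≤ M.fmax x := le_ciSup hbdd k₁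
    have h2 : M.f k₀ x ≤ M.fmax x := le_ciSup hbdd k₀
    rw [hf, if_pos rfl] at h1
    rw [hf, if_neg hk₀] at h2
    rcases max_cases (p x) 0 with h | h <;> rw [h.1] <;> linarith

/-- Only the values `u x` and `u x + p x` occur. If they coincide, the convention for `fsnd` makes
the gap `0`; otherwise the only value below the maximum is the smaller one. -/
lemma fmax_sub_fsnd (hK : 2 ≤ K) (hf : ∀ k x, M.f k x = u x + if k = k₁ then p x else 0)
    {x : Cube d} (hx : 0 < M.fmax x - M.fsnd x) : p x ≠ 0 ∧ M.fmax x - M.fsnd x = |p x| := by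
  have : Nontrivial (Fin K) := Fin.nontrivial_iff_two_le.2 hK
  obtain ⟨k₀, hk₀⟩ := exists_ne k₁
  have hmax := fmax_eq hK hf x
  have hp : p x ≠ 0 := by
    intro h0
    have hno : ¬ ∃ k, M.f k x < M.fmax x := by
      rintro ⟨k, hk⟩
      rw [hmax, hf, h0] at hk
      simp at hk
    rw [fsnd, if_neg hno] at hx
    linarith
  refine ⟨hp, ?_⟩
  have hset : {v | v < M.fmax x ∧ ∃ k, M.f k x = v} = {u x + min (p x) 0} := by
    ext v
    rw [Set.mem_ofPred_eq, Set.mem_singleton_iff]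
    constructor
    · rintro ⟨hv, k, rfl⟩
      rw [hmax, hf] at hv
      rw [hf]
      split_ifs at hv ⊢ with h
      · have : p x < max (p x) 0 := by linarith
        rw [min_eq_left]
        rcases lt_max_iff.1 this with h' | h'
        · exact absurd h' (lt_irrefl _)
        · exact h'.le
      · have : 0 < max (p x) 0 := by linarith
        rw [min_eq_right]
        rcases lt_max_iff.1 this with h' | h'
        · exact h'.le
        · exact absurd h' (lt_irrefl _)
    · rintro rfl
      rw [hmax]
      refine ⟨?_, ?_⟩
      · rcases lt_or_gt_of_ne hp with h | h
        · rw [max_eq_right h.le, min_eq_left h.le]; linarith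
        · rw [max_eq_left h.le, min_eq_right h.le]; linarith
      · rcases lt_or_gt_of_ne hp with h | h
        · exact ⟨k₁, by rw [hf, if_pos rfl, min_eq_left h.le]⟩
        · exact ⟨k₀, by rw [hf, if_neg hk₀, min_eq_right h.le]⟩
  have hex : ∃ k, M.f k x < M.fmax x := by
    have hmem : u x + min (p x) 0 ∈ {v | v < M.fmax x ∧ ∃ k, M.f k x = v} := by
      rw [hset]; exact rfl
    obtain ⟨hlt, k, hk⟩ := hmem
    exact ⟨k, hk ▸ hlt⟩
  rw [fsnd, if_pos hex, hset, csSup_singleton, hmax, add_sub_add_left_eq_sub]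
  rcases lt_or_gt_of_ne hp with h | h
  · rw [max_eq_right h.le, min_eq_left h.le, abs_of_neg h]; ring
  · rw [max_eq_left h.le, min_eq_right h.le, abs_of_pos h]; ring

end Bandit

namespace Grid

variable (G : Grid) {d K : ℕ} (S : Finset (Fin d → Fin G.N)) (σ : (Fin d → Fin G.N) → Bool)
  {β c₀ c₁ : ℝ} (k₁ : Fin K)

/-- The mean reward functions: all are equal to `base`, except that of the arm `k₁`. -/
noncomputable def armMean (β c₀ c₁ : ℝ) (k : Fin K) (x : Cube d) : ℝ :=
  base β c₁ x + if k = k₁ then G.pert S σ β c₀ x else 0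

lemma continuous_armMean (hβ : 0 < β) (k : Fin K) :
    Continuous (G.armMean S σ k₁ β c₀ c₁ k) := by
  unfold armMean
  refine (continuous_base hβ).add ?_
  split_ifs
  · exact G.continuous_pert S σ hβ c₀
  · exact continuous_const

lemma w_rpow_le_one (hβ : 0 < β) : G.w ^ β ≤ 1 := by
  refine Real.rpow_le_one G.w_pos.le ?_ hβ.le
  have := G.pt_mem (j := 0) (f := 0) le_rfl (by have := G.two_le; omega) le_rfl zero_le_one
  linarith [this.1, this.2, G.s_lt_one]

lemma armMean_mem (hβ : 0 < β) (hc00 : 0 ≤ c₀) (hc08 : c₀ ≤ 1 / 8) (hc10 : 0 ≤ c₁)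
    (hc14 : c₁ ≤ 1 / 4) (k : Fin K) (x : Cube d) :
    G.armMean S σ k₁ β c₀ c₁ k x ∈ Set.Icc (1 / 8 : ℝ) (7 / 8) := by
  have h1 := base_mem (d := d) hβ hc10 hc14 x
  have h2 := abs_le.1 (G.abs_pert_le S σ hβ hc00 x)
  have h3 := mul_le_mul hc08 (G.w_rpow_le_one hβ) (Real.rpow_nonneg G.w_pos.le β) (by norm_num)
  unfold armMean
  split_ifs <;> constructor <;> linarith [h1.1, h1.2, h2.1, h2.2]

lemma pert_ae_eq (hd : 1 ≤ d) (hβ : 0 < β) (c₀ : ℝ) (j : Fin d → Fin G.N) {x : Cube d}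
    (hx : (∃ i, x ∈ G.box i) ∨ ∀ i, x i ∈ G.gaps) (hj : x ∉ G.box j) :
    G.pert S σ β c₀ x = G.pert S (flip σ j) β c₀ x := by
  rcases hx with ⟨i, hi⟩ | hx
  · have hij : i ≠ j := fun h => hj (h ▸ hi)
    by_cases hiS : i ∈ S
    · rw [G.pert_of_mem S σ hd hβ c₀ hiS hi, G.pert_of_mem S (flip σ j) hd hβ c₀ hiS hi]
      simp [flip, hij]
    · rw [G.pert_of_notMem S σ hβ c₀ hiS hi, G.pert_of_notMem S (flip σ j) hβ c₀ hiS hi]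
  · rw [G.pert_of_gaps S σ hd hβ c₀ hx, G.pert_of_gaps S (flip σ j) hd hβ c₀ hx]

end Grid

/-- The conditions on the parameters of the perturbed bandits. -/
structure Admissible (d K : ℕ) (β Cβ c₀ c₁ κ : ℝ) : Prop where
  one_le_d : 1 ≤ d
  two_le_K : 2 ≤ K
  β_pos : 0 < β
  β_le : β ≤ 1
  c₀_pos : 0 < c₀
  c₀_le : c₀ ≤ 1 / 8
  c₀_le' : c₀ ≤ Cβ / 4
  c₁_nonneg : 0 ≤ c₁
  c₁_le : c₁ ≤ 1 / 4
  c₁_le' : c₁ ≤ Cβ / 2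
  κ_nonneg : 0 ≤ κ
  κ_le : κ ≤ 1

namespace Admissible

variable {d K : ℕ} {β Cβ c₀ c₁ κ : ℝ}

/-- The perturbed bandit with signs `σ` on the cells in `S`. -/
noncomputable def bandit (A : Admissible d K β Cβ c₀ c₁ κ) (G : Grid)
    (S : Finset (Fin d → Fin G.N)) (P : Measure (Cube d)) [IsProbabilityMeasure P] (k₁ : Fin K)
    (σ : (Fin d → Fin G.N) → Bool) : Bandit d K :=
  have := isProbabilityMeasure_armLaw A.two_le_K k₁ A.κ_nonneg A.κ_le
  bernBandit (G.target d) P (armLaw k₁ κ) (G.armMean S σ k₁ β c₀ c₁)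
    (G.continuous_armMean S σ k₁ A.β_pos)
    (G.armMean_mem S σ k₁ A.β_pos A.c₀_pos.le A.c₀_le A.c₁_nonneg A.c₁_le)

variable (A : Admissible d K β Cβ c₀ c₁ κ) (G : Grid) (S : Finset (Fin d → Fin G.N))
  (P : Measure (Cube d)) [IsProbabilityMeasure P] (k₁ : Fin K) (σ : (Fin d → Fin G.N) → Bool)

lemma bandit_f (k : Fin K) (x : Cube d) :
    (A.bandit G S P k₁ σ).f k x = base β c₁ x + if k = k₁ then G.pert S σ β c₀ x else 0 :=
  have := isProbabilityMeasure_armLaw A.two_le_K k₁ A.κ_nonneg A.κ_le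
  bernBandit_f
    (hm01 := G.armMean_mem S σ k₁ A.β_pos A.c₀_pos.le A.c₀_le A.c₁_nonneg A.c₁_le) k x

lemma gap_le {j : Fin d → Fin G.N} (hj : j ∈ S) {x : Cube d} (hx : x ∈ G.box j) {k : Fin K}
    (hk : k ∈ badArms k₁ (σ j)) :
    c₀ * G.w ^ β ≤ (A.bandit G S P k₁ σ).fmax x - (A.bandit G S P k₁ σ).f k x := by
  rw [Bandit.fmax_eq A.two_le_K (A.bandit_f G S P k₁ σ) x, bandit_f,
    G.pert_of_mem S σ A.one_le_d A.β_pos c₀ hj hx]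
  cases hσ : σ j
  · have hk' : k = k₁ := by simpa [badArms, hσ] using hk
    rw [if_pos hk']
    simp only [Bool.false_eq_true, if_false]
    linarith [le_max_right (-(c₀ * G.w ^ β)) 0]
  · have hk' : k ≠ k₁ := by simpa [badArms, hσ] using hk
    rw [if_neg hk']
    simp only [if_true]
    linarith [le_max_left (c₀ * G.w ^ β) 0]

/-- On the cells the gap is either `0` or exactly `Δ`: for `δ < Δ` the event is null, and for `δ ≥
Δ` it is contained, up to a null set, in the selected cells. -/
lemma margin {α Cα : ℝ} (hα : 0 ≤ α) (hCα : 0 < Cα)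
    (hS : #S * (1 / (G.N : ℝ)) ^ d ≤ Cα * (c₀ * G.w ^ β) ^ α) {δ : ℝ} (hδ : 0 < δ) :
    (G.target d).real {x | 0 < (A.bandit G S P k₁ σ).fmax x - (A.bandit G S P k₁ σ).fsnd x ∧
      (A.bandit G S P k₁ σ).fmax x - (A.bandit G S P k₁ σ).fsnd x ≤ δ} ≤ Cα * δ ^ α := by
  set E := {x | 0 < (A.bandit G S P k₁ σ).fmax x - (A.bandit G S P k₁ σ).fsnd x ∧
      (A.bandit G S P k₁ σ).fmax x - (A.bandit G S P k₁ σ).fsnd x ≤ δ} with hE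
  set Δ := c₀ * G.w ^ β with hΔ
  have hΔ0 : 0 < Δ := mul_pos A.c₀_pos (Real.rpow_pos_of_pos G.w_pos β)
  have hmem : ∀ x, (∃ j, x ∈ G.box j) → x ∈ E → Δ ≤ δ ∧ x ∈ ⋃ j ∈ S, G.box j := by
    rintro x ⟨j, hj⟩ ⟨h1, h2⟩
    obtain ⟨hp, heq⟩ := Bandit.fmax_sub_fsnd A.two_le_K (A.bandit_f G S P k₁ σ) h1
    have hjS : j ∈ S := by
      by_contra h
      exact hp (G.pert_of_notMem S σ A.β_pos c₀ h hj)
    refine ⟨?_, Set.mem_biUnion hjS hj⟩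
    rw [heq, G.pert_of_mem S σ A.one_le_d A.β_pos c₀ hjS hj] at h2
    split_ifs at h2
    · rwa [abs_of_pos hΔ0] at h2
    · rwa [abs_neg, abs_of_pos hΔ0] at h2
  have hae : ∀ᵐ x ∂G.target d, ∃ j, x ∈ G.box j := by
    filter_upwards [G.ae_target_mem] with x hx
    exact G.exists_box hx
  by_cases hle : Δ ≤ δ
  · have h1 : G.target d E ≤ G.target d (⋃ j ∈ S, G.box j) := by
      refine measure_mono_ae ?_
      filter_upwards [hae] with x hx hxE
      exact (hmem x hx hxE).2
    have h2 : (G.target d).real E ≤ (G.target d).real (⋃ j ∈ S, G.box j) :=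
      ENNReal.toReal_mono (measure_ne_top _ _) h1
    calc (G.target d).real E ≤ _ := h2
      _ ≤ ∑ j ∈ S, (G.target d).real (G.box j) := measureReal_biUnion_finset_le _ _
      _ = #S * (1 / (G.N : ℝ)) ^ d := by simp_rw [G.target_box]; simp
      _ ≤ Cα * Δ ^ α := hS
      _ ≤ Cα * δ ^ α :=
        mul_le_mul_of_nonneg_left (Real.rpow_le_rpow hΔ0.le hle hα) hCα.le
  · have h1 : G.target d E = 0 := by
      refine measure_eq_zero_iff_ae_notMem.2 ?_
      filter_upwards [hae] with x hx hxE
      exact hle (hmem x hx hxE).1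
    rw [measureReal_def, h1, ENNReal.toReal_zero]
    positivity

lemma inClass {α Cα qlo qhi : ℝ} {γ : ℝ≥0∞} {cγ : ℝ} (l₀ : ℝ) (hα : 0 ≤ α) (hCα : 0 < Cα)
    (hqlo : qlo ≤ 1) (hqhi : (2 / G.a) ^ d ≤ qhi)
    (hP : IsTransferExponent (G.target d) P γ cγ)
    (hP0 : ∀ r : ℝ, 0 < r → 0 < P (Metric.closedBall 0 r))
    (hS : #S * (1 / (G.N : ℝ)) ^ d ≤ Cα * (c₀ * G.w ^ β) ^ α) :
    InClass β Cβ α Cα qlo qhi γ cγ κ l₀ (c₁ / 2) (A.bandit G S P k₁ σ) where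
  smooth k x x' := by
    rw [bandit_f, bandit_f]
    have h1 := abs_base_sub_le A.β_pos A.β_le A.c₁_nonneg x x'
    have h2 := G.abs_pert_sub_le S σ A.β_pos A.β_le A.c₀_pos.le x x'
    have h0 : 0 ≤ dist x x' ^ β := Real.rpow_nonneg dist_nonneg β
    have h3 : c₁ * dist x x' ^ β ≤ Cβ / 2 * dist x x' ^ β :=
      mul_le_mul_of_nonneg_right A.c₁_le' h0
    have h4 : 2 * c₀ * dist x x' ^ β ≤ Cβ / 2 * dist x x' ^ β :=
      mul_le_mul_of_nonneg_right (by linarith [A.c₀_le']) h0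
    have h5 : 0 ≤ 2 * c₀ * dist x x' ^ β := by have := A.c₀_pos; positivity
    split_ifs
    · rw [add_sub_add_comm]
      exact (abs_add_le _ _).trans (by linarith)
    · rw [add_zero, add_zero]
      linarith
  margin δ hδ _ := A.margin G S P k₁ σ hα hCα hS hδ
  density x hx r hr hr1 := by
    have hx' : ∀ i, x i ∈ G.range := fun i => G.support_subset hx i
    have hrd : 0 ≤ r ^ d := by positivity
    refine ⟨?_, ?_⟩
    · exact (mul_le_of_le_one_left hrd hqlo).trans (G.le_target_closedBall hx' hr hr1)
    · refine (G.target_closedBall_le x hr.le).trans ?_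
      rw [mul_pow]
      exact mul_le_mul_of_nonneg_right hqhi hrd
  transfer := hP
  explore := by
    have hK : (2 : ℝ) ≤ K := by exact_mod_cast A.two_le_K
    have hK0 : (K : ℝ) ≠ 0 := by linarith
    have hmass : ∀ k x, ((A.bandit G S P k₁ σ).behav x).real {k} =
        if k = k₁ then κ / K else (1 - κ / K) / (K - 1) := by
      intro k x
      change (armLaw k₁ κ).real {k} = _
      rw [measureReal_def, armLaw_singleton,
        ENNReal.toReal_ofReal (armWeight_nonneg A.two_le_K k₁ k A.κ_nonneg A.κ_le)]
    refine ⟨?_, fun v hv => hv ⟨k₁, 0, G.mem_support fun _ => G.zero_mem_range, ?_⟩⟩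
    · rintro v ⟨k, x, _, rfl⟩
      rw [hmass]
      split_ifs
      · rw [mul_div_cancel₀ _ hK0]
      · have h1 : (K : ℝ) * ((1 - κ / K) / (K - 1)) = (K - κ) / (K - 1) := by
          have : (K : ℝ) - 1 ≠ 0 := by linarith
          field_simp
        rw [h1, le_div_iff₀ (by linarith)]
        -- The other arms have `(K - κ)/(K - 1) ≥ κ` because `κ ≤ 1`; the infimum is attained at
        -- `k₁`.
        nlinarith [A.κ_nonneg, A.κ_le]
    · rw [hmass, if_pos rfl, mul_div_cancel₀ _ hK0]
  selfSimilar := by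
    have : Nontrivial (Fin K) := Fin.nontrivial_iff_two_le.2 A.two_le_K
    obtain ⟨k₀, hk₀⟩ := exists_ne k₁
    have hf : (A.bandit G S P k₁ σ).f k₀ = base β c₁ := by
      funext x
      rw [bandit_f, if_neg hk₀, add_zero]
    refine ⟨k₀, ?_⟩
    rw [hf]
    refine ⟨selfSimilar_base A.one_le_d A.β_pos l₀ (G.target d) fun r hr => ?_,
      selfSimilar_base A.one_le_d A.β_pos l₀ P hP0⟩
    have h0 := G.mem_support (d := d) (x := 0) fun _ => G.zero_mem_range
    exact (Measure.mem_support_iff_forall _).1 h0 _ (Metric.closedBall_mem_nhds _ hr)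

lemma rewardDensity (j : Fin d → Fin G.N) :
    Bandit.RewardDensity (A.bandit G S P k₁ σ) (A.bandit G S P k₁ (flip σ j))
      (obsRatio (G.armMean S σ k₁ β c₀ c₁) (G.armMean S (flip σ j) k₁ β c₀ c₁)) :=
  have := isProbabilityMeasure_armLaw A.two_le_K k₁ A.κ_nonneg A.κ_le
  rewardDensity_bernBandit
    (hm01 := G.armMean_mem S σ k₁ A.β_pos A.c₀_pos.le A.c₀_le A.c₁_nonneg A.c₁_le)
    (hm01' := G.armMean_mem S (flip σ j) k₁ A.β_pos A.c₀_pos.le A.c₀_le A.c₁_nonneg A.c₁_le)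

lemma le_affinity_flip (A : Admissible d K β Cβ c₀ c₁ κ) (j : Fin d → Fin G.N) {t : ℝ} (ht : 0 ≤ t) (μ : Measure (Cube d))
    [IsProbabilityMeasure μ] (hμ : ∀ᵐ x ∂μ, (∃ i, x ∈ G.box i) ∨ ∀ i, x i ∈ G.gaps)
    (η : Cube d → Measure (Fin K)) (hη : ∀ x, IsProbabilityMeasure (η x))
    (hη1 : ∀ x, η x {k₁} ≤ ENNReal.ofReal t) :
    ENNReal.ofReal (1 - 16 * (c₀ * G.w ^ β) ^ 2 * (t * μ.real (G.box j))) ≤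
      ∫⁻ x, ∫⁻ k, ∫⁻ y, obsRatio (G.armMean S σ k₁ β c₀ c₁)
        (G.armMean S (flip σ j) k₁ β c₀ c₁) (x, k, y) ^ (1 / 2 : ℝ)
          ∂bern (G.armMean S σ k₁ β c₀ c₁ k x) ∂η x ∂μ := by
  refine le_affinity k₁ (G.measurableSet_box j) ht
    (G.armMean_mem S σ k₁ A.β_pos A.c₀_pos.le A.c₀_le A.c₁_nonneg A.c₁_le)
    (G.armMean_mem S (flip σ j) k₁ A.β_pos A.c₀_pos.le A.c₀_le A.c₁_nonneg A.c₁_le)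
    (fun x => ?_) (fun k x hk => ?_) μ ?_ η hη hη1
  · simp only [Grid.armMean, if_true, add_sub_add_left_eq_sub]
    have h1 := abs_le.1 (G.abs_pert_le S σ A.β_pos A.c₀_pos.le x)
    have h2 := abs_le.1 (G.abs_pert_le S (flip σ j) A.β_pos A.c₀_pos.le x)
    rw [abs_le]
    constructor <;> linarith [h1.1, h1.2, h2.1, h2.2]
  · simp only [Grid.armMean, if_neg hk]
  · filter_upwards [hμ] with x hx hxj
    simp only [Grid.armMean, if_true]
    rw [G.pert_ae_eq S σ A.one_le_d A.β_pos c₀ j hx hxj]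

/-- The regret bound for the perturbed bandits, when the perturbation of a single cell cannot be
detected. -/
theorem le_of_regret_le {nP : ℕ} (π : Policy d K nP) (n : ℕ) {p : ℝ} (hp0 : 0 ≤ p) (hp1 : p ≤ 1)
    (hPbox : ∀ j ∈ S, P.real (G.box j) ≤ p)
    (hPae : ∀ᵐ x ∂P, (∃ j, x ∈ G.box j) ∨ ∀ i, x i ∈ G.gaps)
    (hsrc : nP * (16 * (c₀ * G.w ^ β) ^ 2 * (κ * p)) ≤ 1 / 4)
    (htgt : n * (16 * (c₀ * G.w ^ β) ^ 2 * (1 / (G.N : ℝ)) ^ d) ≤ 1 / 4)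
    (V : ℝ≥0∞) (hV : ∀ σ, (A.bandit G S P k₁ σ).regret π n ≤ V) :
    ENNReal.ofReal (n * (#S * (c₀ * G.w ^ β * (1 / (G.N : ℝ)) ^ d)) / 16) ≤ V := by
  set Δ := c₀ * G.w ^ β with hΔ
  have hN := G.N_pos
  have hΔ0 : 0 < Δ := mul_pos A.c₀_pos (Real.rpow_pos_of_pos G.w_pos β)
  have hΔ8 : Δ ≤ 1 / 8 := by
    have := mul_le_mul A.c₀_le (G.w_rpow_le_one A.β_pos) (Real.rpow_nonneg G.w_pos.le β)
      (by norm_num)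
    linarith
  have hΔ2 : 16 * Δ ^ 2 ≤ 1 / 4 := by nlinarith
  set q : ℝ := (1 / (G.N : ℝ)) ^ d with hq
  have hq0 : 0 < q := by positivity
  have hq1 : q ≤ 1 := by
    refine pow_le_one₀ (by positivity) ?_
    rw [div_le_one hN]
    have : (2 : ℝ) ≤ G.N := by exact_mod_cast G.two_le
    linarith
  have hκp0 : 0 ≤ κ * p := mul_nonneg A.κ_nonneg hp0
  have hκp1 : κ * p ≤ 1 := mul_le_one₀ A.κ_le hp0 hp1
  set ya : ℝ := 16 * Δ ^ 2 * (κ * p) with hya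
  set yc : ℝ := 16 * Δ ^ 2 * q with hyc
  have hya0 : 0 ≤ ya := by positivity
  have hyc0 : 0 ≤ yc := by positivity
  -- This does not follow from the budget when `nP = 0`; it comes from `Δ ≤ 1/8` and `p ≤ 1`.
  have hya1 : ya ≤ 1 / 4 := by nlinarith
  have hyc1 : yc ≤ 1 / 4 := by nlinarith
  have hqe : ∀ j, G.target d (G.box j) = ENNReal.ofReal q := fun j => by
    have h : (G.target d).real (G.box j) = q := G.target_box j
    rw [← h, measureReal_def, ENNReal.ofReal_toReal (measure_ne_top _ _)]
  have hmain := Bandit.assouad S (A.bandit G S P k₁) k₁ G.measurableSet_box G.box_disjoint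
    (ENNReal.ofReal Δ) (ENNReal.ofReal q) (ENNReal.ofReal (1 - ya)) (ENNReal.ofReal (1 - yc))
    (by rw [ENNReal.ofReal_le_one]; linarith) (fun σ j _ => (hqe j).ge)
    (fun σ j hj x hx k hk => ENNReal.ofReal_le_ofReal (A.gap_le G S P k₁ σ hj hx hk)) π
    (fun σ j hj => ?_) n V hV
  · rw [← ENNReal.ofReal_pow (by linarith), ← ENNReal.ofReal_pow (by linarith),
      ← ENNReal.ofReal_mul (pow_nonneg (by linarith) _),
      ← ENNReal.ofReal_pow (mul_nonneg (pow_nonneg (by linarith) _) (pow_nonneg (by linarith) _)),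
      ← ENNReal.ofReal_mul hΔ0.le, ← ENNReal.ofReal_mul (by positivity),
      ← ENNReal.ofReal_natCast n, ← ENNReal.ofReal_natCast #S, ← ENNReal.ofReal_mul (by positivity),
      ← ENNReal.ofReal_mul (by positivity)] at hmain
    have h4 : (4 : ℝ≥0∞) = ENNReal.ofReal 4 := by norm_num
    -- By Bernoulli's inequality each of the two samples has affinity at least `3/4`; the squared
    -- product exceeds `1/4`, which with the `4` of Assouad's lemma gives the factor `1/16`.
    have hb : ∀ (m : ℕ) (y : ℝ), y ≤ 1 / 4 → m * y ≤ 1 / 4 → 3 / 4 ≤ (1 - y) ^ m := by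
      intro m y hy hmy
      have := one_add_mul_le_pow (a := -y) (by linarith) m
      rw [← sub_eq_add_neg] at this
      linarith
    have ha := hb nP ya hya1 hsrc
    have hc := hb n yc hyc1 htgt
    have hac : 1 / 4 ≤ ((1 - ya) ^ nP * (1 - yc) ^ n) ^ 2 := by
      have : 9 / 16 ≤ (1 - ya) ^ nP * (1 - yc) ^ n := by nlinarith
      nlinarith
    have hle : 4 * (n * (#S * (Δ * q)) / 16) ≤
        n * (#S * (Δ * q * ((1 - ya) ^ nP * (1 - yc) ^ n) ^ 2)) := by
      have h0 : 0 ≤ (n : ℝ) * (#S * (Δ * q)) := by positivity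
      nlinarith
    have h5 := (ENNReal.ofReal_le_ofReal hle).trans hmain
    rw [ENNReal.ofReal_mul (by norm_num), h4] at h5
    exact (ENNReal.mul_le_mul_iff_right (by simp) ENNReal.ofReal_ne_top).1 h5
  · refine ⟨_, A.rewardDensity G S P k₁ σ j, ?_, fun t h => ?_⟩
    · rw [Bandit.lintegral_sourceLaw _ ((A.rewardDensity G S P k₁ σ j).meas.pow_const _)]
      have hprob := isProbabilityMeasure_armLaw A.two_le_K k₁ A.κ_nonneg A.κ_le
      refine le_trans (ENNReal.ofReal_le_ofReal ?_) (A.le_affinity_flip G S k₁ σ j A.κ_nonneg P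
        hPae (fun _ => armLaw k₁ κ) (fun _ => hprob) fun _ => ?_)
      · have : κ * P.real (G.box j) ≤ κ * p :=
          mul_le_mul_of_nonneg_left (hPbox j hj) A.κ_nonneg
        have := mul_le_mul_of_nonneg_left this (by positivity : 0 ≤ 16 * Δ ^ 2)
        linarith
      · rw [armLaw_singleton, if_pos rfl]
        refine ENNReal.ofReal_le_ofReal (div_le_self A.κ_nonneg ?_)
        exact_mod_cast (by have := A.two_le_K; omega : 1 ≤ K)
    · rw [Bandit.lintegral_stepKernel _ _ _ _ ((A.rewardDensity G S P k₁ σ j).meas.pow_const _)]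
      have hae : ∀ᵐ x ∂G.target d, (∃ i, x ∈ G.box i) ∨ ∀ i, x i ∈ G.gaps := by
        filter_upwards [G.ae_target_mem] with x hx
        exact Or.inl (G.exists_box hx)
      refine le_trans (ENNReal.ofReal_le_ofReal ?_) (A.le_affinity_flip G S k₁ σ j zero_le_one
        (G.target d) hae (fun x => π.act t (h, x)) (fun _ => inferInstance) fun _ => ?_)
      · rw [G.target_box, one_mul]
      · rw [ENNReal.ofReal_one]; exact prob_le_one

end Admissible

end TransferBandit

/-! ### Calibration of the grid size and of the number of cells. -/

namespace TransferBandit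

open Finset

/-- A ball of radius `r` in the full cube can already have volume `(2r) ^ d`; the strict excess of
`qhi` over `2 ^ d` is what leaves room for gaps. -/
lemma exists_filling {d : ℕ} (hd : 1 ≤ d) {qhi : ℝ} (hq : (2 : ℝ) ^ d < qhi) :
    ∃ a : ℝ, 1 / 2 ≤ a ∧ a < 1 ∧ (2 / a) ^ d ≤ qhi := by
  have hq0 : 0 < qhi := lt_trans (by positivity) hq
  set ρ := qhi ^ ((d : ℝ)⁻¹) with hρ
  have hρd : ρ ^ d = qhi := Real.rpow_inv_natCast_pow hq0.le (by omega)
  have hρ0 : 0 < ρ := Real.rpow_pos_of_pos hq0 _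
  have hρ2 : 2 < ρ := lt_of_pow_lt_pow_left₀ d hρ0.le (by rw [hρd]; exact hq)
  refine ⟨max (1 / 2) (2 / ρ), le_max_left _ _, max_lt (by norm_num) ?_, ?_⟩
  · rw [div_lt_one hρ0]; exact hρ2
  · rw [← hρd]
    refine pow_le_pow_left₀ (by positivity) ?_ d
    rw [div_le_iff₀ (lt_of_lt_of_le (by norm_num) (le_max_left _ _))]
    have := mul_le_mul_of_nonneg_left (le_max_right (1 / 2) (2 / ρ)) hρ0.le
    rwa [mul_div_cancel₀ _ hρ0.ne'] at this

/-- The cell at the origin is never selected: for `γ = ∞` it carries all the source mass. -/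
lemma exists_cells (G : Grid) {d m : ℕ} (hm : m ≤ G.N ^ d - 1) :
    ∃ S : Finset (Fin d → Fin G.N), #S = m ∧ ∀ j ∈ S, ∃ i, (j i : ℕ) ≠ 0 := by
  have hN := G.two_le
  let z : Fin d → Fin G.N := fun _ => ⟨0, by omega⟩
  have hcard : m ≤ #(Finset.univ.erase z) := by
    rw [Finset.card_erase_of_mem (Finset.mem_univ z)]
    simpa using hm
  obtain ⟨S, hS, hSm⟩ := Finset.exists_subset_card_eq hcard
  refine ⟨S, hSm, fun j hj => ?_⟩
  by_contra hcon
  push Not at hcon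
  exact (Finset.mem_erase.1 (hS hj)).1 (funext fun i => Fin.ext (hcon i))

/-- Rounding down a number `≥ 1` costs at most a factor `2`, and so does giving up one of the `N ^ d
≥ 2` cells. -/
lemma exists_card {d N : ℕ} (hd : 1 ≤ d) (hN : 2 ≤ N) {θ k : ℝ} (hθ : θ ≤ d) (hk : k ≤ 1)
    (h1 : 1 ≤ k * (N : ℝ) ^ θ) :
    ∃ m : ℕ, m ≤ N ^ d - 1 ∧ (m : ℝ) ≤ k * (N : ℝ) ^ θ ∧ k * (N : ℝ) ^ θ / 2 ≤ m := by
  set y := k * (N : ℝ) ^ θ with hy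
  have hN' : (2 : ℝ) ≤ N := by exact_mod_cast hN
  have hNd : 2 ≤ N ^ d := hN.trans (Nat.le_self_pow (by omega) N)
  have hyN : y ≤ (N : ℝ) ^ d := by
    have h2 : (N : ℝ) ^ θ ≤ (N : ℝ) ^ (d : ℝ) :=
      Real.rpow_le_rpow_of_exponent_le (by linarith) hθ
    rw [Real.rpow_natCast] at h2
    have h3 : 0 ≤ (N : ℝ) ^ θ := by positivity
    nlinarith
  refine ⟨min ⌊y⌋₊ (N ^ d - 1), min_le_right _ _, ?_, ?_⟩
  · exact (Nat.cast_le.2 (min_le_left _ _)).trans (Nat.floor_le (by linarith))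
  · rw [Nat.cast_min]
    refine le_min ?_ ?_
    · have h2 := Nat.lt_floor_add_one y
      have h3 : (1 : ℝ) ≤ ⌊y⌋₊ := by exact_mod_cast (Nat.one_le_floor_iff y).2 h1
      linarith
    · rw [Nat.cast_sub (by omega)]
      have : (2 : ℝ) ≤ (N : ℝ) ^ d := by exact_mod_cast hNd
      push_cast
      linarith

lemma exists_threshold {θ k : ℝ} (hk : 0 < k) (h : 0 < θ ∨ (θ = 0 ∧ k = 1)) :
    ∃ N₁ : ℕ, ∀ N : ℕ, N₁ ≤ N → 1 ≤ k * (N : ℝ) ^ θ := by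
  rcases h with h | ⟨rfl, rfl⟩
  · have hlim : Filter.Tendsto (fun N : ℕ => k * (N : ℝ) ^ θ) Filter.atTop Filter.atTop :=
      ((tendsto_rpow_atTop h).comp tendsto_natCast_atTop_atTop).const_mul_atTop hk
    exact Filter.eventually_atTop.1 (hlim.eventually_ge_atTop 1)
  · exact ⟨0, fun N _ => by simp⟩

/-- A grid size that is large enough to hide a perturbation, but not larger than necessary. -/
lemma exists_size {N₀ : ℕ} (hN₀ : 1 ≤ N₀) {H E : ℝ} (hH : 1 ≤ H) (hE : 0 < E) :
    ∃ N : ℕ, N₀ ≤ N ∧ (∃ u : ℝ, (N : ℝ) = N₀ * u ∧ H ^ (1 / E) ≤ u) ∧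
      (N : ℝ) ≤ 2 * N₀ * H ^ (1 / E) := by
  have h1 : 1 ≤ H ^ (1 / E) := Real.one_le_rpow hH (by positivity)
  set v := H ^ (1 / E)
  have h2 : v ≤ ⌈v⌉₊ := Nat.le_ceil v
  have h3 : (⌈v⌉₊ : ℝ) < v + 1 := Nat.ceil_lt_add_one (by linarith)
  have h4 : 1 ≤ ⌈v⌉₊ := Nat.one_le_ceil_iff.2 (by linarith)
  have h5 : (1 : ℝ) ≤ N₀ := by exact_mod_cast hN₀
  refine ⟨N₀ * ⌈v⌉₊, Nat.le_mul_of_pos_right _ h4, ⟨⌈v⌉₊, by push_cast; ring, h2⟩, ?_⟩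
  push_cast
  nlinarith

/-- Regret bound over a class of self-similar problems, for a fixed policy. -/
lemma le_iSup_regret {d K : ℕ} {β Cβ c₀ c₁ κ : ℝ} (A : Admissible d K β Cβ c₀ c₁ κ) (G : Grid)
    {α Cα qlo qhi : ℝ} {γ : ℝ≥0∞} {cγ l₀ : ℝ} (hα : 0 ≤ α) (hCα : 0 < Cα)
    (hqlo : qlo ≤ 1) (hqhi : (2 / G.a) ^ d ≤ qhi) {P : Measure (Cube d)}
    (hPp : IsProbabilityMeasure P)
    (hP : IsTransferExponent (G.target d) P γ cγ)
    (hP0 : ∀ r : ℝ, 0 < r → 0 < P (Metric.closedBall 0 r))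
    (hPae : ∀ᵐ x ∂P, (∃ j, x ∈ G.box j) ∨ ∀ i, x i ∈ G.gaps) {p : ℝ} (hp0 : 0 ≤ p)
    (hPbox : ∀ j : Fin d → Fin G.N, (∃ i, (j i : ℕ) ≠ 0) → P.real (G.box j) ≤ p)
    {m : ℕ} (hm : m ≤ G.N ^ d - 1)
    (hmar : m * (1 / (G.N : ℝ)) ^ d ≤ Cα * (c₀ * G.w ^ β) ^ α) {n nP : ℕ}
    (hsrc : nP * (16 * (c₀ * G.w ^ β) ^ 2 * (κ * p)) ≤ 1 / 4)
    (htgt : n * (16 * (c₀ * G.w ^ β) ^ 2 * (1 / (G.N : ℝ)) ^ d) ≤ 1 / 4) (π : Policy d K nP) :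
    ENNReal.ofReal (n * (m * (c₀ * G.w ^ β * (1 / (G.N : ℝ)) ^ d)) / 16) ≤
      ⨆ (M : Bandit d K) (_ : InClass β Cβ α Cα qlo qhi γ cγ κ l₀ (c₁ / 2) M), M.regret π n := by
  obtain ⟨S, rfl, hS0⟩ := exists_cells G hm
  have k₁ : Fin K := ⟨0, by have := A.two_le_K; omega⟩
  have hκ := A.κ_nonneg
  -- Masses are at most `1`, so the cell bound may be capped at `1` without harm to the budget.
  refine A.le_of_regret_le G S P k₁ π n (p := min 1 p) (le_min zero_le_one hp0) (min_le_left _ _)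
    (fun j hj => le_min measureReal_le_one (hPbox j (hS0 j hj))) hPae (le_trans ?_ hsrc) htgt _
    fun σ => ?_
  · gcongr
    exact min_le_right _ _
  · exact le_iSup₂_of_le (A.bandit G S P k₁ σ)
      (A.inClass G S P k₁ σ l₀ hα hCα hqlo hqhi hP hP0 hmar) le_rfl

end TransferBandit

set_option maxHeartbeats 1000000 in
open TransferBandit in
theorem theorem4 (d : ℕ) (hd : 1 ≤ d) (β Cβ qlo qhi : ℝ)
    (hβ : 0 < β) (hβ1 : β ≤ 1) (hCβ : 0 < Cβ)
    (hqlo : 0 < qlo) (hqlo1 : qlo ≤ 1) (hqhi : (2 : ℝ) ^ d < qhi) :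
    ∃ b : ℝ, 0 < b ∧ ∃ C₀ : ℝ, 0 < C₀ ∧
      ∀ (α Cα : ℝ), 0 ≤ α → α * β ≤ d → 0 < Cα → (α * β < d ∨ C₀ ≤ Cα) →
      ∀ (K : ℕ) (γ : ℝ≥0∞) (cγ κ l₀ : ℝ), 2 ≤ K → 0 < cγ → cγ ≤ 1 → 0 ≤ κ → κ ≤ 1 → 0 ≤ l₀ →
      ∃ c₁ : ℝ, 0 < c₁ ∧ ∀ nQ nP : ℕ,
        ENNReal.ofReal (c₁ * (nQ *
            ((nQ : ℝ) + (κ * nP) ^ TransferBandit.sourceExponent d β γ) ^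
              (-(β * (1 + α) / (2 * β + d))))) ≤
          ⨅ π : TransferBandit.Policy d K nP,
            ⨆ (M : TransferBandit.Bandit d K)
              (_ : TransferBandit.InClass β Cβ α Cα qlo qhi γ cγ κ l₀ b M),
              M.regret π nQ := by
  obtain ⟨a, ha, ha1, haq⟩ := exists_filling hd hqhi
  have hd' : (1 : ℝ) ≤ d := by exact_mod_cast hd
  set c₁ : ℝ := min (Cβ / 2) (1 / 4) with hc₁
  set c₀ : ℝ := min (Cβ / 4) (1 / 8) with hc₀
  have hc₁0 : 0 < c₁ := lt_min (by linarith) (by norm_num)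
  have hc₀0 : 0 < c₀ := lt_min (by linarith) (by norm_num)
  -- Normalized so that the gap between arms is `Δ = δ₀ N ^ (-β)`.
  set δ₀ : ℝ := c₀ * ((1 - a) / 4) ^ β with hδ₀
  have hbase : 0 < (1 - a) / 4 := by linarith
  have hδ₀0 : 0 < δ₀ := mul_pos hc₀0 (Real.rpow_pos_of_pos hbase β)
  have hδ₀8 : δ₀ ≤ 1 / 8 := by
    have h1 : ((1 - a) / 4) ^ β ≤ 1 := Real.rpow_le_one hbase.le (by linarith) hβ.le
    have h2 : c₀ ≤ 1 / 8 := min_le_right _ _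
    have h3 : 0 < ((1 - a) / 4) ^ β := Real.rpow_pos_of_pos hbase β
    rw [hδ₀]
    nlinarith
  refine ⟨c₁ / 2, by linarith, δ₀ ^ (-(d / β : ℝ)), Real.rpow_pos_of_pos hδ₀0 _, ?_⟩
  intro α Cα hα hαβ hCα hcase K γ cγ κ l₀ hK hcγ hcγ1 hκ hκ1 _
  have A : Admissible d K β Cβ c₀ c₁ κ :=
    ⟨hd, hK, hβ, hβ1, hc₀0, min_le_right _ _, min_le_left _ _, hc₁0.le, min_le_right _ _,
      min_le_left _ _, hκ, hκ1⟩
  set k : ℝ := min (Cα * δ₀ ^ α) 1 with hk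
  have hk0 : 0 < k := lt_min (mul_pos hCα (Real.rpow_pos_of_pos hδ₀0 α)) one_pos
  -- At least one cell must be selected, that is `k N ^ (d - αβ) ≥ 1`. If `αβ < d` a large `N`
  -- suffices; if `αβ = d` this needs `k = 1`, and `C₀ = δ₀ ^ (-d/β)` is the value that makes `C₀ δ₀
  -- ^ α = 1`.
  have hθ : 0 < (d : ℝ) - α * β ∨ ((d : ℝ) - α * β = 0 ∧ k = 1) := by
    rcases hαβ.lt_or_eq with h | h
    · exact Or.inl (by linarith)
    · refine Or.inr ⟨by linarith, min_eq_right ?_⟩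
      have hC : δ₀ ^ (-(d / β : ℝ)) ≤ Cα := by
        rcases hcase with h' | h'
        · exact absurd h h'.ne
        · exact h'
      have hαd : α = d / β := by rw [← h]; field_simp
      calc (1 : ℝ) = δ₀ ^ (-(d / β : ℝ)) * δ₀ ^ α := by
            rw [← Real.rpow_add hδ₀0, hαd, neg_add_cancel, Real.rpow_zero]
        _ ≤ _ := mul_le_mul_of_nonneg_right hC (Real.rpow_nonneg hδ₀0.le α)
  obtain ⟨N₁, hN₁⟩ := exists_threshold hk0 hθ
  obtain ⟨B, hB0, N₂, hsource⟩ := exists_source hd ha ha1 γ hcγ hcγ1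
  -- `N` will be an integer multiple of `N₀`; the entry `⌈B⌉₊` lets this factor absorb the constant
  -- of the source masses.
  set N₀ : ℕ := max (max 2 N₁) (max N₂ ⌈B⌉₊) with hN₀
  have hN₀2 : 2 ≤ N₀ := (le_max_left _ _).trans (le_max_left _ _)
  have hN₀1 : N₁ ≤ N₀ := (le_max_right _ _).trans (le_max_left _ _)
  have hN₀s : N₂ ≤ N₀ := (le_max_left _ _).trans (le_max_right _ _)
  have hN₀B : B ≤ N₀ := (Nat.le_ceil B).trans
    (by exact_mod_cast (le_max_right _ _).trans (le_max_right (max 2 N₁) _))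
  have hN₀' : (2 : ℝ) ≤ N₀ := by exact_mod_cast hN₀2
  set E : ℝ := 2 * β + d with hE
  have hE0 : 0 < E := by linarith
  have hβα : 0 < β * (1 + α) := by positivity
  -- The `32` is the `16` of the regret bound times the `2` lost in rounding `m`; the power of `2 *
  -- N₀` comes from `N ≤ 2 N₀ H ^ (1/E)`.
  refine ⟨k * δ₀ / 32 * (2 * N₀) ^ (-(β * (1 + α))), by positivity, fun nQ nP => ?_⟩
  refine le_iInf fun π => ?_
  rcases Nat.eq_zero_or_pos nQ with hnQ | hnQ
  · simp [hnQ]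
  have hnQ' : (1 : ℝ) ≤ nQ := by exact_mod_cast hnQ
  set e := sourceExponent d β γ with he
  have hκn : 0 ≤ κ * nP := by positivity
  have hκe : 0 ≤ (κ * nP) ^ e := Real.rpow_nonneg hκn e
  set H : ℝ := nQ + (κ * nP) ^ e with hH
  have hH1 : 1 ≤ H := by linarith
  obtain ⟨N, hN0, ⟨u, hNu, hHu⟩, hNH⟩ := exists_size (by omega : 1 ≤ N₀) hH1 hE0
  let G : Grid := ⟨N, a, hN₀2.trans hN0, ha, ha1⟩
  obtain ⟨P, hPp, hP, hP0, hPbox, hPae⟩ := hsource G rfl (hN₀s.trans hN0)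
  have hN : (0 : ℝ) < N := G.N_pos
  have hv1 : 1 ≤ H ^ (1 / E) := Real.one_le_rpow hH1 (by positivity)
  have hu1 : 1 ≤ u := hv1.trans hHu
  have hw : c₀ * G.w ^ β = δ₀ * (N : ℝ) ^ (-β) := by
    have : G.w = (1 - a) / 4 / N := by rw [Grid.w, div_div]
    rw [this, Real.div_rpow hbase.le hN.le, Real.rpow_neg hN.le, hδ₀]
    ring
  have hNd : (1 / (N : ℝ)) ^ d = (N : ℝ) ^ (-(d : ℝ)) := by
    rw [Real.rpow_neg hN.le, Real.rpow_natCast, one_div, inv_pow]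
  obtain ⟨m, hm1, hm2, hm3⟩ := exists_card hd (hN₀2.trans hN0) (by nlinarith : (d : ℝ) - α * β ≤ d)
    (min_le_right _ _ : k ≤ 1) (hN₁ N (hN₀1.trans hN0))
  have huH : ∀ z : ℝ, 0 ≤ z → H ^ (z / E) ≤ u ^ z := by
    intro z hz
    calc H ^ (z / E) = (H ^ (1 / E)) ^ z := by
          rw [← Real.rpow_mul (by linarith)]; ring_nf
      _ ≤ u ^ z := Real.rpow_le_rpow (by linarith) hHu hz
  have hΔ2 : 16 * (c₀ * G.w ^ β) ^ 2 ≤ 1 / 4 * (N : ℝ) ^ (-(2 * β)) := by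
    have h1 : ((N : ℝ) ^ (-β)) ^ 2 = (N : ℝ) ^ (-(2 * β)) := by
      rw [← Real.rpow_natCast, ← Real.rpow_mul hN.le]; ring_nf
    rw [hw, mul_pow, h1, ← mul_assoc]
    refine mul_le_mul_of_nonneg_right ?_ (Real.rpow_nonneg hN.le _)
    linarith [pow_le_pow_left₀ hδ₀0.le hδ₀8 2]
  have htgt : nQ * (16 * (c₀ * G.w ^ β) ^ 2 * (1 / (N : ℝ)) ^ d) ≤ 1 / 4 := by
    have h1 : (nQ : ℝ) ≤ (N : ℝ) ^ E := by
      calc (nQ : ℝ) ≤ H := by linarith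
        _ = H ^ (E / E) := by rw [div_self hE0.ne', Real.rpow_one]
        _ ≤ u ^ E := huH E hE0.le
        _ ≤ (N : ℝ) ^ E := Real.rpow_le_rpow (by linarith) (by rw [hNu]; nlinarith) hE0.le
    calc nQ * (16 * (c₀ * G.w ^ β) ^ 2 * (1 / (N : ℝ)) ^ d)
        ≤ (N : ℝ) ^ E * (1 / 4 * (N : ℝ) ^ (-(2 * β)) * (N : ℝ) ^ (-(d : ℝ))) := by
          rw [hNd]; gcongr
      _ = 1 / 4 * ((N : ℝ) ^ E * ((N : ℝ) ^ (-(2 * β)) * (N : ℝ) ^ (-(d : ℝ)))) := by ring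
      _ = 1 / 4 := by
          rw [← Real.rpow_add hN, ← Real.rpow_add hN, hE]
          ring_nf
          simp
  have hmar : m * (1 / (N : ℝ)) ^ d ≤ Cα * (c₀ * G.w ^ β) ^ α := by
    rw [hw, hNd, Real.mul_rpow hδ₀0.le (Real.rpow_nonneg hN.le _), ← Real.rpow_mul hN.le]
    calc (m : ℝ) * (N : ℝ) ^ (-(d : ℝ))
        ≤ k * (N : ℝ) ^ ((d : ℝ) - α * β) * (N : ℝ) ^ (-(d : ℝ)) := by gcongr
      _ = k * (N : ℝ) ^ (-β * α) := by
          rw [mul_assoc, ← Real.rpow_add hN]; ring_nf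
      _ ≤ Cα * δ₀ ^ α * (N : ℝ) ^ (-β * α) := by gcongr; exact min_le_left _ _
      _ = _ := by ring
  have key : ∀ p : ℝ, 0 ≤ p →
      (∀ j : Fin d → Fin N, (∃ i, (j i : ℕ) ≠ 0) → P.real (G.box j) ≤ p) →
      nP * (16 * (c₀ * G.w ^ β) ^ 2 * (κ * p)) ≤ 1 / 4 →
      ENNReal.ofReal (nQ * (m * (c₀ * G.w ^ β * (1 / (N : ℝ)) ^ d)) / 16) ≤
        ⨆ (M : Bandit d K) (_ : InClass β Cβ α Cα qlo qhi γ cγ κ l₀ (c₁ / 2) M), M.regret π nQ :=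
    fun p hp0 hpbox hsrc => le_iSup_regret A G hα hCα hqlo1 haq hPp hP hP0 hPae hp0 hpbox hm1 hmar
      hsrc htgt π
  refine le_trans (ENNReal.ofReal_le_ofReal ?_) (key (if γ = ⊤ then 0 else
    B * (1 / (N : ℝ)) ^ γ.toReal * (1 / N) ^ d) (by split_ifs <;> positivity) hPbox ?_)
  · have hpow : (2 * N₀ : ℝ) ^ (-(β * (1 + α))) * H ^ (-(β * (1 + α) / E)) ≤
        (N : ℝ) ^ (-(β * (1 + α))) := by
      have h1 : H ^ (-(β * (1 + α) / E)) = (H ^ (1 / E)) ^ (-(β * (1 + α))) := by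
        rw [← Real.rpow_mul (by linarith)]; ring_nf
      rw [h1, ← Real.mul_rpow (by positivity) (by linarith)]
      exact Real.rpow_le_rpow_of_nonpos hN hNH (by linarith)
    have hprod : (N : ℝ) ^ (-(β * (1 + α))) =
        (N : ℝ) ^ ((d : ℝ) - α * β) * ((N : ℝ) ^ (-β) * (N : ℝ) ^ (-(d : ℝ))) := by
      rw [← Real.rpow_add hN, ← Real.rpow_add hN]; ring_nf
    rw [hw, hNd]
    calc k * δ₀ / 32 * (2 * N₀) ^ (-(β * (1 + α))) * (nQ * H ^ (-(β * (1 + α) / E)))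
        = nQ * (k * δ₀ / 32) * ((2 * N₀) ^ (-(β * (1 + α))) * H ^ (-(β * (1 + α) / E))) := by ring
      _ ≤ nQ * (k * δ₀ / 32) * (N : ℝ) ^ (-(β * (1 + α))) := by gcongr
      _ = nQ * (k * (N : ℝ) ^ ((d : ℝ) - α * β) / 2 *
          (δ₀ * (N : ℝ) ^ (-β) * (N : ℝ) ^ (-(d : ℝ)))) / 16 := by rw [hprod]; ring
      _ ≤ _ := by gcongr
  · by_cases htop : γ = ⊤
    · simp [htop]
    rw [if_neg htop]
    set g := γ.toReal with hg
    have hg0 : 0 ≤ g := ENNReal.toReal_nonneg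
    have hEg : 0 < E + g := by linarith
    have heq : e = E / (E + g) := by
      rw [he, sourceExponent, if_neg htop, hE, add_comm (d : ℝ)]
    -- The exponent `e = E/(E + g)` is exactly what turns `u ≥ H ^ (1/E)` into this bound, matching
    -- the source information `Δ² N ^ (-g-d)`, of order `N ^ (-(E+g))`.
    have h1 : κ * nP ≤ u ^ (E + g) := by
      calc κ * nP = ((κ * nP) ^ e) ^ ((E + g) / E) := by
            rw [← Real.rpow_mul hκn, heq, div_mul_div_cancel₀ hEg.ne', div_self hE0.ne',
              Real.rpow_one]
        _ ≤ H ^ ((E + g) / E) := Real.rpow_le_rpow hκe (by linarith) (by positivity)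
        _ ≤ u ^ (E + g) := huH _ hEg.le
    have h2 : B ≤ (N₀ : ℝ) ^ (E + g) := by
      calc B ≤ (N₀ : ℝ) ^ (1 : ℝ) := by rw [Real.rpow_one]; exact hN₀B
        _ ≤ _ := Real.rpow_le_rpow_of_exponent_le (by linarith) (by linarith)
    have h3 : B * (κ * nP) ≤ (N : ℝ) ^ (E + g) := by
      rw [hNu, Real.mul_rpow (by linarith) (by linarith)]
      exact mul_le_mul h2 h1 hκn (Real.rpow_nonneg (by linarith) _)
    have h4 : (1 / (N : ℝ)) ^ g = (N : ℝ) ^ (-g) := by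
      rw [one_div, Real.inv_rpow hN.le, Real.rpow_neg hN.le]
    calc nP * (16 * (c₀ * G.w ^ β) ^ 2 * (κ * (B * (1 / (N : ℝ)) ^ g * (1 / N) ^ d)))
        ≤ nP * (1 / 4 * (N : ℝ) ^ (-(2 * β)) *
            (κ * (B * (N : ℝ) ^ (-g) * (N : ℝ) ^ (-(d : ℝ))))) := by
          rw [hNd, h4]; gcongr
      _ = 1 / 4 * (B * (κ * nP) *
            ((N : ℝ) ^ (-(2 * β)) * ((N : ℝ) ^ (-g) * (N : ℝ) ^ (-(d : ℝ))))) := by ring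
      _ ≤ 1 / 4 * ((N : ℝ) ^ (E + g) *
            ((N : ℝ) ^ (-(2 * β)) * ((N : ℝ) ^ (-g) * (N : ℝ) ^ (-(d : ℝ))))) := by gcongr
      _ = 1 / 4 := by
          rw [← Real.rpow_add hN, ← Real.rpow_add hN, ← Real.rpow_add hN, hE]
          ring_nf
          simp
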